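/- **Setting.** Let $R=\mathtt R_e$ be a finite commutative chain ring (a finite commutative local ring whose maximal ideal $\langle\gamma\rangle$ is principal), with $\gamma^{e}=0\neq\gamma^{e-1}$ and residue field $\mathbb F=R/\langle\gamma\rangle$ of odd order $q$. Put $\mathtt R_n=R/\langle\gamma^n\rangle$, let $4\le\mu\le e$, and let $N_1,N_2\ge 1$. All matrices below have entries represented in $R$. *Codes.* For $2\le\mu\le e$, an $\mathtt R_\mu\mathtt R_{\mu-1}$-linear code of block-length $(N_1,N_2)$ is an $\mathtt R_\mu$-submodule $\mathscr C$ of $\mathtt R_\mu^{N_1}\oplus\mathtt R_{\mu-1}^{N_2}$. It is Euclidean self-orthogonal if $\sum_i c_ic_i'+\gamma\sum_j d_jd_j'=0$ in $\mathtt R_\mu$ for all $(c|d),(c'|d')\in\mathscr C$. *Block forms.* Let $n\ge 2$ and let $k_0,\dots,k_{n-1},\ell_0,\dots,\ell_{n-2}$ be non-negative integers. An $n$-block form consists of row blocks $[A_i\,|\,B_i]$ with $k_i$ rows ($0\le i\le n-1$) and $[C_j\,|\,D_j]$ with $\ell_j$ rows ($0\le j\le n-2$). After a permutation of the first $N_1$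 coordinates and a permutation of the last $N_2$ coordinates, the columns of $A$ and $C$ are grouped into blocks of sizes $k_0,\dots,k_{n-1},N_1-\sum_i k_i$, and those of $B$ and $D$ into blocks of sizes $\ell_0,\dots,\ell_{n-2},N_2-\sum_j\ell_j$. The blocks satisfy: $A_{i,j}=0$ for $j<i$ and $A_{i,i}=I$; $B_{i,j}=0$ for $j\le i$; $C_{i,j}=0$ for $j\le i+1$; $D_{i,j}=0$ for $j<i$ and $D_{i,i}=I$. Here $j$ runs over the column blocks other than the last one; all other entries are arbitrary. *Type and torsion codes.* The code $\mathscr C$ has type $\{k_0,\dots,k_{\mu-1};\ell_0,\dots,\ell_{\mu-2}\}$ if it is generated by the rows of all $\gamma^i[A_i|B_i]$ and $[\gamma^{j+1}C_j|\gamma^jD_j]$ for some $\mu$-block form. Then $\mathscr C^{(X)}\subseteq\mathtt R_\mu^{N_1}$ is the code generated by the rows of all $\gamma^iA_i$, and $\mathscr C^{(Y)}\subseteq\mathtt R_{\mu-1}^{N_2}$ is the code generated by the rows of all $\gamma^jD_j$. For a linear code $X$ over $\mathtt R_n$ put $Tor_i(X)=\{c \bmod \gamma:\gamma^{i-1}c\in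 X\}$ for $1\le i\le n$. The codes $Tor_i(\mathscr C^{(X)})$ and $Tor_j(\mathscr C^{(Y)})$ depend only on $\mathscr C$. *Lifts.* An $\mathtt R_\mu\mathtt R_{\mu-1}$-linear code $\mathscr C_\mu$ is a lift of an $\mathtt R_{\mu-2}\mathtt R_{\mu-3}$-linear code $\mathscr C_{\mu-2}$ (with respect to $k_0,\dots,k_{\mu-1};\ell_0,\dots,\ell_{\mu-2}$) if, for some $(\mu-1)$-block form with row blocks of sizes $k_0,\dots,k_{\mu-2}$ and $\ell_0,\dots,\ell_{\mu-3}$, - $\mathscr C_{\mu-2}$ is generated by the rows of $[A_0|B_0]$, $\gamma^{i-1}[A_i|B_i]$ for $1\le i\le\mu-2$, $[\gamma C_0|D_0]$ and $[\gamma^jC_j|\gamma^{j-1}D_j]$ for $1\le j\le\mu-3$, read in $\mathtt R_{\mu-2}^{N_1}\oplus\mathtt R_{\mu-3}^{N_2}$; - $\mathscr C_\mu$ is generated by the rows of $\gamma^i[A_i|B_i]$ for $0\le i\le\mu-2$, $[\gamma^{j+1}C_j|\gamma^jD_j]$ for $0\le j\le\mu-3$, $[\gamma^{\mu-1}T|0]$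 and $[\gamma^{\mu-1}J|\gamma^{\mu-2}U]$, read in $\mathtt R_\mu^{N_1}\oplus\mathtt R_{\mu-1}^{N_2}$, where $T$ has $k_{\mu-1}$ rows, $J$ and $U$ have $\ell_{\mu-2}$ rows, $T,J,U$ vanish outside the last column blocks, and $T$ and $U$ have full row rank modulo $\gamma$. *Notation.* Write $m_i(\mathbf k)=k_0+\dots+k_i$, and likewise for $\boldsymbol\ell$. Let $\mathscr K_{n,s}$ be the set of $s$-tuples of non-negative integers with $2(k_0+\dots+k_{s-1-i})+k_{s-i}+\dots+k_i\le n$ for $\lfloor s/2\rfloor\le i\le s-1$. Let $\begin{bmatrix}n\\s\end{bmatrix}_q=\prod_{i=0}^{s-1}\frac{q^n-q^i}{q^s-q^i}$, and let $\mathfrak N_\mu(N_1,N_2;\mathbf k;\boldsymbol\ell)$ be the number of Euclidean self-orthogonal $\mathtt R_\mu\mathtt R_{\mu-1}$-linear codes of block-length $(N_1,N_2)$ and type $\{\mathbf k;\boldsymbol\ell\}$. **Proposition 4.10 (Thm6.1).** Let $\mathbf k=(k_0,\dots,k_{\mu-1})\in\mathscr K_{N_1,\mu}$ and $\boldsymbol\ell=(\ell_0,\dots,\ell_{\mu-2})\in\mathscr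 K_{N_2,\mu-1}$. Put $\mathbf k^{(1)}=(k_0+k_1,k_2,\dots,k_{\mu-2})$, $\boldsymbol\ell^{(1)}=(\ell_0+\ell_1,\ell_2,\dots,\ell_{\mu-3})$ and $$F=\begin{bmatrix}N_1-m_{\mu-2}(\mathbf k)-k_0\\k_{\mu-1}\end{bmatrix}_q\begin{bmatrix}N_2-m_{\mu-3}(\boldsymbol\ell)-\ell_0\\\ell_{\mu-2}\end{bmatrix}_q\begin{bmatrix}k_0+k_1\\k_0\end{bmatrix}_q\begin{bmatrix}\ell_0+\ell_1\\\ell_0\end{bmatrix}_q q^{\Theta_\mu(\mathbf k;\boldsymbol\ell)},$$ where, with $M=m_{\mu-2}(\mathbf k)$ and $L=m_{\mu-3}(\boldsymbol\ell)$, $$\begin{aligned}\Theta_\mu(\mathbf k;\boldsymbol\ell)={}&k_0(2N_1-2M-m_1(\mathbf k)-1)+\ell_0(2N_2-2L-m_1(\boldsymbol\ell)-k_1-1)-k_{\mu-1}\ell_{\mu-2}\\&+(M+L-k_0-\ell_0)(N_1+N_2-M-L)+2k_0(N_2-L)\\&+(\ell_{\mu-2}+2\ell_0)(N_1-M-k_0)-(M+L)(k_{\mu-1}+\ell_{\mu-2}).\end{aligned}$$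 Let $\mathscr C_{\mu-2}$ be any Euclidean self-orthogonal $\mathtt R_{\mu-2}\mathtt R_{\mu-3}$-linear code of block-length $(N_1,N_2)$ and type $\{\mathbf k^{(1)};\boldsymbol\ell^{(1)}\}$. (a) For every $k_0$-dimensional subspace $P_1$ of $Tor_1(\mathscr C_{\mu-2}^{(X)})$ and every $\ell_0$-dimensional subspace $P_2$ of $Tor_1(\mathscr C_{\mu-2}^{(Y)})$, there is a lift $\mathscr C_\mu$ of $\mathscr C_{\mu-2}$ that is Euclidean self-orthogonal of type $\{\mathbf k;\boldsymbol\ell\}$ and satisfies $Tor_1(\mathscr C_\mu^{(X)})=P_1$, $Tor_1(\mathscr C_\mu^{(Y)})=P_2$, $Tor_{i+1}(\mathscr C_\mu^{(X)})=Tor_i(\mathscr C_{\mu-2}^{(X)})$ for $1\le i\le\mu-2$ and $Tor_{j+1}(\mathscr C_\mu^{(Y)})=Tor_j(\mathscr C_{\mu-2}^{(Y)})$ for $1\le j\le\mu-3$. (b) The code $\mathscr C_{\mu-2}$ has precisely $F$ distinct lifts $\mathscr C_\mu$ that are Euclidean self-orthogonal of type $\{\mathbf k;\boldsymbol\ell\}$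 and satisfy $Tor_{i+1}(\mathscr C_\mu^{(X)})=Tor_i(\mathscr C_{\mu-2}^{(X)})$ for $1\le i\le\mu-2$ and $Tor_{j+1}(\mathscr C_\mu^{(Y)})=Tor_j(\mathscr C_{\mu-2}^{(Y)})$ for $1\le j\le\mu-3$. (c) $\mathfrak N_\mu(N_1,N_2;\mathbf k;\boldsymbol\ell)=\mathfrak N_{\mu-2}(N_1,N_2;\mathbf k^{(1)};\boldsymbol\ell^{(1)})\cdot F$. -/

import Mathlib

namespace MixedChain

open Finset

section Codes

variable {R : Type*} [CommRing R]

/-- The quotient ring `R_n = R / (γ ^ n)`. -/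
abbrev Rq (γ : R) (n : ℕ) : Type _ := R ⧸ Ideal.span ({γ ^ n} : Set R)

/-- The ambient module `R_μ ^ N₁ ⊕ R_{μ-1} ^ N₂`. -/
abbrev Amb (γ : R) (μ N₁ N₂ : ℕ) : Type _ := (Fin N₁ → Rq γ μ) × (Fin N₂ → Rq γ (μ - 1))

/-- `R_μ R_{μ-1}`-linear codes of block-length `(N₁, N₂)`. As `R` acts on the ambient module
through its quotient `R_μ`, the `R_μ`-submodules are exactly the `R`-submodules. -/
abbrev Code (γ : R) (μ N₁ N₂ : ℕ) : Type _ := Submodule R (Amb γ μ N₁ N₂)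

/-- Multiplication by `γ` as a map `R_{μ-1} → R_μ`, `x + (γ ^ (μ - 1)) ↦ γ * x + (γ ^ μ)`. -/
def gammaMul (γ : R) (μ : ℕ) : Rq γ (μ - 1) →ₗ[R] Rq γ μ :=
  Submodule.mapQ (Ideal.span ({γ ^ (μ - 1)} : Set R)) (Ideal.span ({γ ^ μ} : Set R))
    (LinearMap.mulLeft R γ) (by
      intro x hx
      obtain ⟨a, rfl⟩ := Ideal.mem_span_singleton'.1 hx
      refine Ideal.mem_span_singleton.2 ?_
      have h : γ ^ μ ∣ γ * γ ^ (μ - 1) := by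
        rw [← pow_succ']
        exact pow_dvd_pow γ (by omega)
      exact h.trans ⟨a, by simp only [LinearMap.mulLeft_apply]; ring⟩)

/-- The Euclidean bilinear form `∑ cᵢ cᵢ' + γ ∑ dⱼ dⱼ'`, with values in `R_μ`. -/
def form {γ : R} {μ N₁ N₂ : ℕ} (m m' : Amb γ μ N₁ N₂) : Rq γ μ :=
  ∑ i, m.1 i * m'.1 i + gammaMul γ μ (∑ j, m.2 j * m'.2 j)

/-- The Euclidean dual code. -/
def dual {γ : R} {μ N₁ N₂ : ℕ} (C : Code γ μ N₁ N₂) : Code γ μ N₁ N₂ where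
  carrier := {m | ∀ m' ∈ C, form m m' = 0}
  zero_mem' := by
    intro m' _
    simp [form]
  add_mem' := by
    intro a b ha hb m' hm'
    have h : form (a + b) m' = form a m' + form b m' := by
      simp only [form, Prod.fst_add, Prod.snd_add, Pi.add_apply, add_mul, sum_add_distrib,
        map_add]
      ring
    rw [h, ha m' hm', hb m' hm', add_zero]
  smul_mem' := by
    intro r a ha m' hm'
    have h : form (r • a) m' = r • form a m' := by
      simp only [form, Prod.smul_fst, Prod.smul_snd, Pi.smul_apply, smul_mul_assoc,
        ← smul_sum, map_smul, smul_add]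
    rw [h, ha m' hm', smul_zero]

/-- Euclidean self-orthogonal codes. -/
def SelfOrthogonal {γ : R} {μ N₁ N₂ : ℕ} (C : Code γ μ N₁ N₂) : Prop := C ≤ dual C

/-- Reduction of representatives in `R` to elements of `R_n ^ N`. -/
def red (γ : R) (n : ℕ) {N : ℕ} (c : Fin N → R) : Fin N → Rq γ n :=
  fun t => Ideal.Quotient.mk _ (c t)

/-- The `γ`-free part of a matrix `[A | B ; C | D]` in block echelon form, with entries
represented in `R`. The rows of `[A | B]` come in blocks of sizes `k 0, …, k (n - 1)`, those of
`[C | D]` in blocks of sizes `ℓ 0, …, ℓ (n - 2)`. The columns of `A` and `C` are grouped, after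
a permutation of the coordinates, into blocks of sizes `k 0, …, k (n - 1)` (the columns in the
image of `p`, in this order) and one last block of all the other columns; the columns of `B` and
`D` are grouped in the same way into blocks of sizes `ℓ 0, …, ℓ (n - 2)` (the image of `q`) and
a last block. Blockwise,
* `A` is zero below the diagonal blocks, which are identity matrices;
* `B` is zero on and below the diagonal blocks;
* `C` is zero in the blocks `(i, j)` with `j ≤ i + 1`;
* `D` is zero below the diagonal blocks, which are identity matrices. -/
structure BlockForm (R : Type*) [CommRing R] (n N₁ N₂ : ℕ) (k ℓ : ℕ → ℕ) where
  p : (Σ i : Fin n, Fin (k i)) ↪ Fin N₁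
  q : (Σ j : Fin (n - 1), Fin (ℓ j)) ↪ Fin N₂
  A : Matrix (Σ i : Fin n, Fin (k i)) (Fin N₁) R
  B : Matrix (Σ i : Fin n, Fin (k i)) (Fin N₂) R
  C : Matrix (Σ j : Fin (n - 1), Fin (ℓ j)) (Fin N₁) R
  D : Matrix (Σ j : Fin (n - 1), Fin (ℓ j)) (Fin N₂) R
  hA : ∀ x y, (y.1 : ℕ) ≤ x.1 → A x (p y) = (1 : Matrix _ _ R) x y
  hB : ∀ x y, (y.1 : ℕ) ≤ x.1 → B x (q y) = 0
  hC : ∀ x y, (y.1 : ℕ) ≤ x.1 + 1 → C x (p y) = 0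
  hD : ∀ x y, (y.1 : ℕ) ≤ x.1 → D x (q y) = (1 : Matrix _ _ R) x y

namespace BlockForm

variable {n N₁ N₂ : ℕ} {k ℓ : ℕ → ℕ}

/-- The row `(γ ^ w(i) A_x | γ ^ w(i) B_x)`, where `i` is the block of the row `x`. -/
def rowR (G : BlockForm R n N₁ N₂ k ℓ) (γ : R) (w : ℕ → ℕ) (μ : ℕ)
    (x : Σ i : Fin n, Fin (k i)) : Amb γ μ N₁ N₂ :=
  (red γ μ fun c => γ ^ w x.1 * G.A x c, red γ (μ - 1) fun d => γ ^ w x.1 * G.B x d)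

/-- The row `(γ ^ (w(j) + 1) C_x | γ ^ w(j) D_x)`, where `j` is the block of the row `x`. -/
def rowS (G : BlockForm R n N₁ N₂ k ℓ) (γ : R) (w : ℕ → ℕ) (μ : ℕ)
    (x : Σ j : Fin (n - 1), Fin (ℓ j)) : Amb γ μ N₁ N₂ :=
  (red γ μ fun c => γ ^ (w x.1 + 1) * G.C x c, red γ (μ - 1) fun d => γ ^ w x.1 * G.D x d)

/-- The `R_μ R_{μ-1}`-linear code generated by the rows above. -/
def code (G : BlockForm R n N₁ N₂ k ℓ) (γ : R) (w : ℕ → ℕ) (μ : ℕ) : Code γ μ N₁ N₂ :=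
  Submodule.span R (Set.range (G.rowR γ w μ) ∪ Set.range (G.rowS γ w μ))

end BlockForm

/-- `G` is a generator matrix in standard form of the code `C`: there are `μ` blocks, the `i`-th
row block of `[A | B]` being `γ ^ i [A_i | B_i]` and the `j`-th row block of `[C | D]` being
`[γ ^ (j + 1) C_j | γ ^ j D_j]`, for `i = 0, …, μ - 1` and `j = 0, …, μ - 2`. -/
def IsStandardForm {γ : R} {μ N₁ N₂ : ℕ} {k ℓ : ℕ → ℕ} (G : BlockForm R μ N₁ N₂ k ℓ)
    (C : Code γ μ N₁ N₂) : Prop :=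
  G.code γ id μ = C

/-- The code `C` has type `{k 0, …, k (μ - 1); ℓ 0, …, ℓ (μ - 2)}`. Further values of `k` and
`ℓ` play no role. -/
def HasType {γ : R} {μ N₁ N₂ : ℕ} (C : Code γ μ N₁ N₂) (k ℓ : ℕ → ℕ) : Prop :=
  ∃ G : BlockForm R μ N₁ N₂ k ℓ, IsStandardForm G C

/-- The code `C^{(X)}` over `R_μ` generated by the left part of the upper rows of a standard
form generator matrix. -/
def BlockForm.codeX {μ N₁ N₂ : ℕ} {k ℓ : ℕ → ℕ} (G : BlockForm R μ N₁ N₂ k ℓ) (γ : R) :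
    Submodule R (Fin N₁ → Rq γ μ) :=
  Submodule.span R (Set.range fun x => (G.rowR γ id μ x).1)

/-- The code `C^{(Y)}` over `R_{μ-1}` generated by the right part of the lower rows of a standard
form generator matrix. -/
def BlockForm.codeY {μ N₁ N₂ : ℕ} {k ℓ : ℕ → ℕ} (G : BlockForm R μ N₁ N₂ k ℓ) (γ : R) :
    Submodule R (Fin N₂ → Rq γ (μ - 1)) :=
  Submodule.span R (Set.range fun x => (G.rowS γ id μ x).2)

end Codes

section Local

variable {R : Type*} [CommRing R] [IsLocalRing R]

/-- The `i`-th torsion code (`i ≥ 1`) of a linear code `X` of length `N` over `R_n`: the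
reductions modulo `γ` of the words `c` with `γ ^ (i - 1) c ∈ X`. -/
def tor {γ : R} {n N : ℕ} (X : Submodule R (Fin N → Rq γ n)) (i : ℕ) :
    Set (Fin N → IsLocalRing.ResidueField R) :=
  {v | ∃ c : Fin N → R, (∀ t, IsLocalRing.residue R (c t) = v t) ∧
    red γ n (fun t => γ ^ (i - 1) * c t) ∈ X}

/-- `Tor_i(C^{(X)})`, where `C^{(X)}` is read off from a generator matrix of `C` in standard
form. The result does not depend on the choice of that matrix. -/
def torX {γ : R} {μ N₁ N₂ : ℕ} (C : Code γ μ N₁ N₂) (i : ℕ) :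
    Set (Fin N₁ → IsLocalRing.ResidueField R) :=
  {v | ∃ (k ℓ : ℕ → ℕ) (G : BlockForm R μ N₁ N₂ k ℓ),
    IsStandardForm G C ∧ v ∈ tor (G.codeX γ) i}

/-- `Tor_j(C^{(Y)})`, where `C^{(Y)}` is read off from a generator matrix of `C` in standard
form. The result does not depend on the choice of that matrix. -/
def torY {γ : R} {μ N₁ N₂ : ℕ} (C : Code γ μ N₁ N₂) (j : ℕ) :
    Set (Fin N₂ → IsLocalRing.ResidueField R) :=
  {v | ∃ (k ℓ : ℕ → ℕ) (G : BlockForm R μ N₁ N₂ k ℓ),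
    IsStandardForm G C ∧ v ∈ tor (G.codeY γ) j}

/-- The `R_μ R_{μ-1}`-linear code `C'` is a lift, for the tuples `k` and `ℓ`, of the
`R_{μ-2} R_{μ-3}`-linear code `C`.

A single block form `G` with `μ - 1` row blocks above and `μ - 2` below, written with
representatives in `R`, gives the generator matrices of both codes.
* `C` is generated by the row blocks `[A_0 | B_0]`, `γ ^ (i - 1) [A_i | B_i]` for `i ≥ 1`,
  `[γ C_0 | D_0]`, `[γ ^ j C_j | γ ^ (j - 1) D_j]` for `j ≥ 1`, read modulo
  `(γ ^ (μ - 2) | γ ^ (μ - 3))`.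
* `C'` is generated by the row blocks `γ ^ i [A_i | B_i]` and `[γ ^ (j + 1) C_j | γ ^ j D_j]`,
  read modulo `(γ ^ μ | γ ^ (μ - 1))`, and by two further row blocks `[γ ^ (μ - 1) T | 0]` and
  `[γ ^ (μ - 1) J | γ ^ (μ - 2) U]` which are supported on the last column blocks, where the
  matrices `T` and `U`, with `k (μ - 1)` and `ℓ (μ - 2)` rows, have full row rank modulo `γ`.

So the rows of `C'` agree with those of `C` (multiplied by `γ`, except for the blocks of index
`0`) up to arbitrary terms `γ ^ (μ - 2) E + γ ^ (μ - 1) F` and `γ ^ (μ - 3) M + γ ^ (μ - 2) L` in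
the left and right parts of a block of index `0`, and `γ ^ (μ - 1) F` and `γ ^ (μ - 2) L` in the
other ones: these terms are the digits of the entries of `G` that `C` does not see. -/
def IsLift {γ : R} {μ N₁ N₂ : ℕ} (k ℓ : ℕ → ℕ) (C : Code γ (μ - 2) N₁ N₂)
    (C' : Code γ μ N₁ N₂) : Prop :=
  ∃ (G : BlockForm R (μ - 1) N₁ N₂ k ℓ)
    (T : Matrix (Fin (k (μ - 1))) (Fin N₁) R)
    (J : Matrix (Fin (ℓ (μ - 2))) (Fin N₁) R)
    (U : Matrix (Fin (ℓ (μ - 2))) (Fin N₂) R),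
    (∀ x y, T x (G.p y) = 0) ∧ (∀ x y, J x (G.p y) = 0) ∧ (∀ x y, U x (G.q y) = 0) ∧
    LinearIndependent (IsLocalRing.ResidueField R)
      (fun x c => IsLocalRing.residue R (T x c)) ∧
    LinearIndependent (IsLocalRing.ResidueField R)
      (fun x d => IsLocalRing.residue R (U x d)) ∧
    C = G.code γ (fun i => i - 1) (μ - 2) ∧
    C' = G.code γ id μ ⊔ Submodule.span R
      (Set.range (fun x => ((red γ μ fun c => γ ^ (μ - 1) * T x c, 0) : Amb γ μ N₁ N₂)) ∪
       Set.range (fun x => ((red γ μ fun c => γ ^ (μ - 1) * J x c,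
          red γ (μ - 1) fun d => γ ^ (μ - 2) * U x d) : Amb γ μ N₁ N₂)))

end Local

/-- The number of Euclidean self-orthogonal `R_μ R_{μ-1}`-linear codes of block-length
`(N₁, N₂)` and type `(k; ℓ)`. -/
noncomputable def numSelfOrthogonal {R : Type*} [CommRing R] (γ : R) (μ N₁ N₂ : ℕ)
    (k ℓ : ℕ → ℕ) : ℕ :=
  Set.ncard {C : Code γ μ N₁ N₂ | SelfOrthogonal C ∧ HasType C k ℓ}

/-- The tuples `(k 0, …, k (s - 1))` with
`2 k_0 + ⋯ + 2 k_{s-1-i} + k_{s-i} + ⋯ + k_i ≤ n` for `⌊s / 2⌋ ≤ i ≤ s - 1`. -/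
def Admissible (n s : ℕ) (k : ℕ → ℕ) : Prop :=
  ∀ i, s / 2 ≤ i → i ≤ s - 1 →
    2 * ∑ j ∈ range (s - i), k j + ∑ j ∈ Ico (s - i) (i + 1), k j ≤ n

/-- `m_i(k) = k_0 + ⋯ + k_i`. -/
def m (k : ℕ → ℕ) (i : ℕ) : ℕ := ∑ j ∈ range (i + 1), k j

/-- The tuple `(k_0 + k_1, k_2, k_3, …)`. -/
def merge (k : ℕ → ℕ) (i : ℕ) : ℕ := if i = 0 then k 0 + k 1 else k (i + 1)

/-- The Gaussian binomial coefficient. -/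
def gauss (q n s : ℕ) : ℚ :=
  ∏ i ∈ range s, ((q : ℚ) ^ n - (q : ℚ) ^ i) / ((q : ℚ) ^ s - (q : ℚ) ^ i)

/-- The exponent `Θ_μ(k; ℓ)`. -/
def Theta (μ N₁ N₂ : ℕ) (k ℓ : ℕ → ℕ) : ℤ :=
  let M : ℤ := m k (μ - 2)
  let L : ℤ := m ℓ (μ - 3)
  k 0 * (2 * N₁ - 2 * M - m k 1 - 1) + ℓ 0 * (2 * N₂ - 2 * L - m ℓ 1 - k 1 - 1)
    - k (μ - 1) * ℓ (μ - 2) + (M + L - k 0 - ℓ 0) * (N₁ + N₂ - M - L) + 2 * k 0 * (N₂ - L)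
    + (ℓ (μ - 2) + 2 * ℓ 0) * (N₁ - M - k 0) - (M + L) * (k (μ - 1) + ℓ (μ - 2))

/-- The number of lifts of a given code. -/
noncomputable def liftFactor (q μ N₁ N₂ : ℕ) (k ℓ : ℕ → ℕ) : ℚ :=
  gauss q (N₁ - m k (μ - 2) - k 0) (k (μ - 1)) * gauss q (N₂ - m ℓ (μ - 3) - ℓ 0) (ℓ (μ - 2)) *
    gauss q (k 0 + k 1) (k 0) * gauss q (ℓ 0 + ℓ 1) (ℓ 0) * (q : ℚ) ^ Theta μ N₁ N₂ k ℓ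

end MixedChain

set_option linter.unusedSectionVars false

/-! A code over `R_μ R_{μ-1}` is replaced by the lattice `lat C` of all words over `R` that reduce
into it. The words are filtered by `Fs s = γ^⌈s/2⌉ R^N₁ ⊕ γ^⌊s/2⌋ R^N₂`. Since the right part of the
form carries an extra factor `γ`, the modules `Fs s` and `Fs s'` are exact orthogonals of each other
modulo `γ ^ n` when `s + s' + 1 = 2 * n` and `n ≤ e` (`pow_dvd_bil`, `mem_Fs_of_perp`). The layers
that the filtration induces on a lattice are the torsion codes, alternately on the left and on the
right (`gX`, `gY`). Hence the type is the list of dimensions of partial layers (`hasType_iff`), and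
matrices disappear. For a code `C'` of the right type, being a lift of `C` becomes `(lat C' ⊓ Fs γ
2) ⊔ Fs γ (2 * μ - 3) = γ lat C` (`isLift_iff`). This relation determines `C` from `C'` and shifts
the torsion codes by one index, so the torsion conditions hold for every lift of the right type.

Put `μ = ν + 4` and `L = lat C`. A lattice `C'` over `L` is found in two stages: first `H = C' ⊔ Fs
γ (2 * ν + 5)`, which satisfies `H ⊓ Fs γ 2 = γ L` and is isotropic modulo `γ ^ (ν + 3)`
(`ncard_upper_part`), then `C'` inside `H` (`ncard_lower_part`). Each stage passes through
intermediate submodules until a step takes place in a quotient killed by `γ`, that is, in a vector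
space over the residue field. Unconstrained steps count subspaces or complements and give Gaussian
binomials and powers of `q`. The constrained steps count complements of a subspace `K` that are
isotropic for the leading coefficient of the form. Complements are graphs of maps into `K`, and if
the orthogonal of `K` is isotropic and contains `K`, isotropy becomes a linear condition of the
shape `r + rᵀ = s`, which in odd characteristic is always solvable, with a number of solutions
independent of `s` (`card_isotropic_complements`).

So the count depends only on dimensions. With the first left and right layers prescribed it is
positive, which gives (a); summed over these layers it gives (b) (`ncard_over`). Part (c) follows
because `reduce` sends each code to the unique code that it lifts, and the fibres of `reduce` are
the sets counted in (b). -/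

namespace MixedChain

open Finset Module IsLocalRing

/-! ### Linear algebra over a finite field: subspaces, complements, isotropic complements. -/

section Field

variable {F V : Type*} [Field F] [AddCommGroup V] [Module F V]

/-- Finitely many linearly independent functionals take arbitrary values simultaneously. -/
theorem surjective_of_linearIndependent_dual {ι : Type*} [Finite ι] {f : ι → V →ₗ[F] F}
    (hf : LinearIndependent F f) : Function.Surjective (LinearMap.pi f) := by
  classical
  cases nonempty_fintype ι
  rw [← LinearMap.range_eq_top]
  by_contra h
  -- A functional vanishing on a proper range would be a linear relation among the `f i`.
  obtain ⟨g, hg, hg'⟩ := Submodule.exists_le_ker_of_lt_top _ (lt_top_iff_ne_top.2 h)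
  apply hg
  have key : ∑ i, g (Pi.single i 1) • f i = 0 := by
    ext x
    have h0 : g (LinearMap.pi f x) = 0 := hg' ⟨x, rfl⟩
    rw [LinearMap.pi_apply_eq_sum_univ] at h0
    simp only [LinearMap.coe_sum, Finset.sum_apply, LinearMap.smul_apply, smul_eq_mul,
      LinearMap.zero_apply]
    rw [← h0]
    refine Finset.sum_congr rfl fun i _ => ?_
    rw [smul_eq_mul, LinearMap.pi_apply, mul_comm]
    congr 2
    ext j
    simp [Pi.single_apply, eq_comm]
  have := Fintype.linearIndependent_iff.1 hf _ key
  refine LinearMap.pi_ext' fun i => LinearMap.ext_ring ?_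
  simpa using this i

section Finite

variable [Finite F] [Finite V]

/-- Independent `k`-tuples are counted twice, once directly and once by their span: every
`k`-dimensional subspace is spanned by the same number of them. -/
theorem card_subspaces_mul (k : ℕ) (hk : k ≤ finrank F V) :
    Nat.card {S : Submodule F V // finrank F S = k} *
      ∏ i : Fin k, (Nat.card F ^ k - Nat.card F ^ (i : ℕ)) =
      ∏ i : Fin k, (Nat.card F ^ finrank F V - Nat.card F ^ (i : ℕ)) := by
  classical
  have := Fintype.ofFinite F
  let f : {s : Fin k → V // LinearIndependent F s} → {S : Submodule F V // finrank F S = k} :=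
    fun s => ⟨Submodule.span F (Set.range s.1), by simpa using finrank_span_eq_card s.2⟩
  have hf : ∀ S, Nat.card {s // f s = S} =
      ∏ i : Fin k, (Nat.card F ^ k - Nat.card F ^ (i : ℕ)) := by
    rintro ⟨S, hS⟩
    have h2 := card_linearIndependent (K := F) (V := S) (k := k) hS.ge
    rw [hS, ← Nat.card_eq_fintype_card (α := F)] at h2
    rw [← h2]
    refine Nat.card_congr ⟨fun s => ⟨fun i => ⟨s.1.1 i, ?_⟩, ?_⟩,
      fun s => ⟨⟨fun i => (s.1 i : V), ?_⟩, Subtype.ext ?_⟩, fun s => rfl, fun s => rfl⟩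
    · have := congrArg Subtype.val s.2
      simp only [f] at this
      exact this.le (Submodule.subset_span ⟨i, rfl⟩)
    · exact LinearIndependent.of_comp (Submodule.subtype S) s.1.2
    · exact s.2.map' S.subtype S.ker_subtype
    · refine Submodule.eq_of_le_of_finrank_eq ?_ ?_
      · rw [Submodule.span_le]
        rintro _ ⟨i, rfl⟩
        exact (s.1 i).2
      · refine (finrank_span_eq_card (s.2.map' S.subtype S.ker_subtype)).trans ?_
        simp [hS]
  have h1 := card_linearIndependent (K := F) (V := V) hk
  have := Fintype.ofFinite {S : Submodule F V // finrank F S = k}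
  rw [Nat.card_congr (Equiv.sigmaFiberEquiv f).symm, Nat.card_sigma,
    Finset.sum_congr rfl fun S _ => hf S, Finset.sum_const, smul_eq_mul, Finset.card_univ,
    ← Nat.card_eq_fintype_card, ← Nat.card_eq_fintype_card] at h1
  exact h1

/-- The number of `k`-dimensional subspaces. -/
theorem card_subspaces (k : ℕ) (hk : k ≤ finrank F V) :
    (Nat.card {S : Submodule F V // finrank F S = k} : ℚ) =
      gauss (Nat.card F) (finrank F V) k := by
  have hq : 1 < Nat.card F := Finite.one_lt_card
  have h := card_subspaces_mul (F := F) (V := V) k hk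
  have hc : ∀ n, k ≤ n → ((∏ i : Fin k, (Nat.card F ^ n - Nat.card F ^ (i : ℕ)) : ℕ) : ℚ) =
      ∏ i ∈ range k, ((Nat.card F : ℚ) ^ n - (Nat.card F : ℚ) ^ i) := by
    intro n hn
    rw [Nat.cast_prod, Finset.prod_range]
    refine Finset.prod_congr rfl fun i _ => ?_
    rw [Nat.cast_sub (Nat.pow_le_pow_right hq.le (i.2.le.trans hn))]
    push_cast
    rfl
  have h' := congrArg (Nat.cast : ℕ → ℚ) h
  rw [Nat.cast_mul, hc k le_rfl, hc _ hk] at h'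
  rw [gauss, Finset.prod_div_distrib, eq_div_iff, h']
  refine Finset.prod_ne_zero_iff.2 fun i hi => ?_
  rw [sub_ne_zero]
  exact_mod_cast (Nat.pow_lt_pow_right hq (Finset.mem_range.1 hi)).ne'

end Finite

/-- Complements of `K` as graphs over a fixed complement `C₀`. -/
noncomputable def complEquivHom {K C₀ : Submodule F V} (h : IsCompl K C₀) :
    (C₀ →ₗ[F] K) ≃ {C : Submodule F V // IsCompl K C} :=
  have key : ∀ φ : C₀ →ₗ[F] K,
      IsCompl K (LinearMap.range (C₀.subtype + K.subtype ∘ₗ φ)) := fun φ => by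
    constructor
    · rw [Submodule.disjoint_def]
      rintro x hx ⟨c, rfl⟩
      have hc : (c : V) ∈ K := by
        have := K.sub_mem hx (φ c).2
        simpa using this
      have hc0 : c = 0 := by
        have := Submodule.disjoint_def.1 h.disjoint _ hc c.2
        exact Subtype.ext this
      simp [hc0]
    · rw [codisjoint_iff, eq_top_iff]
      intro x _
      have hx : x ∈ K ⊔ C₀ := by rw [h.sup_eq_top]; trivial
      obtain ⟨a, ha, c, hc, rfl⟩ := Submodule.mem_sup.1 hx
      refine Submodule.mem_sup.2 ⟨a - φ ⟨c, hc⟩, K.sub_mem ha (φ _).2, _, ⟨⟨c, hc⟩, rfl⟩, ?_⟩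
      simp
  Equiv.ofBijective (fun φ => ⟨_, key φ⟩) (by
    constructor
    · intro φ ψ hφψ
      have hr : LinearMap.range (C₀.subtype + K.subtype ∘ₗ φ) =
          LinearMap.range (C₀.subtype + K.subtype ∘ₗ ψ) := congrArg Subtype.val hφψ
      ext c
      have hm : (c : V) + φ c ∈ LinearMap.range (C₀.subtype + K.subtype ∘ₗ ψ) := by
        rw [← hr]; exact ⟨c, rfl⟩
      obtain ⟨c', hc'⟩ := hm
      simp only [LinearMap.add_apply, Submodule.subtype_apply, LinearMap.comp_apply] at hc'
      have h1 : (c' : V) - c ∈ K := by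
        have h2 : (c' : V) - c = φ c - ψ c' := by
          rw [sub_eq_sub_iff_add_eq_add, hc', add_comm]
        rw [h2]
        exact K.sub_mem (φ c).2 (ψ c').2
      have h3 : (c' : V) - c = 0 :=
        Submodule.disjoint_def.1 h.disjoint _ h1 (C₀.sub_mem c'.2 c.2)
      have h4 : c' = c := Subtype.ext (sub_eq_zero.1 h3)
      subst h4
      exact (add_left_cancel hc').symm
    · rintro ⟨C, hC⟩
      -- Subtracting from a vector of `C₀` its `K`-component along `C` lands in `C`.
      refine ⟨-(K.projectionOnto C hC ∘ₗ C₀.subtype), Subtype.ext ?_⟩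
      have hle : LinearMap.range (C₀.subtype +
          K.subtype ∘ₗ (-(K.projectionOnto C hC ∘ₗ C₀.subtype))) ≤ C := by
        rintro _ ⟨c, rfl⟩
        have : (C₀.subtype + K.subtype ∘ₗ (-(K.projectionOnto C hC ∘ₗ C₀.subtype))) c ∈
            LinearMap.ker (K.projectionOnto C hC) := by
          change K.projectionOnto C hC ((c : V) + ((-(K.projectionOnto C hC (c : V)) : K) : V)) = 0
          rw [map_add, Submodule.projectionOnto_apply_left, add_neg_cancel]
        rwa [Submodule.ker_projectionOnto hC] at this
      have hk := key (-(K.projectionOnto C hC ∘ₗ C₀.subtype))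
      refine le_antisymm hle ?_
      -- Two complements of `K`, one contained in the other, agree by modularity.
      exact (eq_of_le_of_inf_le_of_sup_le (z := K) hle
        (by rw [inf_comm, hC.inf_eq_bot]; exact bot_le)
        (by rw [sup_comm _ K, sup_comm _ K, hk.sup_eq_top]; exact le_top)).ge)

theorem complEquivHom_coe {K C₀ : Submodule F V} (h : IsCompl K C₀) (φ : C₀ →ₗ[F] K) :
    (complEquivHom h φ : Submodule F V) = LinearMap.range (C₀.subtype + K.subtype ∘ₗ φ) := rfl

/-- Complements form a torsor under the linear maps from a fixed complement to `K`. -/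
theorem card_complements [Finite F] [Finite V] (K : Submodule F V) :
    Nat.card {C : Submodule F V // IsCompl K C} =
      Nat.card F ^ (finrank F K * (finrank F V - finrank F K)) := by
  obtain ⟨C₀, h⟩ := Submodule.exists_isCompl K
  rw [← Nat.card_congr (complEquivHom h), Module.natCard_eq_pow_finrank (K := F),
    finrank_linearMap, ← Submodule.finrank_add_eq_of_isCompl h, Nat.add_sub_cancel_left, mul_comm]

/-- The square matrices `r` such that `r + rᵀ` is a given symmetric matrix. -/
theorem card_add_transpose_eq (h2 : (2 : F) ≠ 0) {t : ℕ} (s : Fin t → Fin t → F)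
    (hs : ∀ i j, s i j = s j i) :
    Nat.card {r : Fin t → Fin t → F // ∀ i j, r i j + r j i = s i j} =
      Nat.card F ^ (t * (t - 1) / 2) := by
  classical
  -- The entries above the diagonal are free and fix those below; the diagonal is `s i i / 2`, which
  -- is where `2 ≠ 0` enters.
  let e : {r : Fin t → Fin t → F // ∀ i j, r i j + r j i = s i j} ≃
      ({p : Fin t × Fin t // p.1 < p.2} → F) :=
    { toFun := fun r p => r.1 p.1.1 p.1.2
      invFun := fun g => ⟨fun i j => if h : i < j then g ⟨(i, j), h⟩ else
          if h : j < i then s i j - g ⟨(j, i), h⟩ else s i j / 2, by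
        intro i j
        rcases lt_trichotomy i j with h | h | h
        · simp [h, h.not_gt, hs i j]
        · subst h
          simp only [lt_self_iff_false, dite_false]
          field_simp
          norm_num
        · simp [h, h.not_gt, hs i j]⟩
      left_inv := by
        rintro ⟨r, hr⟩
        ext i j
        rcases lt_trichotomy i j with h | h | h
        · simp [h]
        · subst h
          simp only [lt_self_iff_false, dite_false]
          rw [← hr i i]
          field_simp
          ring
        · simp only [h.not_gt, h, dite_false, dite_true]
          rw [← hr i j]
          ring
      right_inv := by
        intro g
        ext ⟨⟨i, j⟩, h⟩
        simp only at h
        simp [h] }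
  rw [Nat.card_congr e, Nat.card_fun, Nat.card_eq_fintype_card (α := {p : Fin t × Fin t // _})]
  congr 1
  rw [Fintype.card_subtype, ← Nat.choose_two_right]
  have : (univ.filter fun p : Fin t × Fin t => p.1 < p.2).card =
      ∑ j : Fin t, (j : ℕ) := by
    rw [Finset.card_filter, ← Finset.univ_product_univ, Finset.sum_product_right]
    refine Finset.sum_congr rfl fun j _ => ?_
    rw [← Finset.card_filter]
    convert Fin.card_Iio j using 2
    ext x
    simp
  rw [this, ← Finset.sum_range (fun i => i), Finset.sum_range_id, Nat.choose_two_right]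

/-- All fibres have the size of the kernel. The multiplicative form avoids division of natural
numbers. -/
theorem card_preimage_mul {A B : Type*} [AddGroup A] [AddGroup B] [Finite A] [Finite B]
    (f : A →+ B) (hf : Function.Surjective f) (G : Set B) :
    Nat.card (f ⁻¹' G) * Nat.card B = Nat.card G * Nat.card A := by
  have hfib : ∀ b : B, Nat.card {a // f a = b} = Nat.card f.ker := by
    intro b
    obtain ⟨a₀, rfl⟩ := hf b
    refine Nat.card_congr ⟨fun a => ⟨a.1 - a₀, ?_⟩, fun a => ⟨a.1 + a₀, ?_⟩, ?_, ?_⟩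
    · rw [AddMonoidHom.mem_ker, map_sub, a.2, sub_self]
    · have := a.2
      rw [AddMonoidHom.mem_ker] at this
      rw [map_add, this, zero_add]
    · intro a; simp
    · intro a; simp
  have h1 : Nat.card (f ⁻¹' G) = Nat.card G * Nat.card f.ker := by
    have e : (f ⁻¹' G) ≃ Σ g : G, {a // f a = g.1} :=
      ⟨fun a => ⟨⟨f a.1, a.2⟩, ⟨a.1, rfl⟩⟩, fun p => ⟨p.2.1, by
        show f p.2.1 ∈ G
        rw [p.2.2]; exact p.1.2⟩, fun a => rfl, by
        rintro ⟨⟨g, hg⟩, ⟨a, ha⟩⟩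
        simp only at ha
        subst ha
        rfl⟩
    have := Fintype.ofFinite G
    rw [Nat.card_congr e, Nat.card_sigma, Finset.sum_congr rfl fun g _ => hfib g.1]
    simp [Nat.card_eq_fintype_card]
  have h2 : Nat.card A = Nat.card B * Nat.card f.ker := by
    have e : A ≃ Σ b : B, {a // f a = b} := (Equiv.sigmaFiberEquiv f).symm
    have := Fintype.ofFinite B
    rw [Nat.card_congr e, Nat.card_sigma, Finset.sum_congr rfl fun g _ => hfib g]
    simp [Nat.card_eq_fintype_card]
  rw [h1, h2]
  ring

/-- Nondegenerate pairings have equal ranks on both sides. -/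
theorem finrank_eq_of_pairing [FiniteDimensional F V] {W : Type*} [AddCommGroup W] [Module F W]
    [FiniteDimensional F W] (β : V →ₗ[F] W →ₗ[F] F) (hl : ∀ x, (∀ y, β x y = 0) → x = 0)
    (hr : ∀ y, (∀ x, β x y = 0) → y = 0) : finrank F V = finrank F W := by
  have h1 : finrank F V ≤ finrank F W := by
    rw [← Subspace.dual_finrank_eq (V := W)]
    refine LinearMap.finrank_le_finrank_of_injective (f := β) ?_
    rw [injective_iff_map_eq_zero]
    exact fun x hx => hl x fun y => by rw [hx]; rfl
  have h2 : finrank F W ≤ finrank F V := by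
    rw [← Subspace.dual_finrank_eq (V := V)]
    refine LinearMap.finrank_le_finrank_of_injective (f := β.flip) ?_
    rw [injective_iff_map_eq_zero]
    exact fun x hx => hr x fun y => by rw [← LinearMap.flip_apply, hx]; rfl
  exact le_antisymm h1 h2

end Field

/-- The number of totally isotropic complements of `K` if the orthogonal space `Λ` of `K` is
totally isotropic and contains `K`. -/
theorem card_isotropic_complements {F V : Type*} [Field F] [AddCommGroup V] [Module F V]
    [Finite F] [Finite V] (h2 : (2 : F) ≠ 0) (β : V →ₗ[F] V →ₗ[F] F)
    (hsymm : ∀ x y, β x y = β y x) (K Λ : Submodule F V)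
    (hΛ : ∀ x, x ∈ Λ ↔ ∀ y ∈ K, β x y = 0) (hK : K ≤ Λ) (hiso : ∀ x ∈ Λ, ∀ y ∈ Λ, β x y = 0)
    {h t : ℕ} (hh : finrank F V = finrank F K + h) (ht : finrank F V = finrank F Λ + t) :
    t ≤ finrank F K ∧
    Nat.card {C : Submodule F V // IsCompl K C ∧ ∀ x ∈ C, ∀ y ∈ C, β x y = 0} =
      Nat.card F ^ (h * (finrank F K - t) + t * (t - 1) / 2) := by
  obtain ⟨C₀, hC⟩ := Submodule.exists_isCompl K
  -- The fixed complement splits as `C₀ = N ⊕ T` with `N = C₀ ⊓ Λ` of dimension `h - t` and `T` of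
  -- dimension `t`. Only `T` pairs non-trivially with `K`.
  let N : Submodule F C₀ := Λ.comap C₀.subtype
  obtain ⟨T, hT⟩ := Submodule.exists_isCompl N
  have hC₀ : finrank F C₀ = h := by
    have := Submodule.finrank_add_eq_of_isCompl hC
    omega
  have hN : finrank F N + t = h := by
    have e1 : finrank F N = finrank F (C₀ ⊓ Λ : Submodule F V) := by
      rw [← Submodule.map_comap_subtype]
      exact (Submodule.equivMapOfInjective _ C₀.subtype_injective N).finrank_eq
    have e2 := Submodule.finrank_sup_add_finrank_inf_eq K (C₀ ⊓ Λ)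
    have e3 : K ⊔ (C₀ ⊓ Λ) = Λ := by
      rw [← sup_inf_assoc_of_le C₀ hK, hC.sup_eq_top, top_inf_eq]
    have e4 : K ⊓ (C₀ ⊓ Λ) = ⊥ := by
      rw [← inf_assoc, hC.inf_eq_bot, bot_inf_eq]
    rw [e3, e4, finrank_bot] at e2
    omega
  have hTt : finrank F T = t := by
    have := Submodule.finrank_add_eq_of_isCompl hT
    omega
  let b : Basis (Fin (finrank F N) ⊕ Fin t) F C₀ :=
    ((finBasis F N).prod (finBasisOfFinrankEq F T hTt)).map (Submodule.prodEquivOfIsCompl N T hT)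
  have hbl : ∀ j, (b (Sum.inl j) : V) ∈ Λ := by
    intro j
    have : b (Sum.inl j) ∈ N := by simp [b]
    exact this
  have hbr : ∀ j, b (Sum.inr j) = finBasisOfFinrankEq F T hTt j := by
    intro j
    simp [b]
  -- An element of `K` matters only through its pairings with the basis of `T`. These are arbitrary,
  -- since a vector of `T` orthogonal to `K` lies in `Λ`, hence in `N ⊓ T = ⊥`.
  let ev : K →ₗ[F] (Fin t → F) :=
    LinearMap.pi fun i => (β (b (Sum.inr i))).comp K.subtype
  have hev : Function.Surjective ev := by
    refine surjective_of_linearIndependent_dual ?_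
    rw [Fintype.linearIndependent_iff]
    intro g hg
    have hx : ∑ i, g i • b (Sum.inr i) ∈ N := by
      change ((∑ i, g i • b (Sum.inr i) : C₀) : V) ∈ Λ
      rw [hΛ]
      intro y hy
      have := LinearMap.congr_fun hg ⟨y, hy⟩
      simpa using this
    have hx' : ∑ i, g i • b (Sum.inr i) ∈ T :=
      T.sum_mem fun i _ => T.smul_mem _ (by rw [hbr]; exact Subtype.coe_prop _)
    have h0 := Submodule.disjoint_def.1 hT.disjoint _ hx hx'
    have hli := b.linearIndependent.comp Sum.inr Sum.inr_injective
    exact Fintype.linearIndependent_iff.1 hli g h0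
  -- This makes the truncated subtraction in the exponent a true one.
  have hta : t ≤ finrank F K := by
    have := LinearMap.finrank_le_finrank_of_surjective hev
    simpa using this
  refine ⟨hta, ?_⟩
  let ι := Fin (finrank F N) ⊕ Fin t
  let EV : (ι → K) →+ (ι → Fin t → F) := (ev.compLeft ι).toAddMonoidHom
  have hEV : Function.Surjective EV := by
    intro r
    choose u hu using fun i => hev (r i)
    exact ⟨u, funext hu⟩
  -- These are the conditions for the vectors `b i + u i` to span an isotropic space, written in the
  -- pairings `r i = ev (u i)`. The rows over `N` are forced; on `T × T` only the symmetric part of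
  -- `r` is prescribed. Pairs inside `N` impose nothing because `Λ` is isotropic.
  let G : Set (ι → Fin t → F) :=
    {r | (∀ j i, r (Sum.inl j) i = -β (b (Sum.inr i)) (b (Sum.inl j))) ∧
      ∀ i j, r (Sum.inr i) j + r (Sum.inr j) i = -β (b (Sum.inr i)) (b (Sum.inr j))}
  have hG : Nat.card G = Nat.card F ^ (t * (t - 1) / 2) := by
    rw [← card_add_transpose_eq h2 (fun i j => -β (b (Sum.inr i)) (b (Sum.inr j)))
      (fun i j => by rw [hsymm])]
    refine Nat.card_congr ⟨fun r => ⟨fun i => r.1 (Sum.inr i), r.2.2⟩,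
      fun r => ⟨Sum.elim (fun j i => -β (b (Sum.inr i)) (b (Sum.inl j))) r.1,
        fun _ _ => rfl, r.2⟩, ?_, fun _ => rfl⟩
    rintro ⟨r, hr⟩
    ext (j | j) i
    · exact (hr.1 j i).symm
    · rfl
  have e : {C : Submodule F V // IsCompl K C ∧ ∀ x ∈ C, ∀ y ∈ C, β x y = 0} ≃ (EV ⁻¹' G) := by
    have e1 : {C : Submodule F V // IsCompl K C ∧ ∀ x ∈ C, ∀ y ∈ C, β x y = 0} ≃
        {C : {C : Submodule F V // IsCompl K C} // ∀ x ∈ C.1, ∀ y ∈ C.1, β x y = 0} :=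
      (Equiv.subtypeSubtypeEquivSubtypeInter _ _).symm
    refine e1.trans (Equiv.subtypeEquiv
      (((complEquivHom hC).symm).trans (b.constr F).symm.toEquiv) ?_)
    intro C
    obtain ⟨u, rfl⟩ := (((complEquivHom hC).symm).trans
      (b.constr F (M' := K)).symm.toEquiv).symm.surjective C
    rw [Equiv.apply_symm_apply]
    simp only [Equiv.symm_trans_apply, Equiv.symm_symm]
    have hsp : ((complEquivHom hC ((b.constr F (M' := K)).symm.toEquiv.symm u) :
        {C : Submodule F V // IsCompl K C}) : Submodule F V) =
        Submodule.span F (Set.range fun i => (b i : V) + u i) := by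
      rw [complEquivHom_coe, LinearMap.range_eq_map, ← b.span_eq, Submodule.map_span,
        ← Set.range_comp]
      congr 2
      ext i
      simp
    rw [hsp]
    have hexp : ∀ i j, β ((b i : V) + u i) ((b j : V) + u j) =
        β (b i) (b j) + β (b i) (u j) + β (b j) (u i) := by
      intro i j
      have h1 : β (u i : V) (u j) = 0 := hiso _ (hK (u i).2) _ (hK (u j).2)
      simp only [map_add, LinearMap.add_apply, h1, hsymm (u i : V) (b j)]
      ring
    have hlK : ∀ j (x : K), β (b (Sum.inl j)) x = 0 := fun j x => hiso _ (hbl j) _ (hK x.2)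
    constructor
    · intro H
      have H' : ∀ i j, β (b i) (b j) + β (b i) (u j) + β (b j) (u i) = 0 := by
        intro i j
        rw [← hexp]
        exact H _ (Submodule.subset_span ⟨i, rfl⟩) _ (Submodule.subset_span ⟨j, rfl⟩)
      refine ⟨fun j i => ?_, fun i j => ?_⟩
      · have := H' (Sum.inr i) (Sum.inl j)
        rw [hlK, add_zero] at this
        exact (neg_eq_of_add_eq_zero_right this).symm
      · have := H' (Sum.inr i) (Sum.inr j)
        change β (b (Sum.inr j)) (u (Sum.inr i)) + β (b (Sum.inr i)) (u (Sum.inr j)) = _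
        linear_combination this
    · rintro ⟨H1, H2⟩
      have H' : ∀ i j, β (b i) (b j) + β (b i) (u j) + β (b j) (u i) = 0 := by
        have H1' : ∀ j i, β (b (Sum.inr i)) (u (Sum.inl j)) =
          -β (b (Sum.inr i)) (b (Sum.inl j)) := H1
        have H2' : ∀ i j, β (b (Sum.inr j)) (u (Sum.inr i)) + β (b (Sum.inr i)) (u (Sum.inr j)) =
          -β (b (Sum.inr i)) (b (Sum.inr j)) := H2
        rintro (i | i) (j | j)
        · rw [hlK, hlK, hiso _ (hbl i) _ (hbl j)]; simp
        · rw [hlK, H1', hsymm (b (Sum.inl i) : V)]; ring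
        · rw [hlK, H1']; ring
        · linear_combination H2' i j
      intro x hx y hy
      induction hx using Submodule.span_induction with
      | mem x hx =>
        obtain ⟨i, rfl⟩ := hx
        induction hy using Submodule.span_induction with
        | mem y hy =>
          obtain ⟨j, rfl⟩ := hy
          simp only
          rw [hexp, H']
        | zero => simp
        | add y z _ _ hy hz => rw [map_add, hy, hz, add_zero]
        | smul c y _ hy => rw [map_smul, hy, smul_zero]
      | zero => simp
      | add y z _ _ hy hz => rw [map_add, LinearMap.add_apply, hy, hz, add_zero]
      | smul c y _ hy => rw [map_smul, LinearMap.smul_apply, hy, smul_zero]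
  rw [Nat.card_congr e]
  have hc := card_preimage_mul EV hEV G
  rw [hG, Nat.card_fun (α := ι) (β := Fin t → F), Nat.card_fun (α := ι) (β := K),
    Module.natCard_eq_pow_finrank (K := F) (V := K),
    Nat.card_fun (α := Fin t), Nat.card_fin,
    show Nat.card ι = h by simp [ι, hN], ← pow_mul, ← pow_mul] at hc
  have hpos : 0 < Nat.card F ^ (t * h) := pow_pos Finite.card_pos _
  refine Nat.eq_of_mul_eq_mul_right hpos (hc.trans ?_)
  rw [← pow_add, ← pow_add]
  congr 1
  obtain ⟨d, hd⟩ := Nat.exists_eq_add_of_le hta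
  rw [hd, Nat.add_sub_cancel_left]
  ring

/-! ### Submodules between `A` and `B` as subspaces of the residue space `B / A`. -/

section Interval

universe u v

variable {R : Type u} [CommRing R] [IsLocalRing R] {M : Type v} [AddCommGroup M] [Module R M]

instance residueSurjective : RingHomSurjective (residue R) := ⟨residue_surjective⟩

/-- If `γ B ⊆ A`, where `γ` generates the maximal ideal, then `B / A` is a vector space over the
residue field. -/
theorem exists_residue_quotient {γ : R} (hmax : maximalIdeal R = Ideal.span {γ})
    (A B : Submodule R M) (hγ : ∀ x ∈ B, γ • x ∈ A) :
    ∃ (V : Type v) (_ : AddCommGroup V) (_ : Module (ResidueField R) V)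
      (π : B →ₛₗ[residue R] V), Function.Surjective π ∧ ∀ x : B, π x = 0 ↔ (x : M) ∈ A := by
  have htor : IsTorsionBySet R (B ⧸ A.submoduleOf B) (maximalIdeal R) := by
    rintro x ⟨a, ha⟩
    obtain ⟨x, rfl⟩ := Submodule.Quotient.mk_surjective _ x
    rw [hmax] at ha
    obtain ⟨c, rfl⟩ := Ideal.mem_span_singleton'.1 ha
    change (c * γ) • Submodule.Quotient.mk x = 0
    rw [← Submodule.Quotient.mk_smul, Submodule.Quotient.mk_eq_zero, mul_smul]
    exact (A.submoduleOf B).smul_mem c (hγ x x.2)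
  let _ : Module (ResidueField R) (B ⧸ A.submoduleOf B) := htor.module
  refine ⟨B ⧸ A.submoduleOf B, inferInstance, inferInstance,
    { toFun := Submodule.Quotient.mk
      map_add' := fun _ _ => rfl
      map_smul' := fun _ _ => rfl }, Submodule.Quotient.mk_surjective _, fun x => ?_⟩
  exact Submodule.Quotient.mk_eq_zero _

variable {V : Type*} [AddCommGroup V] [Module (ResidueField R) V] {A B : Submodule R M}
  (π : B →ₛₗ[residue R] V)

/-- The submodule of `B` which corresponds to a subspace of the vector space `B / A`. -/
noncomputable def pull (S : Submodule (ResidueField R) V) : Submodule R M := (S.comap π).map B.subtype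

variable {π}

theorem mem_pull {S : Submodule (ResidueField R) V} {x : M} :
    x ∈ pull π S ↔ ∃ h : x ∈ B, π ⟨x, h⟩ ∈ S := by
  simp [pull]

theorem pull_le (S : Submodule (ResidueField R) V) : pull π S ≤ B := fun _ hx =>
  (mem_pull.1 hx).1

theorem pull_top : pull π ⊤ = B := by
  ext x
  simp [mem_pull]

theorem pull_inf (S S' : Submodule (ResidueField R) V) :
    pull π (S ⊓ S') = pull π S ⊓ pull π S' := by
  ext x
  simp only [mem_pull, Submodule.mem_inf]
  exact ⟨fun ⟨h, h1, h2⟩ => ⟨⟨h, h1⟩, ⟨h, h2⟩⟩, fun ⟨⟨h, h1⟩, ⟨_, h2⟩⟩ => ⟨h, h1, h2⟩⟩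

variable (hπ : Function.Surjective π) (hker : ∀ x : B, π x = 0 ↔ (x : M) ∈ A)

include hker in
theorem pull_bot (hAB : A ≤ B) : pull π ⊥ = A := by
  ext x
  simp only [mem_pull, Submodule.mem_bot, hker]
  exact ⟨fun h => h.2, fun h => ⟨hAB h, h⟩⟩

include hker in
theorem le_pull (hAB : A ≤ B) (S : Submodule (ResidueField R) V) : A ≤ pull π S := by
  rw [← pull_bot hker hAB]
  exact Submodule.map_mono (Submodule.comap_mono bot_le)

include hπ in
theorem pull_le_pull_iff {S S' : Submodule (ResidueField R) V} :
    pull π S ≤ pull π S' ↔ S ≤ S' := by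
  refine ⟨fun h v hv => ?_, fun h => Submodule.map_mono (Submodule.comap_mono h)⟩
  obtain ⟨x, rfl⟩ := hπ v
  obtain ⟨_, hx⟩ := mem_pull.1 (h (mem_pull.2 ⟨x.2, hv⟩))
  exact hx

include hπ in
theorem pull_injective : Function.Injective (pull π) := fun _ _ h =>
  le_antisymm ((pull_le_pull_iff hπ).1 h.le) ((pull_le_pull_iff hπ).1 h.ge)

include hπ in
theorem pull_sup (S S' : Submodule (ResidueField R) V) :
    pull π (S ⊔ S') = pull π S ⊔ pull π S' := by
  refine le_antisymm (fun x hx => ?_) (sup_le ((pull_le_pull_iff hπ).2 le_sup_left)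
    ((pull_le_pull_iff hπ).2 le_sup_right))
  obtain ⟨h, hx⟩ := mem_pull.1 hx
  obtain ⟨s, hs, s', hs', e⟩ := Submodule.mem_sup.1 hx
  obtain ⟨y, rfl⟩ := hπ s
  refine Submodule.mem_sup.2 ⟨y, mem_pull.2 ⟨y.2, hs⟩, x - y, mem_pull.2 ⟨B.sub_mem h y.2, ?_⟩,
    by simp⟩
  have : π (⟨x, h⟩ - y) = s' := by
    rw [map_sub, ← e, add_sub_cancel_left]
  rw [← this] at hs'
  exact hs'

include hker in
-- An element whose class comes from `C` differs from an element of `C` by one of `A`, which `C`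
-- contains.
theorem exists_pull_eq {C : Submodule R M} (hAC : A ≤ C) (hCB : C ≤ B) :
    ∃ S : Submodule (ResidueField R) V, pull π S = C := by
  refine ⟨(C.submoduleOf B).map π, ?_⟩
  ext x
  simp only [mem_pull, Submodule.mem_map]
  constructor
  · rintro ⟨h, y, hy, e⟩
    have : π (⟨x, h⟩ - y) = 0 := by rw [map_sub, e, sub_self]
    have h1 : (x - y : M) ∈ C := hAC ((hker _).1 this)
    have h2 : (y : M) ∈ C := hy
    simpa using C.add_mem h1 h2
  · intro h
    exact ⟨hCB h, ⟨x, hCB h⟩, h, rfl⟩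

include hπ hker in
-- Both `pull π S` and `A = pull π ⊥` are preimages under `π`, whose fibres all have the same size.
theorem card_pull [Finite M] (hAB : A ≤ B) (S : Submodule (ResidueField R) V) :
    Nat.card (pull π S) = Nat.card S * Nat.card A := by
  have : Finite V := Finite.of_surjective _ hπ
  have e1 : Nat.card (pull π S) = Nat.card (π ⁻¹' (S : Set V)) :=
    Nat.card_congr ⟨fun x => ⟨⟨x.1, (mem_pull.1 x.2).1⟩, (mem_pull.1 x.2).2⟩,
      fun x => ⟨x.1, mem_pull.2 ⟨x.1.2, x.2⟩⟩, fun _ => rfl, fun _ => rfl⟩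
  have e2 : Nat.card (pull π (⊥ : Submodule (ResidueField R) V)) = Nat.card (π ⁻¹' {0}) :=
    Nat.card_congr ⟨fun x => ⟨⟨x.1, (mem_pull.1 x.2).1⟩, (mem_pull.1 x.2).2⟩,
      fun x => ⟨x.1, mem_pull.2 ⟨x.1.2, x.2⟩⟩, fun _ => rfl, fun _ => rfl⟩
  rw [pull_bot hker hAB] at e2
  have h1 := card_preimage_mul π.toAddMonoidHom hπ (S : Set V)
  have h2 := card_preimage_mul π.toAddMonoidHom hπ ({0} : Set V)
  rw [Nat.card_coe_set_eq {(0 : V)}, Set.ncard_singleton, one_mul] at h2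
  change Nat.card (π ⁻¹' (S : Set V)) * _ = _ at h1
  change Nat.card (π ⁻¹' {0}) * _ = _ at h2
  rw [← e1] at h1
  rw [← e2] at h2
  have hpos : 0 < Nat.card V := Nat.card_pos
  refine Nat.eq_of_mul_eq_mul_right hpos ?_
  rw [h1, mul_assoc, h2]
  rfl

include hπ hker in
/-- Counting submodules between `A` and `B` is counting subspaces of `B / A`. -/
theorem ncard_interval (P : Submodule R M → Prop)
    (hP : ∀ C, P C → A ≤ C ∧ C ≤ B) :
    Set.ncard {C | P C} = Nat.card {S : Submodule (ResidueField R) V // P (pull π S)} := by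
  rw [← Nat.card_coe_set_eq]
  refine (Nat.card_congr (Equiv.ofBijective (fun S => ⟨pull π S.1, S.2⟩) ⟨?_, ?_⟩)).symm
  · intro S S' h
    exact Subtype.ext (pull_injective hπ (congrArg Subtype.val h))
  · rintro ⟨C, hC⟩
    obtain ⟨S, rfl⟩ := exists_pull_eq hker (hP C hC).1 (hP C hC).2
    exact ⟨⟨S, hC⟩, rfl⟩

end Interval

/-! ### The leading coefficient of a bilinear form with values in a power of the maximal ideal. -/

section LeadingCoefficient

variable {R : Type*} [CommRing R] [IsLocalRing R]

theorem residue_eq_zero_iff_dvd {γ : R} (hmax : maximalIdeal R = Ideal.span {γ}) (r : R) :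
    residue R r = 0 ↔ γ ∣ r := by
  rw [residue_eq_zero_iff, hmax, Ideal.mem_span_singleton]

/-- If `r` were a unit while `γ ^ n * r = γ ^ (n + 1) * s`, then `r - γ * s` would be a unit killing
`γ ^ n`. So `γ ^ n * r` determines the residue of `r`, although it does not determine `r`. -/
theorem pow_succ_dvd_iff {γ : R} (hmax : maximalIdeal R = Ideal.span {γ}) {n : ℕ}
    (hn : γ ^ n ≠ 0) (r : R) : γ ^ (n + 1) ∣ γ ^ n * r ↔ residue R r = 0 := by
  rw [residue_eq_zero_iff_dvd hmax]
  constructor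
  · rintro ⟨s, hs⟩
    rw [← residue_eq_zero_iff_dvd hmax]
    by_contra h
    have hu : IsUnit (r - γ * s) := by
      by_contra h'
      have h1 : residue R (r - γ * s) = 0 := (residue_eq_zero_iff _).2 h'
      rw [map_sub, map_mul, (residue_eq_zero_iff_dvd hmax γ).2 dvd_rfl, zero_mul, sub_zero] at h1
      exact h h1
    apply hn
    have : γ ^ n * (r - γ * s) = 0 := by rw [mul_sub, hs]; ring
    exact (hu.mul_left_eq_zero).1 this
  · rintro ⟨s, rfl⟩
    exact ⟨s, by ring⟩

/-- The leading coefficient of the values of a bilinear form. -/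
theorem exists_residue_form {M : Type*} [AddCommGroup M] [Module R M] {γ : R} (hmax : maximalIdeal R = Ideal.span {γ}) {n : ℕ}
    (hn : γ ^ n ≠ 0) (b : M →ₗ[R] M →ₗ[R] R) {A B A' B' : Submodule R M}
    (hb : ∀ x ∈ B, ∀ y ∈ B', γ ^ n ∣ b x y)
    (hA : ∀ x ∈ B, ∀ y ∈ A', γ ^ (n + 1) ∣ b x y) (hA' : ∀ x ∈ A, ∀ y ∈ B', γ ^ (n + 1) ∣ b x y)
    {V W : Type*} [AddCommGroup V] [Module (ResidueField R) V] [AddCommGroup W]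
    [Module (ResidueField R) W] {π : B →ₛₗ[residue R] V} (hπ : Function.Surjective π)
    (hker : ∀ x : B, π x = 0 ↔ (x : M) ∈ A) {π' : B' →ₛₗ[residue R] W}
    (hπ' : Function.Surjective π') (hker' : ∀ x : B', π' x = 0 ↔ (x : M) ∈ A') :
    ∃ β : V →ₗ[ResidueField R] W →ₗ[ResidueField R] ResidueField R,
      ∀ (x : B) (y : B') (r : R), b x y = γ ^ n * r → β (π x) (π' y) = residue R r := by
  have hdiff : ∀ r r', γ ^ (n + 1) ∣ γ ^ n * r - γ ^ n * r' → residue R r = residue R r' := by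
    intro r r' h
    rw [← mul_sub] at h
    have := (pow_succ_dvd_iff hmax hn _).1 h
    rwa [map_sub, sub_eq_zero] at this
  choose f hf using fun (x : B) (y : B') => hb x x.2 y y.2
  have hval : ∀ (x : B) (y : B') (r : R), b x y = γ ^ n * r → residue R (f x y) = residue R r := by
    intro x y r h
    refine hdiff _ _ ?_
    rw [← hf, ← h, sub_self]
    exact dvd_zero _
  choose g hg using hπ
  choose g' hg' using hπ'
  have hwd : ∀ (x : B) (y : B') v w, π x = v → π' y = w →
      residue R (f (g v) (g' w)) = residue R (f x y) := by
    rintro x y _ _ rfl rfl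
    refine hdiff _ _ ?_
    rw [← hf, ← hf]
    have h1 : ((g (π x) : M) - x) ∈ A := by
      have : π (g (π x) - x) = 0 := by rw [map_sub, hg, sub_self]
      exact (hker _).1 this
    have h2 : ((g' (π' y) : M) - y) ∈ A' := by
      have : π' (g' (π' y) - y) = 0 := by rw [map_sub, hg', sub_self]
      exact (hker' _).1 this
    -- Changing representatives moves the value by pairings with `A` and `A'`, which lie one power
    -- of `γ` deeper.
    have h3 : b (g (π x)) (g' (π' y)) - b x y =
        b ((g (π x) : M) - x) (g' (π' y)) + b x ((g' (π' y) : M) - y) := by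
      simp only [map_sub, LinearMap.sub_apply]
      ring
    rw [h3]
    exact dvd_add (hA' _ h1 _ (g' (π' y)).2) (hA _ x.2 _ h2)
  refine ⟨LinearMap.mk₂ (ResidueField R) (fun v w => residue R (f (g v) (g' w)))
    ?_ ?_ ?_ ?_, ?_⟩
  · intro v v' w
    rw [hwd (g v + g v') (g' w) _ _ (by rw [map_add, hg, hg]) (hg' w), ← map_add]
    refine hval _ _ _ ?_
    rw [mul_add, ← hf, ← hf]
    simp
  · intro c v w
    obtain ⟨c, rfl⟩ := residue_surjective c
    rw [hwd (c • g v) (g' w) _ _ (by rw [map_smulₛₗ, hg]) (hg' w), smul_eq_mul, ← map_mul]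
    refine hval _ _ _ ?_
    rw [mul_left_comm, ← hf]
    simp
  · intro v w w'
    rw [hwd (g v) (g' w + g' w') _ _ (hg v) (by rw [map_add, hg', hg']), ← map_add]
    refine hval _ _ _ ?_
    rw [mul_add, ← hf, ← hf]
    simp
  · intro c v w
    obtain ⟨c, rfl⟩ := residue_surjective c
    rw [hwd (g v) (c • g' w) _ _ (hg v) (by rw [map_smulₛₗ, hg']), smul_eq_mul, ← map_mul]
    refine hval _ _ _ ?_
    rw [mul_left_comm, ← hf]
    simp
  · intro x y r h
    rw [LinearMap.mk₂_apply, hwd x y _ _ rfl rfl]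
    exact hval _ _ _ h

end LeadingCoefficient

/-! ### Counting submodules, complements and isotropic complements in an interval killed by `γ`. -/

section Counting

variable {R : Type*} [CommRing R] [IsLocalRing R] [Finite R] {M : Type*} [AddCommGroup M]
  [Module R M] [Finite M] {γ : R}

local notation "qq" => Nat.card (ResidueField R)

instance finite_residueField : Finite (ResidueField R) :=
  Finite.of_surjective _ residue_surjective

theorem one_lt_card_residueField : 1 < qq := Finite.one_lt_card

theorem card_pull_eq_pow {V : Type*} [AddCommGroup V] [Module (ResidueField R) V]
    {A B : Submodule R M} {π : B →ₛₗ[residue R] V} (hπ : Function.Surjective π)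
    (hker : ∀ x : B, π x = 0 ↔ (x : M) ∈ A) (hAB : A ≤ B)
    (S : Submodule (ResidueField R) V) :
    Nat.card (pull π S) = qq ^ finrank (ResidueField R) S * Nat.card A := by
  have : Finite V := Finite.of_surjective _ hπ
  rw [card_pull hπ hker hAB, Module.natCard_eq_pow_finrank (K := ResidueField R) (V := S)]

theorem card_eq_pow_finrank_mul {V : Type*} [AddCommGroup V] [Module (ResidueField R) V]
    {A B : Submodule R M} {π : B →ₛₗ[residue R] V} (hπ : Function.Surjective π)
    (hker : ∀ x : B, π x = 0 ↔ (x : M) ∈ A) (hAB : A ≤ B) :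
    Nat.card B = qq ^ finrank (ResidueField R) V * Nat.card A := by
  rw [← finrank_top, ← card_pull_eq_pow hπ hker hAB, pull_top]

theorem pow_mul_card_inj {A : Submodule R M} {a b : ℕ}
    (h : qq ^ a * Nat.card A = qq ^ b * Nat.card A) : a = b :=
  Nat.pow_right_injective one_lt_card_residueField
    (Nat.eq_of_mul_eq_mul_right Nat.card_pos h)

theorem exists_card_eq_pow_mul (hmax : maximalIdeal R = Ideal.span {γ}) {A B : Submodule R M}
    (hAB : A ≤ B) (hγ : ∀ x ∈ B, γ • x ∈ A) : ∃ n, Nat.card B = qq ^ n * Nat.card A := by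
  obtain ⟨V, _, _, π, hπ, hker⟩ := exists_residue_quotient hmax A B hγ
  exact ⟨_, card_eq_pow_finrank_mul hπ hker hAB⟩

/-- Prescribing the cardinality is prescribing the dimension of the corresponding subspace, because
`q > 1`. -/
theorem ncard_submodules (hmax : maximalIdeal R = Ideal.span {γ}) {A B : Submodule R M}
    (hAB : A ≤ B) (hγ : ∀ x ∈ B, γ • x ∈ A) {n k : ℕ} (hk : k ≤ n)
    (hn : Nat.card B = qq ^ n * Nat.card A) :
    (Set.ncard {C : Submodule R M | A ≤ C ∧ C ≤ B ∧ Nat.card C = qq ^ k * Nat.card A} : ℚ) =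
      gauss qq n k := by
  obtain ⟨V, _, _, π, hπ, hker⟩ := exists_residue_quotient hmax A B hγ
  have : Finite V := Finite.of_surjective _ hπ
  have hV : finrank (ResidueField R) V = n :=
    pow_mul_card_inj ((card_eq_pow_finrank_mul hπ hker hAB).symm.trans hn)
  rw [ncard_interval hπ hker _ (fun C h => ⟨h.1, h.2.1⟩), ← hV, ← card_subspaces _ (hV ▸ hk)]
  congr 1
  refine Nat.card_congr (Equiv.subtypeEquivRight fun S => ?_)
  rw [card_pull_eq_pow hπ hker hAB]
  exact ⟨fun h => pow_mul_card_inj h.2.2, fun h => ⟨le_pull hker hAB S, pull_le S, by rw [h]⟩⟩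

theorem isCompl_iff_pull {V : Type*} [AddCommGroup V] [Module (ResidueField R) V]
    {A B : Submodule R M} {π : B →ₛₗ[residue R] V} (hπ : Function.Surjective π)
    (hker : ∀ x : B, π x = 0 ↔ (x : M) ∈ A) (hAB : A ≤ B)
    {S S' : Submodule (ResidueField R) V} :
    IsCompl S S' ↔ pull π S' ⊓ pull π S = A ∧ pull π S' ⊔ pull π S = B := by
  rw [← pull_inf, ← pull_sup hπ, isCompl_iff, disjoint_iff, codisjoint_iff, inf_comm, sup_comm,
    ← (pull_injective hπ).eq_iff, ← (pull_injective hπ).eq_iff (a := S' ⊔ S), pull_bot hker hAB,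
    pull_top]

theorem ncard_complements (hmax : maximalIdeal R = Ideal.span {γ}) {A K B : Submodule R M}
    (hAK : A ≤ K) (hKB : K ≤ B) (hγ : ∀ x ∈ B, γ • x ∈ A) {a b : ℕ}
    (ha : Nat.card K = qq ^ a * Nat.card A) (hb : Nat.card B = qq ^ b * Nat.card K) :
    Set.ncard {C : Submodule R M | C ⊓ K = A ∧ C ⊔ K = B} = qq ^ (a * b) := by
  obtain ⟨V, _, _, π, hπ, hker⟩ := exists_residue_quotient hmax A B hγ
  have : Finite V := Finite.of_surjective _ hπ
  have hAB := hAK.trans hKB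
  obtain ⟨K, rfl⟩ := exists_pull_eq hker hAK hKB
  have hK : finrank (ResidueField R) K = a :=
    pow_mul_card_inj ((card_pull_eq_pow hπ hker hAB K).symm.trans ha)
  have hV : finrank (ResidueField R) V = b + a := by
    refine pow_mul_card_inj ((card_eq_pow_finrank_mul hπ hker hAB).symm.trans ?_)
    rw [hb, ha, pow_add, mul_assoc]
  rw [ncard_interval hπ hker _
    (fun C h => ⟨h.1.symm.trans_le inf_le_left, le_sup_left.trans_eq h.2⟩)]
  have h1 := card_complements K
  rw [hK, hV, Nat.add_sub_cancel] at h1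
  rw [← h1]
  exact Nat.card_congr (Equiv.subtypeEquivRight fun S => (isCompl_iff_pull hπ hker hAB).symm)

/-- The number of complements of `K` in `B` over `A` that are totally isotropic modulo
`γ ^ (n + 1)`. -/
theorem ncard_isotropic_complements (hmax : maximalIdeal R = Ideal.span {γ}) (hodd : Odd qq)
    {n : ℕ} (hn : γ ^ n ≠ 0) (b : M →ₗ[R] M →ₗ[R] R) (hsymm : ∀ x y, b x y = b y x)
    {A K Λ B : Submodule R M} (hAK : A ≤ K) (hKΛ : K ≤ Λ) (hΛB : Λ ≤ B)
    (hγ : ∀ x ∈ B, γ • x ∈ A) (hB : ∀ x ∈ B, ∀ y ∈ B, γ ^ n ∣ b x y)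
    (hA : ∀ x ∈ A, ∀ y ∈ B, γ ^ (n + 1) ∣ b x y)
    (hΛ : ∀ x ∈ B, (∀ y ∈ K, γ ^ (n + 1) ∣ b x y) → x ∈ Λ)
    (hΛΛ : ∀ x ∈ Λ, ∀ y ∈ Λ, γ ^ (n + 1) ∣ b x y) {a h t : ℕ}
    (ha : Nat.card K = qq ^ a * Nat.card A) (hh : Nat.card B = qq ^ h * Nat.card K)
    (ht : Nat.card B = qq ^ t * Nat.card Λ) :
    t ≤ a ∧ Set.ncard {C : Submodule R M | C ⊓ K = A ∧ C ⊔ K = B ∧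
      ∀ x ∈ C, ∀ y ∈ C, γ ^ (n + 1) ∣ b x y} = qq ^ (h * (a - t) + t * (t - 1) / 2) := by
  obtain ⟨V, _, _, π, hπ, hker⟩ := exists_residue_quotient hmax A B hγ
  have : Finite V := Finite.of_surjective _ hπ
  have hAB := hAK.trans (hKΛ.trans hΛB)
  obtain ⟨β, hβ⟩ := exists_residue_form hmax hn b hB
    (fun x hx y hy => by rw [hsymm]; exact hA y hy x hx) hA hπ hker hπ hker
  have hβ0 : ∀ x y : B, β (π x) (π y) = 0 ↔ γ ^ (n + 1) ∣ b x y := by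
    intro x y
    obtain ⟨r, hr⟩ := hB x x.2 y y.2
    rw [hβ x y r hr, hr, pow_succ_dvd_iff hmax hn]
  have hpull : ∀ S : Submodule (ResidueField R) V, (∀ v ∈ S, ∀ w ∈ S, β v w = 0) ↔
      ∀ x ∈ pull π S, ∀ y ∈ pull π S, γ ^ (n + 1) ∣ b x y := by
    intro S
    constructor
    · intro H x hx y hy
      obtain ⟨hx, hx'⟩ := mem_pull.1 hx
      obtain ⟨hy, hy'⟩ := mem_pull.1 hy
      exact (hβ0 ⟨x, hx⟩ ⟨y, hy⟩).1 (H _ hx' _ hy')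
    · intro H v hv w hw
      obtain ⟨x, rfl⟩ := hπ v
      obtain ⟨y, rfl⟩ := hπ w
      exact (hβ0 x y).2 (H x (mem_pull.2 ⟨x.2, hv⟩) y (mem_pull.2 ⟨y.2, hw⟩))
  obtain ⟨K, rfl⟩ := exists_pull_eq hker hAK (hKΛ.trans hΛB)
  obtain ⟨Λ, rfl⟩ := exists_pull_eq hker (hAK.trans hKΛ) hΛB
  have hK : finrank (ResidueField R) K = a :=
    pow_mul_card_inj ((card_pull_eq_pow hπ hker hAB K).symm.trans ha)
  have hVK : finrank (ResidueField R) V = finrank (ResidueField R) K + h := by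
    refine pow_mul_card_inj ((card_eq_pow_finrank_mul hπ hker hAB).symm.trans ?_)
    rw [hh, ha, hK, ← mul_assoc, ← pow_add, add_comm]
  have hVΛ : finrank (ResidueField R) V = finrank (ResidueField R) Λ + t := by
    refine pow_mul_card_inj ((card_eq_pow_finrank_mul hπ hker hAB).symm.trans ?_)
    rw [ht, card_pull_eq_pow hπ hker hAB, ← mul_assoc, ← pow_add, add_comm]
  have h2 : (2 : ResidueField R) ≠ 0 := by
    intro h0
    have := Fintype.ofFinite (ResidueField R)
    rw [Nat.card_eq_fintype_card] at hodd
    have h3 : ringChar (ResidueField R) ≠ 2 := fun h =>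
      (Nat.not_even_iff_odd.2 hodd)
        (by rw [Nat.even_iff, FiniteField.even_card_iff_char_two.1 h])
    exact Ring.two_ne_zero h3 h0
  have hKΛ' := (pull_le_pull_iff hπ).1 hKΛ
  have hsβ : ∀ v w, β v w = β w v := by
    intro v w
    obtain ⟨x, rfl⟩ := hπ v
    obtain ⟨y, rfl⟩ := hπ w
    obtain ⟨r, hr⟩ := hB x x.2 y y.2
    rw [hβ x y r hr, hβ y x r (by rw [hsymm, hr])]
  have hmain := card_isotropic_complements h2 β hsβ K Λ (fun v => ?_) hKΛ' ((hpull Λ).2 hΛΛ)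
    hVK hVΛ
  · rw [hK] at hmain
    refine ⟨hmain.1, ?_⟩
    rw [ncard_interval hπ hker _
      (fun C h => ⟨h.1.symm.trans_le inf_le_left, le_sup_left.trans_eq h.2.1⟩), ← hmain.2]
    refine Nat.card_congr (Equiv.subtypeEquivRight fun S => ?_)
    rw [isCompl_iff_pull hπ hker hAB, hpull, and_assoc]
  · constructor
    · intro hv w hw
      exact (hpull Λ).2 hΛΛ v hv w (hKΛ' hw)
    -- The hypothesis on `Λ` supplies only this inclusion of `K^⊥` in `Λ`; the other one holds since
    -- `K ≤ Λ` and `Λ` is isotropic.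
    · intro H
      obtain ⟨x, rfl⟩ := hπ v
      have hx : (x : M) ∈ pull π Λ := by
        refine hΛ x x.2 fun y hy => ?_
        obtain ⟨hy, hy'⟩ := mem_pull.1 hy
        exact (hβ0 x ⟨y, hy⟩).1 (H _ hy')
      exact (mem_pull.1 hx).2

/-- The indices of the left and right kernels of a pairing with values in `γ ^ n R` modulo
`γ ^ (n + 1)` agree. -/
theorem card_mul_card_of_pairing (hmax : maximalIdeal R = Ideal.span {γ}) {n : ℕ}
    (hn : γ ^ n ≠ 0) (b : M →ₗ[R] M →ₗ[R] R) {A B A' B' : Submodule R M} (hAB : A ≤ B)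
    (hAB' : A' ≤ B') (hb : ∀ x ∈ B, ∀ y ∈ B', γ ^ n ∣ b x y)
    (hA : ∀ x ∈ B, x ∈ A ↔ ∀ y ∈ B', γ ^ (n + 1) ∣ b x y)
    (hA' : ∀ y ∈ B', y ∈ A' ↔ ∀ x ∈ B, γ ^ (n + 1) ∣ b x y) {d : ℕ}
    (hd : Nat.card B' = qq ^ d * Nat.card A') :
    Nat.card B = qq ^ d * Nat.card A := by
  -- The quotients are residue spaces automatically: the pairing is already divisible by `γ ^ n`, so
  -- one more factor `γ` puts a vector into the kernel.
  have hγ : ∀ x ∈ B, γ • x ∈ A := by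
    intro x hx
    rw [hA _ (B.smul_mem _ hx)]
    intro y hy
    rw [map_smul, LinearMap.smul_apply, smul_eq_mul, pow_succ']
    exact mul_dvd_mul_left _ (hb x hx y hy)
  have hγ' : ∀ x ∈ B', γ • x ∈ A' := by
    intro y hy
    rw [hA' _ (B'.smul_mem _ hy)]
    intro x hx
    rw [map_smul, smul_eq_mul, pow_succ']
    exact mul_dvd_mul_left _ (hb x hx y hy)
  obtain ⟨V, _, _, π, hπ, hker⟩ := exists_residue_quotient hmax A B hγ
  obtain ⟨W, _, _, π', hπ', hker'⟩ := exists_residue_quotient hmax A' B' hγ'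
  have : Finite V := Finite.of_surjective _ hπ
  have : Finite W := Finite.of_surjective _ hπ'
  obtain ⟨β, hβ⟩ := exists_residue_form hmax hn b hb
    (fun x hx y hy => (hA' y (hAB' hy)).1 hy x hx) (fun x hx => (hA x (hAB hx)).1 hx)
    hπ hker hπ' hker'
  have hβ0 : ∀ (x : B) (y : B'), β (π x) (π' y) = 0 ↔ γ ^ (n + 1) ∣ b x y := by
    intro x y
    obtain ⟨r, hr⟩ := hb x x.2 y y.2
    rw [hβ x y r hr, hr, pow_succ_dvd_iff hmax hn]
  rw [card_eq_pow_finrank_mul hπ hker hAB, finrank_eq_of_pairing β]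
  · rw [card_eq_pow_finrank_mul hπ' hker' hAB'] at hd
    rw [pow_mul_card_inj hd]
  · intro v hv
    obtain ⟨x, rfl⟩ := hπ v
    rw [hker, hA x x.2]
    intro y hy
    exact (hβ0 x ⟨y, hy⟩).1 (hv _)
  · intro w hw
    obtain ⟨y, rfl⟩ := hπ' w
    rw [hker', hA' y y.2]
    intro x hx
    exact (hβ0 ⟨x, hx⟩ y).1 (hw _)

end Counting

/-- `γ` generates the maximal ideal of a local ring and has nilpotency index `e`. -/
structure IsChain {R : Type*} [CommRing R] [IsLocalRing R] (γ : R) (e : ℕ) : Prop where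
  max : maximalIdeal R = Ideal.span {γ}
  nil : γ ^ e = 0
  ne : γ ^ (e - 1) ≠ 0

/-! ### Words over `R`, their filtration and the Euclidean form. -/

section Words

variable {R : Type*} [CommRing R]

/-- Pairs of words over `R`, which represent the elements of the ambient modules. -/
abbrev Word (R : Type*) (N₁ N₂ : ℕ) : Type _ := (Fin N₁ → R) × (Fin N₂ → R)

variable {N₁ N₂ : ℕ}

/-- The filtration by the submodules `γ ^ ⌈s / 2⌉ R ^ N₁ ⊕ γ ^ ⌊s / 2⌋ R ^ N₂`. -/
def Fs (γ : R) (s : ℕ) : Submodule R (Word R N₁ N₂) where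
  carrier := {x | (∀ t, γ ^ ((s + 1) / 2) ∣ x.1 t) ∧ ∀ t, γ ^ (s / 2) ∣ x.2 t}
  zero_mem' := ⟨fun _ => dvd_zero _, fun _ => dvd_zero _⟩
  add_mem' := fun hx hy => ⟨fun t => dvd_add (hx.1 t) (hy.1 t), fun t => dvd_add (hx.2 t) (hy.2 t)⟩
  smul_mem' := fun c _ hx => ⟨fun t => (hx.1 t).mul_left c, fun t => (hx.2 t).mul_left c⟩

theorem mem_Fs {γ : R} {s : ℕ} {x : Word R N₁ N₂} :
    x ∈ Fs γ s ↔ (∀ t, γ ^ ((s + 1) / 2) ∣ x.1 t) ∧ ∀ t, γ ^ (s / 2) ∣ x.2 t := Iff.rfl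

theorem Fs_antitone {γ : R} {s s' : ℕ} (h : s ≤ s') :
    (Fs γ s' : Submodule R (Word R N₁ N₂)) ≤ Fs γ s := fun _ hx =>
  ⟨fun t => (pow_dvd_pow γ (by omega)).trans (hx.1 t),
    fun t => (pow_dvd_pow γ (by omega)).trans (hx.2 t)⟩

theorem Fs_zero {γ : R} : (Fs γ 0 : Submodule R (Word R N₁ N₂)) = ⊤ := by
  ext x
  simp [mem_Fs]

theorem mem_Fs_even {γ : R} {i : ℕ} {x : Word R N₁ N₂} :
    x ∈ Fs γ (2 * i) ↔ (∀ t, γ ^ i ∣ x.1 t) ∧ ∀ t, γ ^ i ∣ x.2 t := by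
  rw [mem_Fs, show (2 * i + 1) / 2 = i by omega, show 2 * i / 2 = i by omega]

theorem mem_Fs_odd {γ : R} {i : ℕ} {x : Word R N₁ N₂} :
    x ∈ Fs γ (2 * i + 1) ↔ (∀ t, γ ^ (i + 1) ∣ x.1 t) ∧ ∀ t, γ ^ i ∣ x.2 t := by
  rw [mem_Fs, show (2 * i + 1 + 1) / 2 = i + 1 by omega, show (2 * i + 1) / 2 = i by omega]

/-- The bilinear form on representatives. -/
def bil (γ : R) : Word R N₁ N₂ →ₗ[R] Word R N₁ N₂ →ₗ[R] R :=
  LinearMap.mk₂ R (fun x y => ∑ i, x.1 i * y.1 i + γ * ∑ j, x.2 j * y.2 j)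
    (fun x x' y => by simp only [Prod.fst_add, Prod.snd_add, Pi.add_apply, add_mul,
      sum_add_distrib]; ring)
    (fun c x y => by simp only [Prod.smul_fst, Prod.smul_snd, Pi.smul_apply, smul_eq_mul,
      mul_assoc, ← mul_sum]; ring)
    (fun x y y' => by simp only [Prod.fst_add, Prod.snd_add, Pi.add_apply, mul_add,
      sum_add_distrib]; ring)
    (fun c x y => by simp only [Prod.smul_fst, Prod.smul_snd, Pi.smul_apply, smul_eq_mul,
      mul_left_comm _ c, ← mul_sum]; ring)

theorem bil_apply (γ : R) (x y : Word R N₁ N₂) :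
    bil γ x y = ∑ i, x.1 i * y.1 i + γ * ∑ j, x.2 j * y.2 j := rfl

theorem bil_symm (γ : R) (x y : Word R N₁ N₂) : bil γ x y = bil γ y x := by
  simp only [bil_apply, mul_comm]

/-- The left part contributes the exponent `⌈s/2⌉ + ⌈s'/2⌉` and the right part `1 + ⌊s/2⌋ + ⌊s'/2⌋`.
Both are at least `⌊(s + s' + 1) / 2⌋`, so the half steps of the filtration are adapted to the
factor `γ` in the form. -/
theorem pow_dvd_bil {γ : R} {s s' n : ℕ} {x y : Word R N₁ N₂} (hx : x ∈ Fs γ s) (hy : y ∈ Fs γ s')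
    (hn : 2 * n ≤ s + s' + 1) : γ ^ n ∣ bil γ x y := by
  rw [bil_apply]
  refine dvd_add (dvd_sum fun t _ => ?_) ?_
  · refine (pow_dvd_pow γ (?_ : n ≤ (s + 1) / 2 + (s' + 1) / 2)).trans ?_
    · omega
    · rw [pow_add]
      exact mul_dvd_mul (hx.1 t) (hy.1 t)
  · refine (pow_dvd_pow γ (?_ : n ≤ (s / 2 + s' / 2) + 1)).trans ?_
    · omega
    · rw [pow_succ', pow_add]
      exact mul_dvd_mul_left _ (dvd_sum fun t _ => mul_dvd_mul (hx.2 t) (hy.2 t))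

/-- Multiplication by powers of `γ` on both parts of a word. -/
def sc (γ : R) (a b : ℕ) : Word R N₁ N₂ →ₗ[R] Word R N₁ N₂ :=
  (LinearMap.lsmul R _ (γ ^ a)).prodMap (LinearMap.lsmul R _ (γ ^ b))

theorem sc_fst (γ : R) (a b : ℕ) (x : Word R N₁ N₂) (t : Fin N₁) :
    (sc γ a b x).1 t = γ ^ a * x.1 t := rfl

theorem sc_snd (γ : R) (a b : ℕ) (x : Word R N₁ N₂) (t : Fin N₂) :
    (sc γ a b x).2 t = γ ^ b * x.2 t := rfl

/-- The submodule `γ L`. -/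
def gm (γ : R) (L : Submodule R (Word R N₁ N₂)) : Submodule R (Word R N₁ N₂) :=
  L.map (LinearMap.lsmul R _ γ)

theorem gm_mono {γ : R} {L L' : Submodule R (Word R N₁ N₂)} (h : L ≤ L') : gm γ L ≤ gm γ L' :=
  Submodule.map_mono h

theorem gm_le {γ : R} {L : Submodule R (Word R N₁ N₂)} : gm γ L ≤ L := by
  rintro _ ⟨x, hx, rfl⟩
  exact L.smul_mem _ hx

theorem smul_mem_gm {γ : R} {L : Submodule R (Word R N₁ N₂)} {x : Word R N₁ N₂} (hx : x ∈ L) :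
    γ • x ∈ gm γ L := ⟨x, hx, rfl⟩

theorem smul_mem_Fs {γ : R} {s : ℕ} {x : Word R N₁ N₂} (hx : x ∈ Fs γ s) :
    γ • x ∈ Fs γ (s + 2) := by
  rw [mem_Fs, show (s + 2 + 1) / 2 = (s + 1) / 2 + 1 by omega,
    show (s + 2) / 2 = s / 2 + 1 by omega, pow_succ', pow_succ']
  exact ⟨fun t => mul_dvd_mul_left _ (hx.1 t), fun t => mul_dvd_mul_left _ (hx.2 t)⟩

theorem exists_smul_of_mem_Fs {γ : R} {s : ℕ} {x : Word R N₁ N₂} (hx : x ∈ Fs γ (s + 2)) :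
    ∃ y ∈ Fs γ s, γ • y = x := by
  rw [mem_Fs, show (s + 2 + 1) / 2 = (s + 1) / 2 + 1 by omega,
    show (s + 2) / 2 = s / 2 + 1 by omega] at hx
  choose f hf using hx.1
  choose g hg using hx.2
  refine ⟨(fun t => γ ^ ((s + 1) / 2) * f t, fun t => γ ^ (s / 2) * g t),
    ⟨fun t => dvd_mul_right _ _, fun t => dvd_mul_right _ _⟩, ?_⟩
  ext t
  · rw [hf t]; simp only [Prod.smul_fst, Pi.smul_apply, smul_eq_mul]; ring
  · rw [hg t]; simp only [Prod.smul_snd, Pi.smul_apply, smul_eq_mul]; ring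

theorem gm_Fs {γ : R} {s : ℕ} : gm γ (Fs γ s : Submodule R (Word R N₁ N₂)) = Fs γ (s + 2) := by
  ext x
  constructor
  · rintro ⟨y, hy, rfl⟩
    exact smul_mem_Fs hy
  · exact exists_smul_of_mem_Fs

end Words

/-! ### Cancellation of `γ`, exact orthogonality of the filtration, and its layers. -/

section Local

variable {R : Type*} [CommRing R] [IsLocalRing R] {γ : R} {e : ℕ}

namespace IsChain

theorem pow_ne (h : IsChain γ e) {n : ℕ} (hn : n < e) : γ ^ n ≠ 0 := fun h0 => h.ne (by
  rw [show e - 1 = n + (e - 1 - n) by omega, pow_add, h0, zero_mul])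

theorem residue_eq_zero (h : IsChain γ e) (r : R) : residue R r = 0 ↔ γ ∣ r :=
  residue_eq_zero_iff_dvd h.max r

/-- As long as `a + j < e`, the cofactor of `γ ^ j` in `z` cannot be a unit, since otherwise `γ ^ (a
+ j)` would vanish; so one more factor `γ` splits off. -/
theorem dvd_of_pow_mul_eq_zero (h : IsChain γ e) {a : ℕ} {z : R} (hz : γ ^ a * z = 0) :
    ∀ j, a + j ≤ e → γ ^ j ∣ z := by
  intro j
  induction j with
  | zero => intro _; simp
  | succ j ih =>
    intro hj
    obtain ⟨w, rfl⟩ := ih (by omega)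
    rw [pow_succ]
    refine mul_dvd_mul_left _ ?_
    rw [← h.residue_eq_zero, residue_eq_zero_iff]
    intro hu
    rw [← mul_assoc, ← pow_add] at hz
    exact h.pow_ne (by omega) ((hu.mul_left_eq_zero).1 hz)

theorem dvd_of_pow_mul (h : IsChain γ e) {a b : ℕ} {z : R} (hz : γ ^ (a + b) ∣ γ ^ a * z)
    (hab : a + b ≤ e) : γ ^ b ∣ z := by
  obtain ⟨y, hy⟩ := hz
  have h1 : γ ^ b ∣ z - γ ^ b * y :=
    h.dvd_of_pow_mul_eq_zero (a := a) (by rw [mul_sub, hy]; ring) b hab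
  simpa using dvd_add h1 (dvd_mul_right (γ ^ b) y)

theorem dvd_of_mul (h : IsChain γ e) {b : ℕ} {z : R} (hz : γ ^ (b + 1) ∣ γ * z)
    (hb : b + 1 ≤ e) : γ ^ b ∣ z :=
  h.dvd_of_pow_mul (a := 1) (by rwa [pow_one, add_comm]) (by omega)

end IsChain

variable {N₁ N₂ : ℕ}

theorem mem_Fs_of_smul_mem (h : IsChain γ e) {s : ℕ} (hs : s + 3 ≤ 2 * e + 1)
    {x : Word R N₁ N₂} (hx : γ • x ∈ Fs γ (s + 2)) : x ∈ Fs γ s := by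
  rw [mem_Fs, show (s + 2 + 1) / 2 = (s + 1) / 2 + 1 by omega,
    show (s + 2) / 2 = s / 2 + 1 by omega] at hx
  exact ⟨fun t => h.dvd_of_mul (hx.1 t) (by omega), fun t => h.dvd_of_mul (hx.2 t) (by omega)⟩

/-- Multiplication by `γ` shifts the filtration by two steps, and below the nilpotency index the
shift can be undone. -/
theorem gm_inf_Fs (h : IsChain γ e) {s : ℕ} (hs : s + 3 ≤ 2 * e + 1)
    (L : Submodule R (Word R N₁ N₂)) : gm γ L ⊓ Fs γ (s + 2) = gm γ (L ⊓ Fs γ s) := by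
  ext x
  constructor
  · rintro ⟨⟨y, hy, rfl⟩, h2⟩
    exact ⟨y, ⟨hy, mem_Fs_of_smul_mem h hs h2⟩, rfl⟩
  · rintro ⟨y, hy, rfl⟩
    exact ⟨⟨y, hy.1, rfl⟩, smul_mem_Fs hy.2⟩

/-- Testing against multiples of unit vectors isolates each coordinate. As `s + s'` is odd, the
exponents `⌈s/2⌉ + ⌈s'/2⌉` and `1 + ⌊s/2⌋ + ⌊s'/2⌋` are both exactly `n`, and `n ≤ e` permits the
cancellation. -/
theorem mem_Fs_of_perp (h : IsChain γ e) {n s s' : ℕ} (hn : n ≤ e) (hs : s + s' + 1 = 2 * n)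
    {x : Word R N₁ N₂} (hx : ∀ y ∈ Fs γ s, γ ^ n ∣ bil γ x y) : x ∈ Fs γ s' := by
  classical
  refine ⟨fun t => ?_, fun t => ?_⟩
  · have := hx (Pi.single t (γ ^ ((s + 1) / 2)), 0) ⟨fun t' => ?_, fun _ => dvd_zero _⟩
    · rw [bil_apply] at this
      simp only [Pi.single_apply, mul_ite, mul_zero, Finset.sum_ite_eq', Finset.mem_univ,
        if_true, Pi.zero_apply, Finset.sum_const_zero, add_zero] at this
      rw [mul_comm, show n = (s + 1) / 2 + (s' + 1) / 2 by omega] at this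
      exact h.dvd_of_pow_mul this (by omega)
    · simp only [Pi.single_apply]
      split_ifs <;> simp
  · have := hx (0, Pi.single t (γ ^ (s / 2))) ⟨fun _ => dvd_zero _, fun t' => ?_⟩
    · rw [bil_apply] at this
      simp only [Pi.single_apply, mul_ite, mul_zero, Finset.sum_ite_eq', Finset.mem_univ,
        if_true, Pi.zero_apply, Finset.sum_const_zero, zero_add] at this
      rw [show γ * (x.2 t * γ ^ (s / 2)) = γ ^ (s / 2 + 1) * x.2 t by ring,
        show n = s / 2 + 1 + s' / 2 by omega] at this
      exact h.dvd_of_pow_mul this (by omega)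
    · simp only [Pi.single_apply]
      split_ifs <;> simp

/-- Reduction of the left part of a word modulo `γ`. -/
noncomputable def resX : Word R N₁ N₂ →ₛₗ[residue R] (Fin N₁ → ResidueField R) where
  toFun x t := residue R (x.1 t)
  map_add' x y := by ext; simp
  map_smul' c x := by ext; simp

/-- Reduction of the right part of a word modulo `γ`. -/
noncomputable def resY : Word R N₁ N₂ →ₛₗ[residue R] (Fin N₂ → ResidueField R) where
  toFun x t := residue R (x.2 t)
  map_add' x y := by ext; simp
  map_smul' c x := by ext; simp

theorem resY_apply (x : Word R N₁ N₂) (t : Fin N₂) : resY x t = residue R (x.2 t) := rfl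

theorem resX_eq_zero (h : IsChain γ e) {x : Word R N₁ N₂} : resX x = 0 ↔ ∀ t, γ ∣ x.1 t := by
  rw [funext_iff]
  exact forall_congr' fun t => h.residue_eq_zero _

theorem resY_eq_zero (h : IsChain γ e) {x : Word R N₁ N₂} : resY x = 0 ↔ ∀ t, γ ∣ x.2 t := by
  rw [funext_iff]
  exact forall_congr' fun t => h.residue_eq_zero _

/-- The words `c mod γ` such that `(γ ^ i c | γ ^ i d) ∈ L` for some `d`. -/
noncomputable def gX (γ : R) (L : Submodule R (Word R N₁ N₂)) (i : ℕ) :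
    Submodule (ResidueField R) (Fin N₁ → ResidueField R) :=
  (L.comap (sc γ i i)).map resX

/-- The words `d mod γ` such that `(γ ^ (j + 1) c | γ ^ j d) ∈ L` for some `c`. -/
noncomputable def gY (γ : R) (L : Submodule R (Word R N₁ N₂)) (j : ℕ) :
    Submodule (ResidueField R) (Fin N₂ → ResidueField R) :=
  (L.comap (sc γ (j + 1) j)).map resY

/-- The layer `(L ⊓ P) / (L ⊓ Q)` should be the image of `L.comap f` under `g`. As `f` need not be
injective, both are reached from `L.comap f`, where the preimage of `Q` under `f` is the kernel of
`g`. -/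
theorem card_inf_eq_card_map_mul {M W : Type*} [AddCommGroup M] [Module R M] [Finite M]
    [AddCommGroup W] [Module (ResidueField R) W] [Finite W] (f : M →ₗ[R] M)
    (g : M →ₛₗ[residue R] W) {P Q L : Submodule R M} (hP : ∀ x ∈ P, ∃ y, f y = x)
    (hfP : ∀ y, f y ∈ P) (hQ : ∀ y, f y ∈ Q ↔ g y = 0) (hQP : Q ≤ P) :
    Nat.card (L ⊓ P : Submodule R M) =
      Nat.card ((L.comap f).map g) * Nat.card (L ⊓ Q : Submodule R M) := by
  let f1 : L.comap f →+ (L.comap f).map g :=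
    { toFun := fun x => ⟨g x, ⟨x.1, x.2, rfl⟩⟩
      map_zero' := by ext; simp
      map_add' := fun x y => by ext; simp }
  let f2 : L.comap f →+ (L ⊓ P : Submodule R M) :=
    { toFun := fun x => ⟨f x, ⟨x.2, hfP _⟩⟩
      map_zero' := by ext; simp
      map_add' := fun x y => by ext; simp }
  have hf1 : Function.Surjective f1 := by
    rintro ⟨_, x, hx, rfl⟩
    exact ⟨⟨x, hx⟩, rfl⟩
  have hf2 : Function.Surjective f2 := by
    rintro ⟨x, hx, hx'⟩
    obtain ⟨y, rfl⟩ := hP x hx'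
    exact ⟨⟨y, hx⟩, rfl⟩
  have h1 := card_preimage_mul f1 hf1 {0}
  have h2 := card_preimage_mul f2 hf2 {x | (x : M) ∈ Q}
  have hpre : f2 ⁻¹' {x | (x : M) ∈ Q} = f1 ⁻¹' {0} := by
    ext x
    change f x ∈ Q ↔ f1 x = 0
    rw [hQ, ← Subtype.coe_inj]
    rfl
  have hQc : Nat.card {x : (L ⊓ P : Submodule R M) | (x : M) ∈ Q} =
      Nat.card (L ⊓ Q : Submodule R M) :=
    Nat.card_congr ⟨fun x => ⟨x.1, x.1.2.1, x.2⟩, fun x => ⟨⟨x.1, x.2.1, hQP x.2.2⟩, x.2.2⟩,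
      fun _ => rfl, fun _ => rfl⟩
  rw [Nat.card_coe_set_eq {(0 : (L.comap f).map g)}, Set.ncard_singleton, one_mul] at h1
  rw [hpre, hQc, ← h1] at h2
  have hpos : 0 < Nat.card (f1 ⁻¹' {0}) := by
    have : Nonempty (f1 ⁻¹' {0}) := ⟨⟨0, map_zero f1⟩⟩
    exact Nat.card_pos
  refine Nat.eq_of_mul_eq_mul_left hpos (h2.trans ?_)
  ring

variable [Finite R]

local notation "qq" => Nat.card (ResidueField R)

/-- An even step of the filtration changes only the left exponent, so its layer is a left torsion
code; an odd step is seen on the right in the same way. -/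
theorem card_inf_Fs_even (h : IsChain γ e) (L : Submodule R (Word R N₁ N₂)) {i : ℕ} (hi : i < e) :
    Nat.card (L ⊓ Fs γ (2 * i) : Submodule R (Word R N₁ N₂)) =
      Nat.card (gX γ L i) * Nat.card (L ⊓ Fs γ (2 * i + 1) : Submodule R (Word R N₁ N₂)) := by
  refine card_inf_eq_card_map_mul (sc γ i i) resX (fun x hx => ?_) (fun y => ?_) (fun y => ?_)
    (Fs_antitone (by omega))
  · rw [mem_Fs_even] at hx
    choose f hf using hx.1
    choose g hg using hx.2
    exact ⟨(f, g), Prod.ext (funext fun t => (hf t).symm) (funext fun t => (hg t).symm)⟩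
  · rw [mem_Fs_even]
    exact ⟨fun t => dvd_mul_right _ _, fun t => dvd_mul_right _ _⟩
  · rw [mem_Fs_odd, resX_eq_zero h]
    simp only [sc_fst, sc_snd, dvd_mul_right, implies_true, and_true]
    refine forall_congr' fun t => ⟨fun hd => ?_, fun hd => ?_⟩
    · simpa using h.dvd_of_pow_mul hd (by omega)
    · rw [pow_succ]; exact mul_dvd_mul_left _ hd

theorem card_inf_Fs_odd (h : IsChain γ e) (L : Submodule R (Word R N₁ N₂)) {i : ℕ} (hi : i < e) :
    Nat.card (L ⊓ Fs γ (2 * i + 1) : Submodule R (Word R N₁ N₂)) =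
      Nat.card (gY γ L i) * Nat.card (L ⊓ Fs γ (2 * i + 2) : Submodule R (Word R N₁ N₂)) := by
  refine card_inf_eq_card_map_mul (sc γ (i + 1) i) resY (fun x hx => ?_) (fun y => ?_)
    (fun y => ?_) (Fs_antitone (by omega))
  · rw [mem_Fs_odd] at hx
    choose f hf using hx.1
    choose g hg using hx.2
    exact ⟨(f, g), Prod.ext (funext fun t => (hf t).symm) (funext fun t => (hg t).symm)⟩
  · rw [mem_Fs_odd]
    exact ⟨fun t => dvd_mul_right _ _, fun t => dvd_mul_right _ _⟩
  · rw [show 2 * i + 2 = 2 * (i + 1) by ring, mem_Fs_even, resY_eq_zero h]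
    simp only [sc_fst, sc_snd, dvd_mul_right, implies_true, true_and]
    refine forall_congr' fun t => ⟨fun hd => ?_, fun hd => ?_⟩
    · simpa using h.dvd_of_pow_mul hd (by omega)
    · rw [pow_succ]; exact mul_dvd_mul_left _ hd

theorem card_Fs_even (h : IsChain γ e) {i : ℕ} (hi : i < e) :
    Nat.card (Fs γ (2 * i) : Submodule R (Word R N₁ N₂)) =
      qq ^ N₁ * Nat.card (Fs γ (2 * i + 1) : Submodule R (Word R N₁ N₂)) := by
  have := card_inf_Fs_even (N₁ := N₁) (N₂ := N₂) h ⊤ hi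
  rw [top_inf_eq, top_inf_eq] at this
  rw [this]
  congr 1
  have ht : gX γ (⊤ : Submodule R (Word R N₁ N₂)) i = ⊤ := by
    refine eq_top_iff.2 fun v _ => ?_
    choose c hc using fun t => residue_surjective (v t)
    exact ⟨(c, 0), Submodule.mem_top, funext hc⟩
  rw [ht, Nat.card_congr (Submodule.topEquiv (R := ResidueField R)).toEquiv, Nat.card_fun,
    Nat.card_fin]

theorem card_Fs_odd (h : IsChain γ e) {i : ℕ} (hi : i < e) :
    Nat.card (Fs γ (2 * i + 1) : Submodule R (Word R N₁ N₂)) =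
      qq ^ N₂ * Nat.card (Fs γ (2 * i + 2) : Submodule R (Word R N₁ N₂)) := by
  have := card_inf_Fs_odd (N₁ := N₁) (N₂ := N₂) h ⊤ hi
  rw [top_inf_eq, top_inf_eq] at this
  rw [this]
  congr 1
  have ht : gY γ (⊤ : Submodule R (Word R N₁ N₂)) i = ⊤ := by
    refine eq_top_iff.2 fun v _ => ?_
    choose c hc using fun t => residue_surjective (v t)
    exact ⟨(0, c), Submodule.mem_top, funext hc⟩
  rw [ht, Nat.card_congr (Submodule.topEquiv (R := ResidueField R)).toEquiv, Nat.card_fun,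
    Nat.card_fin]

/-- The kernel of multiplication by `γ` on all words is `Fs γ (2 * e - 2)`, of size `q ^ (N₁ + N₂)`,
and `L` contains it. -/
theorem card_eq_card_gm (h : IsChain γ e) (he : 1 ≤ e) {L : Submodule R (Word R N₁ N₂)}
    (hL : Fs γ (2 * e - 2) ≤ L) : Nat.card L = qq ^ (N₁ + N₂) * Nat.card (gm γ L) := by
  have hbot : (Fs γ (2 * (e - 1) + 2) : Submodule R (Word R N₁ N₂)) = ⊥ := by
    refine eq_bot_iff.2 fun x hx => ?_
    rw [show 2 * (e - 1) + 2 = 2 * e by omega, mem_Fs_even, h.nil] at hx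
    exact Prod.ext (funext fun t => zero_dvd_iff.1 (hx.1 t))
      (funext fun t => zero_dvd_iff.1 (hx.2 t))
  have hc : Nat.card (Fs γ (2 * (e - 1)) : Submodule R (Word R N₁ N₂)) = qq ^ (N₁ + N₂) := by
    rw [card_Fs_even h (by omega), card_Fs_odd h (by omega), hbot, pow_add]
    simp
  let f : L →+ gm γ L :=
    { toFun := fun x => ⟨γ • x.1, smul_mem_gm x.2⟩
      map_zero' := by ext <;> simp
      map_add' := fun x y => by ext <;> simp [mul_add] }
  have hf : Function.Surjective f := by
    rintro ⟨_, x, hx, rfl⟩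
    exact ⟨⟨x, hx⟩, rfl⟩
  have h1 := card_preimage_mul f hf {0}
  rw [Nat.card_coe_set_eq {(0 : gm γ L)}, Set.ncard_singleton, one_mul] at h1
  rw [← h1]
  congr 1
  rw [← hc]
  have hz : ∀ x : Word R N₁ N₂, γ • x = 0 ↔ x ∈ Fs γ (2 * (e - 1)) := by
    intro x
    constructor
    · intro hx
      exact mem_Fs_of_smul_mem h (by omega) (by rw [hx]; exact zero_mem _)
    · intro hx
      have := smul_mem_Fs hx
      rwa [hbot, Submodule.mem_bot] at this
  refine Nat.card_congr ⟨fun x => ⟨x.1.1, (hz _).1 (congrArg Subtype.val x.2)⟩,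
    fun x => ⟨⟨x.1, hL (by rw [show 2 * e - 2 = 2 * (e - 1) by omega]; exact x.2)⟩,
      Subtype.ext ((hz _).2 x.2)⟩, fun _ => rfl, fun _ => rfl⟩

/-- If `γ x ∈ γ L` then `x ∈ L`, provided that `L` contains the annihilator of `γ`. -/
theorem mem_of_smul_mem_gm (h : IsChain γ e) (he : 1 ≤ e) {L : Submodule R (Word R N₁ N₂)}
    (hL : Fs γ (2 * e - 2) ≤ L) {x : Word R N₁ N₂} (hx : γ • x ∈ gm γ L) : x ∈ L := by
  obtain ⟨y, hy, e1⟩ := hx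
  have h0 : γ • (x - y) = 0 := by
    rw [smul_sub, sub_eq_zero]
    exact e1.symm
  have : x - y ∈ Fs γ (2 * e - 2) :=
    mem_Fs_of_smul_mem h (by omega) (by rw [h0]; exact zero_mem _)
  simpa using L.add_mem (hL this) hy

/-- The second isomorphism theorem for cardinalities. -/
theorem card_sup_mul_card_inf {M : Type*} [AddCommGroup M] [Module R M] [Finite M]
    (A B : Submodule R M) :
    Nat.card (A ⊔ B : Submodule R M) * Nat.card (A ⊓ B : Submodule R M) =
      Nat.card A * Nat.card B := by
  let f : A × B →+ (A ⊔ B : Submodule R M) :=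
    { toFun := fun p => ⟨p.1.1 + p.2.1, Submodule.add_mem_sup p.1.2 p.2.2⟩
      map_zero' := by ext; simp
      map_add' := fun p p' => by ext; simp; abel }
  have hf : Function.Surjective f := by
    rintro ⟨x, hx⟩
    obtain ⟨a, ha, b, hb, rfl⟩ := Submodule.mem_sup.1 hx
    exact ⟨(⟨a, ha⟩, ⟨b, hb⟩), rfl⟩
  have h1 := card_preimage_mul f hf {0}
  rw [Nat.card_coe_set_eq {(0 : (A ⊔ B : Submodule R M))}, Set.ncard_singleton, one_mul,
    Nat.card_prod] at h1
  rw [← h1, mul_comm]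
  congr 1
  have hn : ∀ x : (f ⁻¹' {0} : Set (A × B)), (x.1.1 : M) + x.1.2 = 0 := fun x =>
    congrArg Subtype.val x.2
  refine Nat.card_congr ⟨fun x => ⟨(⟨x.1, x.2.1⟩, ⟨-x.1, B.neg_mem x.2.2⟩), ?_⟩,
    fun x => ⟨x.1.1, x.1.1.2, ?_⟩, fun x => rfl, fun x => ?_⟩
  · exact Subtype.ext (by simp [f])
  · rw [eq_neg_of_add_eq_zero_left (hn x)]
    exact B.neg_mem x.1.2.2
  · refine Subtype.ext (Prod.ext rfl (Subtype.ext ?_))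
    exact neg_eq_of_add_eq_zero_right (hn x)

end Local

/-- The fibre size is allowed to be rational because Gaussian binomials are defined as rational
products. -/
theorem ncard_eq_mul_of_fibers_rat {α β : Type*} [Finite α] [Finite β] {S : Set α} {T : Set β}
    (f : α → β) (hf : ∀ a ∈ S, f a ∈ T) {c : ℚ}
    (hc : ∀ b ∈ T, (Set.ncard {a | a ∈ S ∧ f a = b} : ℚ) = c) : (S.ncard : ℚ) = T.ncard * c := by
  classical
  have := Fintype.ofFinite α
  have := Fintype.ofFinite β
  rw [Set.ncard_eq_toFinset_card', Set.ncard_eq_toFinset_card',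
    Finset.card_eq_sum_card_fiberwise (f := f) (t := T.toFinset) (fun a ha => by
      simpa using hf a (by simpa using ha)), Nat.cast_sum,
    Finset.sum_congr rfl (g := fun _ => c), Finset.sum_const, nsmul_eq_mul]
  intro b hb
  rw [← hc b (by simpa using hb), Set.ncard_eq_toFinset_card']
  congr 2
  ext a
  simp

theorem ncard_eq_mul_of_fibers {α β : Type*} [Finite α] [Finite β] {S : Set α} {T : Set β}
    (f : α → β) (hf : ∀ a ∈ S, f a ∈ T) {c : ℕ}
    (hc : ∀ b ∈ T, Set.ncard {a | a ∈ S ∧ f a = b} = c) : S.ncard = T.ncard * c := by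
  have := ncard_eq_mul_of_fibers_rat (c := (c : ℚ)) f hf fun b hb => by rw [hc b hb]
  exact_mod_cast this

/-! ### Two-layer counts, and the middle part of the isotropic lifts of `γ L`. -/

section Counting

variable {R : Type*} [CommRing R] [IsLocalRing R] [Finite R] {γ : R}

local notation "qq" => Nat.card (ResidueField R)

theorem qq_pos : 0 < qq := Nat.card_pos

/-- Counting submodules between `A` and `B` by the sizes of their two layers with respect to `K`. -/
theorem ncard_two_layers {M : Type*} [AddCommGroup M] [Module R M] [Finite M]
    (hmax : maximalIdeal R = Ideal.span {γ}) {A K B : Submodule R M} (hAK : A ≤ K) (hKB : K ≤ B)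
    (hγ : ∀ x ∈ B, γ • x ∈ A) {u k w l : ℕ} (hK : Nat.card K = qq ^ (u + k) * Nat.card A)
    (hB : Nat.card B = qq ^ (w + l) * Nat.card K) :
    (Set.ncard {C : Submodule R M | A ≤ C ∧ C ≤ B ∧
      Nat.card (C ⊓ K : Submodule R M) = qq ^ k * Nat.card A ∧
      Nat.card C = qq ^ (k + l) * Nat.card A} : ℚ) =
      gauss qq (u + k) k * gauss qq (w + l) l * qq ^ (u * l) := by
  -- A submodule `C` is found from `D = C ⊓ K`, then `D' = C ⊔ K`, and then as one of the
  -- complements of `K` in `D'` over `D`. The three choices give the three factors.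
  rw [ncard_eq_mul_of_fibers (T := {C : Submodule R M | A ≤ C ∧ C ≤ K ∧
      Nat.card C = qq ^ k * Nat.card A}) (fun C => C ⊓ K)
      (c := Set.ncard {C : Submodule R M | K ≤ C ∧ C ≤ B ∧ Nat.card C = qq ^ l * Nat.card K} *
        qq ^ (u * l)) (fun C hC => ⟨le_inf hC.1 hAK, inf_le_right, hC.2.2.1⟩)]
  · push_cast
    rw [ncard_submodules hmax hAK (fun x hx => hγ x (hKB hx)) (by omega) hK,
      ncard_submodules hmax hKB (fun x hx => hAK (hγ x hx)) (by omega) hB, mul_assoc]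
  rintro D ⟨hAD, hDK, hD⟩
  refine ncard_eq_mul_of_fibers (fun C => C ⊔ K) ?_ ?_
  · rintro C ⟨⟨hAC, hCB, -, hC⟩, rfl⟩
    refine ⟨le_sup_right, sup_le hCB hKB, ?_⟩
    have h1 := card_sup_mul_card_inf C K
    rw [hD, hC] at h1
    refine Nat.eq_of_mul_eq_mul_right (m := qq ^ k * Nat.card A)
      (Nat.mul_pos (pow_pos qq_pos _) Nat.card_pos) (h1.trans ?_)
    ring
  · rintro D' ⟨hKD', hD'B, hD'⟩
    have hKD : Nat.card K = qq ^ u * Nat.card D := by rw [hK, hD, pow_add, mul_assoc]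
    rw [← ncard_complements hmax hDK hKD' (fun x hx => hAD (hγ x (hD'B hx))) hKD hD']
    congr 1
    ext C
    constructor
    · rintro ⟨⟨_, h1⟩, h2⟩
      exact ⟨h1, h2⟩
    · rintro ⟨rfl, rfl⟩
      refine ⟨⟨⟨hAD.trans inf_le_left, le_sup_left.trans hD'B, hD, ?_⟩, rfl⟩, rfl⟩
      have h1 := card_sup_mul_card_inf C K
      rw [hD, hD'] at h1
      refine Nat.eq_of_mul_eq_mul_right (m := Nat.card K) Nat.card_pos (h1.symm.trans ?_)
      ring

variable {N₁ N₂ e ν M P : ℕ}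

/-- The lattice of a self-orthogonal code over `R_{ν+2}`, with the ranks of its last two torsion
codes. -/
structure IsBase (γ : R) (e ν M P : ℕ) (L : Submodule R (Word R N₁ N₂)) : Prop where
  chain : IsChain γ e
  odd : Odd qq
  he : ν + 4 ≤ e
  le : Fs γ (2 * ν + 3) ≤ L
  iso : ∀ x ∈ L, ∀ y ∈ L, γ ^ (ν + 2) ∣ bil γ x y
  cX : Nat.card (L ⊓ Fs γ (2 * ν + 2) : Submodule R (Word R N₁ N₂)) =
    qq ^ M * Nat.card (Fs γ (2 * ν + 3) : Submodule R (Word R N₁ N₂))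
  cY : Nat.card (L ⊓ Fs γ (2 * ν + 1) : Submodule R (Word R N₁ N₂)) =
    qq ^ P * Nat.card (L ⊓ Fs γ (2 * ν + 2) : Submodule R (Word R N₁ N₂))

namespace IsBase

variable {L : Submodule R (Word R N₁ N₂)}

theorem gm_le_Fs (L : Submodule R (Word R N₁ N₂)) : gm γ L ≤ Fs γ 2 := by
  rw [← zero_add 2, ← gm_Fs, Fs_zero]
  exact gm_mono le_top

theorem annihilator_le (hL : IsBase γ e ν M P L) {s : ℕ} (hs : s ≤ 2 * ν + 6) :
    (Fs γ (2 * e - 2) : Submodule R (Word R N₁ N₂)) ≤ Fs γ s :=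
  Fs_antitone (by have := hL.he; omega)

theorem Fs_le_gm (hL : IsBase γ e ν M P L) : Fs γ (2 * ν + 5) ≤ gm γ L := by
  rw [show 2 * ν + 5 = 2 * ν + 3 + 2 by ring, ← gm_Fs]
  exact gm_mono hL.le

theorem mem_of_smul (hL : IsBase γ e ν M P L) {x : Word R N₁ N₂} (hx : γ • x ∈ gm γ L) : x ∈ L :=
  mem_of_smul_mem_gm hL.chain (by have := hL.he; omega)
    ((hL.annihilator_le (by omega)).trans hL.le) hx

theorem iso_gm (hL : IsBase γ e ν M P L) {x y : Word R N₁ N₂} (hx : x ∈ gm γ L)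
    (hy : y ∈ gm γ L) : γ ^ (ν + 4) ∣ bil γ x y := by
  obtain ⟨x, hx, rfl⟩ := hx
  obtain ⟨y, hy, rfl⟩ := hy
  simp only [LinearMap.lsmul_apply, map_smul, LinearMap.smul_apply, smul_eq_mul]
  rw [show γ ^ (ν + 4) = γ * (γ * γ ^ (ν + 2)) by ring]
  exact mul_dvd_mul_left _ (mul_dvd_mul_left _ (hL.iso x hx y hy))

theorem iso_gm_left (hL : IsBase γ e ν M P L) {x y : Word R N₁ N₂} (hx : x ∈ gm γ L)
    (hy : y ∈ L) : γ ^ (ν + 3) ∣ bil γ x y := by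
  obtain ⟨x, hx, rfl⟩ := hx
  simp only [LinearMap.lsmul_apply, map_smul, LinearMap.smul_apply, smul_eq_mul]
  rw [pow_succ']
  exact mul_dvd_mul_left _ (hL.iso x hx y hy)

/-- The lifts of `γ L` to isotropic submodules modulo `γ ^ (ν + 3)` with a given image modulo
`L ⊓ Fs γ 2`. -/
theorem ncard_middle_part (hL : IsBase γ e ν M P L) {T : Submodule R (Word R N₁ N₂)} {t κ : ℕ}
    (hT : L ⊓ Fs γ 2 ≤ T) (hTL : T ≤ L)
    (ht : Nat.card T = qq ^ t * Nat.card (L ⊓ Fs γ 2 : Submodule R (Word R N₁ N₂)))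
    (hκ : Nat.card (L ⊓ Fs γ 2 : Submodule R (Word R N₁ N₂)) = qq ^ κ * Nat.card (gm γ L)) :
    ∃ c, c + t * (t + 1) / 2 = t * κ ∧
      Set.ncard {H : Submodule R (Word R N₁ N₂) | H ⊓ Fs γ 2 = gm γ L ∧ H ⊔ (L ⊓ Fs γ 2) = T ∧
        ∀ x ∈ H, ∀ y ∈ H, γ ^ (ν + 3) ∣ bil γ x y} = qq ^ c := by
  have hmax := hL.chain.max
  -- Modulo `γ ^ (ν + 3)` the orthogonal of `Fs γ (2 * ν + 3)` is `Fs γ 2`. So `H` is found in two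
  -- steps: `H₂ = H ⊔ J` is an arbitrary complement of `L ⊓ Fs γ 2` over `J`, and isotropy
  -- constrains only the choice of `H` inside `H₂`.
  set J := gm γ L ⊔ Fs γ (2 * ν + 3) with hJ
  have hgJ : gm γ L ≤ J := le_sup_left
  have hJ2 : J ≤ Fs γ 2 := sup_le (gm_le_Fs L) (Fs_antitone (by omega))
  have hJL : J ≤ L := sup_le gm_le hL.le
  have hJLF : J ≤ L ⊓ Fs γ 2 := le_inf hJL hJ2
  obtain ⟨j, hj⟩ := exists_card_eq_pow_mul hmax hgJ fun x hx => smul_mem_gm (hJL hx)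
  obtain ⟨j', hj'⟩ := exists_card_eq_pow_mul hmax hJLF fun x hx => hgJ (smul_mem_gm hx.1)
  have hκj : κ = j' + j := by
    refine pow_mul_card_inj (hκ.symm.trans (hj'.trans ?_))
    rw [hj, pow_add, mul_assoc]
  have hstep : ∀ H₂ ∈ {C : Submodule R (Word R N₁ N₂) | C ⊓ (L ⊓ Fs γ 2) = J ∧
      C ⊔ (L ⊓ Fs γ 2) = T}, t ≤ j ∧ Set.ncard {H : Submodule R (Word R N₁ N₂) |
        H ⊓ J = gm γ L ∧ H ⊔ J = H₂ ∧ ∀ x ∈ H, ∀ y ∈ H, γ ^ (ν + 3) ∣ bil γ x y} =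
        qq ^ (t * (j - t) + t * (t - 1) / 2) := by
    rintro H₂ ⟨h1, h2⟩
    have hH₂L : H₂ ≤ L := (le_sup_left.trans_eq h2).trans hTL
    have hJH₂ : J ≤ H₂ := h1.symm.trans_le inf_le_left
    have hcard : Nat.card H₂ = qq ^ t * Nat.card J := by
      have h3 := card_sup_mul_card_inf H₂ (L ⊓ Fs γ 2)
      rw [h1, h2, ht] at h3
      refine Nat.eq_of_mul_eq_mul_right (m := Nat.card (L ⊓ Fs γ 2 : Submodule R (Word R N₁ N₂)))
        Nat.card_pos (h3.symm.trans ?_)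
      ring
    -- Within `H₂` the submodule `J` is its own orthogonal, so it serves both as `K` and as `Λ`.
    refine ncard_isotropic_complements hmax hL.odd (n := ν + 2)
      (hL.chain.pow_ne (by have := hL.he; omega)) (bil γ) (bil_symm γ) hgJ le_rfl hJH₂
      (fun x hx => smul_mem_gm (hH₂L hx)) (fun x hx y hy => hL.iso x (hH₂L hx) y (hH₂L hy))
      (fun x hx y hy => hL.iso_gm_left hx (hH₂L hy)) (fun x hx hp => ?_) (fun x hx y hy => ?_)
      hj hcard hcard
    · rw [← h1]
      refine ⟨hx, hH₂L hx, ?_⟩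
      exact mem_Fs_of_perp hL.chain (n := ν + 3) (s := 2 * ν + 3) (by have := hL.he; omega)
        (by ring) fun y hy => hp y (le_sup_right (a := gm γ L) hy)
    · obtain ⟨x, hx', x', hx'', rfl⟩ := Submodule.mem_sup.1 hx
      obtain ⟨y, hy', y', hy'', rfl⟩ := Submodule.mem_sup.1 hy
      rw [map_add, map_add, LinearMap.add_apply, LinearMap.add_apply]
      refine dvd_add (dvd_add (hL.iso_gm_left hx' (gm_le hy')) ?_)
        (dvd_add (hL.iso_gm_left hx' (hL.le hy'')) ?_)
      · rw [bil_symm]; exact hL.iso_gm_left hy' (hL.le hx'')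
      · exact pow_dvd_bil hx'' hy'' (by omega)
  have hfib := ncard_eq_mul_of_fibers
    (S := {H : Submodule R (Word R N₁ N₂) | H ⊓ Fs γ 2 = gm γ L ∧ H ⊔ (L ⊓ Fs γ 2) = T ∧
        ∀ x ∈ H, ∀ y ∈ H, γ ^ (ν + 3) ∣ bil γ x y})
    (T := {C : Submodule R (Word R N₁ N₂) | C ⊓ (L ⊓ Fs γ 2) = J ∧ C ⊔ (L ⊓ Fs γ 2) = T})
    (fun H => H ⊔ J) (c := qq ^ (t * (j - t) + t * (t - 1) / 2)) ?_ ?_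
  · have hne := ncard_complements hmax hJLF hT (fun x hx => hgJ (smul_mem_gm (hTL hx))) hj' ht
    rw [hne, ← pow_add] at hfib
    -- The inequality is a by-product of the isotropic count, which needs at least one `H₂` to be
    -- applied to.
    have htj : t ≤ j := by
      have hn : {C : Submodule R (Word R N₁ N₂) | C ⊓ (L ⊓ Fs γ 2) = J ∧
          C ⊔ (L ⊓ Fs γ 2) = T}.Nonempty := by
        refine Set.nonempty_of_ncard_ne_zero ?_
        rw [hne]
        exact (pow_pos qq_pos _).ne'
      obtain ⟨H₂, hH₂⟩ := hn
      exact (hstep H₂ hH₂).1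
    refine ⟨_, ?_, hfib⟩
    obtain ⟨d, rfl⟩ := Nat.exists_eq_add_of_le htj
    rw [Nat.add_sub_cancel_left, hκj]
    have hh : t * (t - 1) / 2 + t * (t + 1) / 2 = t * t := by
      have h1 := Nat.div_mul_cancel (Nat.even_mul_pred_self t).two_dvd
      have h2 := Nat.div_mul_cancel (Nat.even_mul_succ_self t).two_dvd
      have h3 : t * (t - 1) + t * (t + 1) = 2 * (t * t) := by
        cases t with
        | zero => rfl
        | succ n => rw [Nat.add_sub_cancel]; ring
      omega
    nlinarith
  · rintro H ⟨h1, h2, -⟩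
    have hHL : H ≤ L := (le_sup_left.trans_eq h2).trans hTL
    constructor
    · rw [sup_comm, sup_inf_assoc_of_le _ hJLF, ← inf_assoc, inf_eq_left.2 hHL, h1]
      exact sup_eq_left.2 hgJ
    · rw [sup_assoc, sup_eq_right.2 hJLF, h2]
  · intro H₂ hH₂
    rw [← (hstep H₂ hH₂).2]
    obtain ⟨h1, h2⟩ := hH₂
    congr 1
    ext H
    constructor
    · rintro ⟨⟨h3, h4, h5⟩, h6⟩
      refine ⟨?_, h6, h5⟩
      rw [← inf_eq_right.2 hJ2, ← inf_assoc, h3]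
      exact inf_eq_left.2 hgJ
    · rintro ⟨h3, rfl, h5⟩
      refine ⟨⟨?_, ?_, h5⟩, rfl⟩
      · have hHL : H ≤ L := le_sup_left.trans ((le_sup_left.trans_eq h2).trans hTL)
        rw [← h3, ← h1]
        refine le_antisymm (le_inf inf_le_left (le_inf (inf_le_left.trans le_sup_left)
          (le_inf (inf_le_left.trans hHL) inf_le_right))) ?_
        exact le_inf inf_le_left (inf_le_right.trans (inf_le_right.trans inf_le_right))
      · rw [← sup_eq_right.2 hJLF, ← sup_assoc, h2]

end IsBase

end Counting

/-! ### The two stages: the lattices `H`, then the lattices with a given `H`. -/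

section Counting

variable {R : Type*} [CommRing R] [IsLocalRing R] [Finite R] {γ : R}

local notation "qq" => Nat.card (ResidueField R)

variable {N₁ N₂ e ν M P : ℕ}

namespace IsBase

variable {L : Submodule R (Word R N₁ N₂)}

/-- The isotropic lifts modulo `γ ^ (ν + 3)` whose first two layers are given. -/
theorem ncard_upper_part (hL : IsBase γ e ν M P L) {Ta Tb : Submodule R (Word R N₁ N₂)}
    {k₀ l₀ l₁ κ : ℕ} (ha : L ⊓ Fs γ 1 ≤ Ta) (haL : Ta ≤ L) (hb : L ⊓ Fs γ 2 ≤ Tb)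
    (hbL : Tb ≤ L ⊓ Fs γ 1)
    (hca : Nat.card Ta = qq ^ k₀ * Nat.card (L ⊓ Fs γ 1 : Submodule R (Word R N₁ N₂)))
    (hcb : Nat.card Tb = qq ^ l₀ * Nat.card (L ⊓ Fs γ 2 : Submodule R (Word R N₁ N₂)))
    (hl : Nat.card (L ⊓ Fs γ 1 : Submodule R (Word R N₁ N₂)) =
      qq ^ (l₀ + l₁) * Nat.card (L ⊓ Fs γ 2 : Submodule R (Word R N₁ N₂)))
    (hκ : Nat.card (L ⊓ Fs γ 2 : Submodule R (Word R N₁ N₂)) = qq ^ κ * Nat.card (gm γ L)) :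
    ∃ c, c + (k₀ + l₀) * (k₀ + l₀ + 1) / 2 = (k₀ + l₀) * κ ∧
      Set.ncard {H : Submodule R (Word R N₁ N₂) | H ≤ L ∧ H ⊓ Fs γ 2 = gm γ L ∧
        (∀ x ∈ H, ∀ y ∈ H, γ ^ (ν + 3) ∣ bil γ x y) ∧ H ⊔ (L ⊓ Fs γ 1) = Ta ∧
        (H ⊓ Fs γ 1) ⊔ (L ⊓ Fs γ 2) = Tb} = qq ^ (k₀ * l₁ + c) := by
  have hmax := hL.chain.max
  have h21 : (L ⊓ Fs γ 2 : Submodule R (Word R N₁ N₂)) ≤ L ⊓ Fs γ 1 :=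
    inf_le_inf_left _ (Fs_antitone (by omega))
  have hTcard : ∀ T ∈ {C : Submodule R (Word R N₁ N₂) | C ⊓ (L ⊓ Fs γ 1) = Tb ∧
      C ⊔ (L ⊓ Fs γ 1) = Ta}, L ⊓ Fs γ 2 ≤ T ∧ T ≤ L ∧
        Nat.card T = qq ^ (k₀ + l₀) * Nat.card (L ⊓ Fs γ 2 : Submodule R (Word R N₁ N₂)) := by
    rintro T ⟨h1, h2⟩
    refine ⟨hb.trans (h1.symm.trans_le inf_le_left), (le_sup_left.trans_eq h2).trans haL, ?_⟩
    have h3 := card_sup_mul_card_inf T (L ⊓ Fs γ 1)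
    rw [h1, h2, hca, hcb] at h3
    refine Nat.eq_of_mul_eq_mul_right (m := Nat.card (L ⊓ Fs γ 1 : Submodule R (Word R N₁ N₂)))
      Nat.card_pos (h3.symm.trans ?_)
    ring
  -- The possible sums `T = H ⊔ (L ⊓ Fs γ 2)` are the complements of `L ⊓ Fs γ 1` in `Ta` over `Tb`.
  have hne := ncard_complements hmax (A := Tb) (K := L ⊓ Fs γ 1) (B := Ta) (a := l₁) (b := k₀)
    hbL ha (fun x hx => hb ⟨L.smul_mem _ (haL hx), gm_le_Fs L (smul_mem_gm (haL hx))⟩)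
    (by rw [hl, hcb, pow_add]; ring) hca
  have hn : {C : Submodule R (Word R N₁ N₂) | C ⊓ (L ⊓ Fs γ 1) = Tb ∧
      C ⊔ (L ⊓ Fs γ 1) = Ta}.Nonempty := by
    refine Set.nonempty_of_ncard_ne_zero ?_
    rw [hne]
    exact (pow_pos qq_pos _).ne'
  obtain ⟨T₀, hT₀⟩ := hn
  -- The equation for `c` involves only dimensions, so the exponent found for one `T₀` serves for
  -- every `T`.
  obtain ⟨c, hc, -⟩ := hL.ncard_middle_part (hTcard T₀ hT₀).1 (hTcard T₀ hT₀).2.1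
    (hTcard T₀ hT₀).2.2 hκ
  refine ⟨c, hc, ?_⟩
  rw [ncard_eq_mul_of_fibers (T := {C : Submodule R (Word R N₁ N₂) | C ⊓ (L ⊓ Fs γ 1) = Tb ∧
      C ⊔ (L ⊓ Fs γ 1) = Ta}) (fun H => H ⊔ (L ⊓ Fs γ 2)) (c := qq ^ c), hne, ← pow_add,
    mul_comm l₁]
  · rintro H ⟨h1, h2, -, h4, h5⟩
    constructor
    · rw [← inf_assoc, inf_eq_left.2 (sup_le h1 inf_le_left), sup_comm,
        sup_inf_assoc_of_le _ (h21.trans inf_le_right), sup_comm, h5]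
    · rw [sup_assoc, sup_eq_right.2 h21, h4]
  · intro T hT
    obtain ⟨hT1, hTL, hTc⟩ := hTcard T hT
    obtain ⟨c', hc', hres⟩ := hL.ncard_middle_part hT1 hTL hTc hκ
    have hcc : c' = c := by omega
    rw [← hcc, ← hres]
    congr 1
    ext H
    constructor
    · rintro ⟨⟨-, h2, h3, -, -⟩, h6⟩
      exact ⟨h2, h6, h3⟩
    · rintro ⟨h2, rfl, h3⟩
      have hHL : H ≤ L := le_sup_left.trans hTL
      refine ⟨⟨hHL, h2, h3, ?_, ?_⟩, rfl⟩
      · rw [← hT.2, sup_assoc, sup_eq_right.2 h21]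
      · rw [← hT.1, ← inf_assoc, inf_eq_left.2 (sup_le hHL inf_le_left),
          sup_comm H, sup_inf_assoc_of_le _ (h21.trans inf_le_right), sup_comm]

/-- Each multiplication by `γ` divides both cardinalities by `q ^ (N₁ + N₂)`, so the relative index
survives. -/
theorem card_gm_gm (hL : IsBase γ e ν M P L) {X : Submodule R (Word R N₁ N₂)} {d : ℕ}
    (hX : Fs γ (2 * ν + 3) ≤ X)
    (hd : Nat.card X = qq ^ d * Nat.card (Fs γ (2 * ν + 3) : Submodule R (Word R N₁ N₂))) :
    Nat.card (gm γ (gm γ X)) =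
      qq ^ d * Nat.card (Fs γ (2 * ν + 7) : Submodule R (Word R N₁ N₂)) := by
  have he : 1 ≤ e := by have := hL.he; omega
  have h5 : Fs γ (2 * ν + 5) ≤ gm γ X := by
    rw [show 2 * ν + 5 = 2 * ν + 3 + 2 by ring, ← gm_Fs]
    exact gm_mono hX
  have h1 := card_eq_card_gm hL.chain he ((hL.annihilator_le (by omega)).trans hX)
  have h2 := card_eq_card_gm hL.chain he ((hL.annihilator_le (by omega)).trans h5)
  have h3 := card_eq_card_gm (N₁ := N₁) (N₂ := N₂) hL.chain he
    (hL.annihilator_le (s := 2 * ν + 3) (by omega))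
  have h4 := card_eq_card_gm (N₁ := N₁) (N₂ := N₂) hL.chain he
    (hL.annihilator_le (s := 2 * ν + 5) (by omega))
  rw [gm_Fs] at h3 h4
  rw [h1, h2, h3, h4] at hd
  have hpos : 0 < qq ^ (N₁ + N₂) * qq ^ (N₁ + N₂) :=
    Nat.mul_pos (pow_pos qq_pos _) (pow_pos qq_pos _)
  refine Nat.eq_of_mul_eq_mul_left hpos ?_
  calc _ = _ := by rw [mul_assoc, hd]
    _ = _ := by ring

/-- The orthogonal module of `H` modulo `γ ^ n`. -/
def perp (γ : R) (n : ℕ) (H : Submodule R (Word R N₁ N₂)) : Submodule R (Word R N₁ N₂) where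
  carrier := {x | ∀ y ∈ H, γ ^ n ∣ bil γ x y}
  zero_mem' := fun y _ => by simp
  add_mem' := fun hx hx' y hy => by
    rw [map_add, LinearMap.add_apply]
    exact dvd_add (hx y hy) (hx' y hy)
  smul_mem' := fun c x hx y hy => by
    rw [map_smul, LinearMap.smul_apply]
    exact (hx y hy).mul_left c

/-- The isotropic submodules modulo `γ ^ (ν + 4)` with a given sum with `Fs γ (2 * ν + 5)`. -/
theorem ncard_lower_part (hL : IsBase γ e ν M P L) {H : Submodule R (Word R N₁ N₂)}
    {k₀ l₀ k l u w : ℕ} (hN₁ : N₁ = M + k₀ + k + u) (hN₂ : N₂ = P + l₀ + l + w) (hHL : H ≤ L)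
    (hH2 : H ⊓ Fs γ 2 = gm γ L) (hiso : ∀ x ∈ H, ∀ y ∈ H, γ ^ (ν + 3) ∣ bil γ x y)
    (hk : Nat.card H = qq ^ k₀ * Nat.card (H ⊓ Fs γ 1 : Submodule R (Word R N₁ N₂)))
    (hl : Nat.card (H ⊓ Fs γ 1 : Submodule R (Word R N₁ N₂)) = qq ^ l₀ * Nat.card (gm γ L)) :
    (Set.ncard {C : Submodule R (Word R N₁ N₂) | C ⊔ Fs γ (2 * ν + 5) = H ∧
      Fs γ (2 * ν + 7) ≤ C ∧ (∀ x ∈ C, ∀ y ∈ C, γ ^ (ν + 4) ∣ bil γ x y) ∧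
      Nat.card (C ⊓ Fs γ (2 * ν + 5) : Submodule R (Word R N₁ N₂)) =
        qq ^ (P + l) * Nat.card (C ⊓ Fs γ (2 * ν + 6) : Submodule R (Word R N₁ N₂)) ∧
      Nat.card (C ⊓ Fs γ (2 * ν + 6) : Submodule R (Word R N₁ N₂)) =
        qq ^ (M + k) * Nat.card (Fs γ (2 * ν + 7) : Submodule R (Word R N₁ N₂))} : ℚ) =
      gauss qq (u + k) k * gauss qq (w + l) l * qq ^ (u * l) *
        qq ^ ((M + P) * (u + w) + (k₀ + l₀) * (k₀ + l₀ - 1) / 2) := by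
  have hch := hL.chain
  have hmax := hch.max
  have he := hL.he
  -- Every admissible `C` contains `G = γ H`. It is recovered from `I₀ = C ⊓ W`, which lies between
  -- `G` and the orthogonal of `H` in `W`, and then as an isotropic complement of `W` in `H` over
  -- `I₀`. The smaller `W₁` separates the left layer of `I₀` from the right one.
  set G := gm γ H with hG
  set W := G ⊔ Fs γ (2 * ν + 5) with hW
  set W₁ := G ⊔ Fs γ (2 * ν + 6) with hW₁
  have hgH : gm γ L ≤ H := hH2.symm.trans_le inf_le_left
  have hI : Fs γ (2 * ν + 5) ≤ gm γ L := hL.Fs_le_gm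
  have hGL : G ≤ gm γ L := gm_mono hHL
  have hWg : W ≤ gm γ L := sup_le hGL hI
  have hWH : W ≤ H := hWg.trans hgH
  have h65 : (Fs γ (2 * ν + 6) : Submodule R (Word R N₁ N₂)) ≤ Fs γ (2 * ν + 5) :=
    Fs_antitone (by omega)
  have hW₁W : W₁ ≤ W := sup_le_sup_left h65 _
  have hF7 : Fs γ (2 * ν + 7) ≤ G := by
    rw [show 2 * ν + 7 = 2 * ν + 5 + 2 by ring, ← gm_Fs]
    exact gm_mono (hI.trans hgH)
  have hp₁ : qq ^ N₁ = qq ^ (M + k₀ + k + u) := congrArg (qq ^ ·) hN₁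
  have hp₂ : qq ^ N₂ = qq ^ (P + l₀ + l + w) := congrArg (qq ^ ·) hN₂
  have cG : Nat.card H = qq ^ (N₁ + N₂) * Nat.card G :=
    card_eq_card_gm hch (by omega) ((hL.annihilator_le (by omega)).trans (hI.trans hgH))
  have cI1 : Nat.card (Fs γ (2 * ν + 6) : Submodule R (Word R N₁ N₂)) =
      qq ^ N₁ * Nat.card (Fs γ (2 * ν + 7) : Submodule R (Word R N₁ N₂)) := by
    have := card_Fs_even (N₁ := N₁) (N₂ := N₂) hch (i := ν + 3) (by omega)
    exact this
  have cI : Nat.card (Fs γ (2 * ν + 5) : Submodule R (Word R N₁ N₂)) =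
      qq ^ (N₁ + N₂) * Nat.card (Fs γ (2 * ν + 7) : Submodule R (Word R N₁ N₂)) := by
    have := card_Fs_odd (N₁ := N₁) (N₂ := N₂) hch (i := ν + 2) (by omega)
    rw [show 2 * (ν + 2) + 1 = 2 * ν + 5 by ring, show 2 * (ν + 2) + 2 = 2 * ν + 6 by ring,
      cI1] at this
    rw [this, pow_add]
    ring
  have hGinf : ∀ s, 2 * ν + 1 ≤ s → s ≤ 2 * ν + 2 →
      G ⊓ Fs γ (s + 4) = gm γ (gm γ (L ⊓ Fs γ s)) := by
    intro s h1 h2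
    rw [← gm_inf_Fs hch (by omega), ← hH2, inf_assoc,
      inf_eq_right.2 (Fs_antitone (show 2 ≤ s + 2 by omega)), hG,
      show s + 4 = s + 2 + 2 by ring, gm_inf_Fs hch (by omega)]
  have cGI1 : Nat.card (G ⊓ Fs γ (2 * ν + 6) : Submodule R (Word R N₁ N₂)) =
      qq ^ M * Nat.card (Fs γ (2 * ν + 7) : Submodule R (Word R N₁ N₂)) := by
    rw [show 2 * ν + 6 = 2 * ν + 2 + 4 by ring, hGinf _ (by omega) (by omega)]
    exact hL.card_gm_gm (le_inf hL.le (Fs_antitone (by omega))) hL.cX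
  have cGI : Nat.card (G ⊓ Fs γ (2 * ν + 5) : Submodule R (Word R N₁ N₂)) =
      qq ^ (P + M) * Nat.card (Fs γ (2 * ν + 7) : Submodule R (Word R N₁ N₂)) := by
    rw [show 2 * ν + 5 = 2 * ν + 1 + 4 by ring, hGinf _ (by omega) (by omega)]
    exact hL.card_gm_gm (le_inf hL.le (Fs_antitone (by omega)))
      (by rw [hL.cY, hL.cX, pow_add, mul_assoc])
  have p7 : 0 < Nat.card (Fs γ (2 * ν + 7) : Submodule R (Word R N₁ N₂)) := Nat.card_pos
  have cW : Nat.card W = qq ^ (k₀ + k + u + (l₀ + l + w)) * Nat.card G := by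
    have h1 := card_sup_mul_card_inf G (Fs γ (2 * ν + 5))
    rw [cI, cGI] at h1
    refine Nat.eq_of_mul_eq_mul_right (m := qq ^ (P + M) *
      Nat.card (Fs γ (2 * ν + 7) : Submodule R (Word R N₁ N₂)))
      (Nat.mul_pos (pow_pos qq_pos _) p7) (h1.trans ?_)
    rw [pow_add _ N₁ N₂, hp₁, hp₂]
    ring
  have cW₁ : Nat.card W₁ = qq ^ (k₀ + k + u) * Nat.card G := by
    have h1 := card_sup_mul_card_inf G (Fs γ (2 * ν + 6))
    rw [cI1, cGI1] at h1
    refine Nat.eq_of_mul_eq_mul_right (m := qq ^ M *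
      Nat.card (Fs γ (2 * ν + 7) : Submodule R (Word R N₁ N₂)))
      (Nat.mul_pos (pow_pos qq_pos _) p7) (h1.trans ?_)
    rw [hp₁]
    ring
  -- Already `Fs γ (2 * ν + 5) ≤ W` has orthogonal `Fs γ 2` modulo `γ ^ (ν + 4)`, and `H ⊓ Fs γ 2 =
  -- γ L`.
  have hmemH2 : ∀ x ∈ H, (∀ y ∈ W, γ ^ (ν + 4) ∣ bil γ x y) → x ∈ gm γ L := by
    intro x hx hp
    rw [← hH2]
    exact ⟨hx, mem_Fs_of_perp hch (n := ν + 4) (s := 2 * ν + 5) he (by ring)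
      fun y hy => hp y (le_sup_right (a := G) hy)⟩
  -- The pairing between `W` and `H` has right kernel `γ L`, so `W / B₀` is dual to `H / γ L`, of
  -- dimension `k₀ + l₀`.
  have cB₀ : Nat.card W = qq ^ (k₀ + l₀) *
      Nat.card (W ⊓ perp γ (ν + 4) H : Submodule R (Word R N₁ N₂)) := by
    refine card_mul_card_of_pairing hmax (n := ν + 3) (hch.pow_ne (by omega)) (bil γ)
      (A := W ⊓ perp γ (ν + 4) H) (A' := gm γ L) (B' := H) inf_le_left hgH (fun x hx y hy => hiso x (hWH hx) y hy)
      (fun x hx => ⟨fun h => h.2, fun h => ⟨hx, h⟩⟩) (fun y hy => ⟨fun h x hx => ?_, fun h => ?_⟩)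
      (by rw [hk, hl, pow_add, mul_assoc])
    · exact hL.iso_gm (hWg hx) h
    · exact hmemH2 y hy fun x hx => by rw [bil_symm]; exact h x hx
  -- Against `W₁` the right kernel grows to `H ⊓ Fs γ 1`, and only the `k₀` left dimensions remain.
  have cK₀ : Nat.card W₁ = qq ^ k₀ *
      Nat.card (W₁ ⊓ perp γ (ν + 4) H : Submodule R (Word R N₁ N₂)) := by
    refine card_mul_card_of_pairing hmax (n := ν + 3) (hch.pow_ne (by omega)) (bil γ)
      (A := W₁ ⊓ perp γ (ν + 4) H) (A' := H ⊓ Fs γ 1) (B' := H) inf_le_left inf_le_left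
      (fun x hx y hy => hiso x (hWH (hW₁W hx)) y hy)
      (fun x hx => ⟨fun h => h.2, fun h => ⟨hx, h⟩⟩) (fun y hy => ⟨fun h x hx => ?_, fun h => ?_⟩)
      hk
    · obtain ⟨_, ⟨x, hx', rfl⟩, x', hx'', rfl⟩ := Submodule.mem_sup.1 hx
      rw [map_add, LinearMap.add_apply]
      refine dvd_add ?_ (pow_dvd_bil hx'' h.2 (by omega))
      rw [LinearMap.lsmul_apply, map_smul, LinearMap.smul_apply, smul_eq_mul, pow_succ']
      exact mul_dvd_mul_left _ (hiso x hx' y hy)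
    · exact ⟨hy, mem_Fs_of_perp hch (n := ν + 4) (s := 2 * ν + 6) he (by ring)
        fun x hx => by rw [bil_symm]; exact h x (le_sup_right (a := G) hx)⟩
  set B₀ := W ⊓ perp γ (ν + 4) H with hB₀
  set K₀ := W₁ ⊓ perp γ (ν + 4) H with hK₀
  have cK : Nat.card K₀ = qq ^ (u + k) * Nat.card G := by
    refine Nat.eq_of_mul_eq_mul_left (pow_pos qq_pos k₀) (cK₀.symm.trans (cW₁.trans ?_))
    ring
  have cB : Nat.card B₀ = qq ^ (w + l) * Nat.card K₀ := by
    refine Nat.eq_of_mul_eq_mul_left (pow_pos qq_pos (k₀ + l₀)) (cB₀.symm.trans (cW.trans ?_))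
    rw [cK]
    ring
  have hGp : G ≤ perp γ (ν + 4) H := by
    rintro _ ⟨x, hx, rfl⟩ y hy
    rw [LinearMap.lsmul_apply, map_smul, LinearMap.smul_apply, smul_eq_mul, pow_succ']
    exact mul_dvd_mul_left _ (hiso x hx y hy)
  have hGK : G ≤ K₀ := le_inf le_sup_left hGp
  have hKB : K₀ ≤ B₀ := inf_le_inf_right _ hW₁W
  have hinfK : ∀ {C : Submodule R (Word R N₁ N₂)}, C ≤ B₀ → C ⊓ K₀ = C ⊓ W₁ := fun hC =>
    le_antisymm (inf_le_inf_left _ inf_le_left)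
      (le_inf inf_le_left (le_inf inf_le_right ((inf_le_left.trans hC).trans inf_le_right)))
  -- The prescribed layers of `C` translate by the modular law, since `G ≤ C` gives `G ⊔ (C ⊓ Fs γ
  -- (2 * ν + 6)) = C ⊓ W₁`.
  have hsz1 : ∀ C : Submodule R (Word R N₁ N₂), G ≤ C →
      (Nat.card (C ⊓ Fs γ (2 * ν + 6) : Submodule R (Word R N₁ N₂)) =
        qq ^ (M + k) * Nat.card (Fs γ (2 * ν + 7) : Submodule R (Word R N₁ N₂)) ↔
      Nat.card (C ⊓ W₁ : Submodule R (Word R N₁ N₂)) = qq ^ k * Nat.card G) := by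
    intro C hC
    have h1 := card_sup_mul_card_inf G (C ⊓ Fs γ (2 * ν + 6))
    have h2 : G ⊔ (C ⊓ Fs γ (2 * ν + 6)) = C ⊓ W₁ := by
      rw [inf_comm, ← sup_inf_assoc_of_le _ hC, inf_comm]
    have h3 : G ⊓ (C ⊓ Fs γ (2 * ν + 6)) = G ⊓ Fs γ (2 * ν + 6) := by
      rw [← inf_assoc, inf_eq_left.2 hC]
    rw [h2, h3, cGI1] at h1
    have pG : 0 < Nat.card G := Nat.card_pos
    constructor
    · intro h
      rw [h] at h1
      refine Nat.eq_of_mul_eq_mul_right (Nat.mul_pos (pow_pos qq_pos M) p7) (h1.trans ?_)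
      ring
    · intro h
      rw [h] at h1
      refine Nat.eq_of_mul_eq_mul_left pG (h1.symm.trans ?_)
      ring
  have hsz : ∀ C : Submodule R (Word R N₁ N₂), G ≤ C →
      (Nat.card (C ⊓ Fs γ (2 * ν + 5) : Submodule R (Word R N₁ N₂)) =
        qq ^ (P + l + (M + k)) * Nat.card (Fs γ (2 * ν + 7) : Submodule R (Word R N₁ N₂)) ↔
      Nat.card (C ⊓ W : Submodule R (Word R N₁ N₂)) = qq ^ (k + l) * Nat.card G) := by
    intro C hC
    have h1 := card_sup_mul_card_inf G (C ⊓ Fs γ (2 * ν + 5))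
    have h2 : G ⊔ (C ⊓ Fs γ (2 * ν + 5)) = C ⊓ W := by
      rw [inf_comm, ← sup_inf_assoc_of_le _ hC, inf_comm]
    have h3 : G ⊓ (C ⊓ Fs γ (2 * ν + 5)) = G ⊓ Fs γ (2 * ν + 5) := by
      rw [← inf_assoc, inf_eq_left.2 hC]
    rw [h2, h3, cGI] at h1
    have pG : 0 < Nat.card G := Nat.card_pos
    constructor
    · intro h
      rw [h] at h1
      refine Nat.eq_of_mul_eq_mul_right (Nat.mul_pos (pow_pos qq_pos (P + M)) p7) (h1.trans ?_)
      ring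
    · intro h
      rw [h] at h1
      refine Nat.eq_of_mul_eq_mul_left pG (h1.symm.trans ?_)
      ring
  rw [ncard_eq_mul_of_fibers (T := {C : Submodule R (Word R N₁ N₂) | G ≤ C ∧ C ≤ B₀ ∧
      Nat.card (C ⊓ K₀ : Submodule R (Word R N₁ N₂)) = qq ^ k * Nat.card G ∧
      Nat.card C = qq ^ (k + l) * Nat.card G}) (fun C => C ⊓ W)
      (c := qq ^ ((M + P) * (u + w) + (k₀ + l₀) * (k₀ + l₀ - 1) / 2)), Nat.cast_mul,
    ncard_two_layers hmax hGK hKB (fun x hx => smul_mem_gm (hWH hx.1)) cK cB]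
  · push_cast
    ring
  · rintro C ⟨h1, h2, h3, h4, h5⟩
    have hGC : G ≤ C := by
      rw [hG, ← h1, gm, Submodule.map_sup]
      exact sup_le gm_le (by
        have := gm_Fs (N₁ := N₁) (N₂ := N₂) (γ := γ) (s := 2 * ν + 5)
        exact this.trans_le h2)
    -- Here `H = C ⊔ Fs γ (2 * ν + 5)`: the first summand is orthogonal to `C` by isotropy, the
    -- second to `W ≤ Fs γ 2` by the degrees of the filtration.
    have hCB : C ⊓ W ≤ B₀ := by
      refine le_inf inf_le_right fun x hx y hy => ?_
      obtain ⟨z, hz, y', hy', rfl⟩ := Submodule.mem_sup.1 (h1.ge hy)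
      rw [map_add]
      exact dvd_add (h3 x hx.1 z hz) (pow_dvd_bil (gm_le_Fs L (hWg hx.2)) hy' (by omega))
    refine ⟨le_inf hGC le_sup_left, hCB, ?_, ?_⟩
    · rw [hinfK hCB, inf_assoc, inf_eq_right.2 hW₁W, ← hsz1 C hGC]
      exact h5
    · rw [← hsz C hGC, h4, h5]
      ring
  · rintro I₀ ⟨hGI, hIB, h1, h2⟩
    have hIW : I₀ ≤ W := hIB.trans inf_le_left
    have cW' : Nat.card W = qq ^ (k₀ + l₀ + (u + w)) * Nat.card I₀ := by
      rw [cW, h2]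
      ring
    have cH' : Nat.card H = qq ^ (M + P) * Nat.card W := by
      rw [cG, cW, pow_add _ N₁ N₂, hp₁, hp₂]
      ring
    -- The roles are `K = W` and `Λ = γ L`. As `W / I₀` has dimension `k₀ + l₀ + (u + w)` and `H / γ
    -- L` has dimension `k₀ + l₀`, the difference in the exponent is `u + w`.
    have hfin := (ncard_isotropic_complements hmax hL.odd (n := ν + 3) (hch.pow_ne (by omega))
      (bil γ) (bil_symm γ) hIW hWg hgH (fun x hx => hGI (smul_mem_gm hx)) hiso
      (fun x hx y hy => (hIB hx).2 y hy) hmemH2 (fun x hx y hy => hL.iso_gm hx hy) cW' cH'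
      (t := k₀ + l₀) (by rw [hk, hl, pow_add, mul_assoc])).2
    rw [Nat.add_sub_cancel_left] at hfin
    rw [← hfin]
    congr 1
    ext C
    constructor
    · rintro ⟨⟨h3, h4, h5, -, -⟩, h6⟩
      refine ⟨h6, ?_, h5⟩
      have hGC : G ≤ C := hGI.trans (h6.symm.trans_le inf_le_left)
      rw [← h3, hW, ← sup_assoc, sup_eq_left.2 hGC]
    · rintro ⟨h3, h4, h5⟩
      have hGC : G ≤ C := hGI.trans (h3.symm.trans_le inf_le_left)
      have h6 := (hsz C hGC).2 (by rw [h3, h2])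
      have h7 := (hsz1 C hGC).2 (by
        rw [← h1, hinfK hIB, ← h3, inf_assoc, inf_eq_right.2 hW₁W])
      refine ⟨⟨?_, hF7.trans hGC, h5, ?_, h7⟩, h3⟩
      · rw [← h4, hW, ← sup_assoc, sup_eq_left.2 hGC]
      · rw [h6, h7, pow_add]
        ring

end IsBase

end Counting

/-! ### All lattices over `L`, first with given first layers and then in total. -/

section Counting

variable {R : Type*} [CommRing R] [IsLocalRing R] [Finite R] {γ : R}

local notation "qq" => Nat.card (ResidueField R)

variable {N₁ N₂ e ν M P : ℕ}

/-- `C` is the lattice of a self-orthogonal code over `R_{ν+4}` that lies over the code with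
lattice `L`, and its last two torsion codes have ranks `M + k` and `P + l`. -/
structure IsOver (γ : R) (ν M P k l : ℕ) (L C : Submodule R (Word R N₁ N₂)) : Prop where
  le : Fs γ (2 * ν + 7) ≤ C
  iso : ∀ x ∈ C, ∀ y ∈ C, γ ^ (ν + 4) ∣ bil γ x y
  lies : (C ⊓ Fs γ 2) ⊔ Fs γ (2 * ν + 5) = gm γ L
  cY : Nat.card (C ⊓ Fs γ (2 * ν + 5) : Submodule R (Word R N₁ N₂)) =
    qq ^ (P + l) * Nat.card (C ⊓ Fs γ (2 * ν + 6) : Submodule R (Word R N₁ N₂))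
  cX : Nat.card (C ⊓ Fs γ (2 * ν + 6) : Submodule R (Word R N₁ N₂)) =
    qq ^ (M + k) * Nat.card (Fs γ (2 * ν + 7) : Submodule R (Word R N₁ N₂))

namespace IsBase

variable {L : Submodule R (Word R N₁ N₂)}

/-- `γ C` lies in `C ⊓ Fs γ 2`, hence in `γ L`, and `γ` can be cancelled there. -/
theorem le_of_isOver {k l : ℕ} (hL : IsBase γ e ν M P L) {C : Submodule R (Word R N₁ N₂)}
    (hC : IsOver γ ν M P k l L C) : C ≤ L := by
  intro x hx
  refine hL.mem_of_smul ?_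
  rw [← hC.lies]
  refine le_sup_left (a := C ⊓ Fs γ 2) ⟨C.smul_mem _ hx, ?_⟩
  exact gm_le_Fs ⊤ (smul_mem_gm Submodule.mem_top)

/-- The map `C ↦ C ⊔ Fs γ (2 * ν + 5)` fibres these lattices over those of the upper stage, with
fibres counted by the lower stage. It leaves the two prescribed first layers unchanged, because `Fs
γ (2 * ν + 5)` lies in `L ⊓ Fs γ 2`. -/
theorem ncard_over_fixed (hL : IsBase γ e ν M P L) {Ta Tb : Submodule R (Word R N₁ N₂)}
    {k₀ l₀ l₁ κ k l u w : ℕ} (hN₁ : N₁ = M + k₀ + k + u) (hN₂ : N₂ = P + l₀ + l + w)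
    (ha : L ⊓ Fs γ 1 ≤ Ta) (haL : Ta ≤ L) (hb : L ⊓ Fs γ 2 ≤ Tb)
    (hbL : Tb ≤ L ⊓ Fs γ 1)
    (hca : Nat.card Ta = qq ^ k₀ * Nat.card (L ⊓ Fs γ 1 : Submodule R (Word R N₁ N₂)))
    (hcb : Nat.card Tb = qq ^ l₀ * Nat.card (L ⊓ Fs γ 2 : Submodule R (Word R N₁ N₂)))
    (hl : Nat.card (L ⊓ Fs γ 1 : Submodule R (Word R N₁ N₂)) =
      qq ^ (l₀ + l₁) * Nat.card (L ⊓ Fs γ 2 : Submodule R (Word R N₁ N₂)))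
    (hκ : Nat.card (L ⊓ Fs γ 2 : Submodule R (Word R N₁ N₂)) = qq ^ κ * Nat.card (gm γ L)) :
    ∃ c, c + (k₀ + l₀) * (k₀ + l₀ + 1) / 2 = (k₀ + l₀) * κ ∧
      (Set.ncard {C : Submodule R (Word R N₁ N₂) | IsOver γ ν M P k l L C ∧
        C ⊔ (L ⊓ Fs γ 1) = Ta ∧ (C ⊓ Fs γ 1) ⊔ (L ⊓ Fs γ 2) = Tb} : ℚ) =
        gauss qq (u + k) k * gauss qq (w + l) l * qq ^ (k₀ * l₁ + c + u * l +
          ((M + P) * (u + w) + (k₀ + l₀) * (k₀ + l₀ - 1) / 2)) := by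
  obtain ⟨c, hc, hup⟩ := hL.ncard_upper_part ha haL hb hbL hca hcb hl hκ
  refine ⟨c, hc, ?_⟩
  have hI : Fs γ (2 * ν + 5) ≤ gm γ L := hL.Fs_le_gm
  have h51 : (Fs γ (2 * ν + 5) : Submodule R (Word R N₁ N₂)) ≤ Fs γ 1 := Fs_antitone (by omega)
  have h52 : (Fs γ (2 * ν + 5) : Submodule R (Word R N₁ N₂)) ≤ Fs γ 2 := Fs_antitone (by omega)
  have hIL1 : Fs γ (2 * ν + 5) ≤ L ⊓ Fs γ 1 := le_inf (hI.trans gm_le) h51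
  have hIL2 : Fs γ (2 * ν + 5) ≤ L ⊓ Fs γ 2 := le_inf (hI.trans gm_le) h52
  have hfix : ∀ C : Submodule R (Word R N₁ N₂), (C ⊔ Fs γ (2 * ν + 5)) ⊔ (L ⊓ Fs γ 1) =
      C ⊔ (L ⊓ Fs γ 1) := fun C => by rw [sup_assoc, sup_eq_right.2 hIL1]
  have hmod : ∀ C : Submodule R (Word R N₁ N₂), ∀ s, Fs γ (2 * ν + 5) ≤ Fs γ s →
      (C ⊔ Fs γ (2 * ν + 5)) ⊓ Fs γ s = (C ⊓ Fs γ s) ⊔ Fs γ (2 * ν + 5) := fun C s h => by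
    rw [sup_comm, sup_inf_assoc_of_le _ h, sup_comm]
  have hfix' : ∀ C : Submodule R (Word R N₁ N₂),
      ((C ⊔ Fs γ (2 * ν + 5)) ⊓ Fs γ 1) ⊔ (L ⊓ Fs γ 2) = (C ⊓ Fs γ 1) ⊔ (L ⊓ Fs γ 2) := fun C => by
    rw [hmod C 1 h51, sup_assoc, sup_eq_right.2 hIL2]
  have hlow : ∀ H ∈ {H : Submodule R (Word R N₁ N₂) | H ≤ L ∧ H ⊓ Fs γ 2 = gm γ L ∧
        (∀ x ∈ H, ∀ y ∈ H, γ ^ (ν + 3) ∣ bil γ x y) ∧ H ⊔ (L ⊓ Fs γ 1) = Ta ∧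
        (H ⊓ Fs γ 1) ⊔ (L ⊓ Fs γ 2) = Tb},
      (Set.ncard {C | C ∈ {C : Submodule R (Word R N₁ N₂) | IsOver γ ν M P k l L C ∧
        C ⊔ (L ⊓ Fs γ 1) = Ta ∧ (C ⊓ Fs γ 1) ⊔ (L ⊓ Fs γ 2) = Tb} ∧
        C ⊔ Fs γ (2 * ν + 5) = H} : ℚ) = gauss qq (u + k) k * gauss qq (w + l) l * qq ^ (u * l) *
        qq ^ ((M + P) * (u + w) + (k₀ + l₀) * (k₀ + l₀ - 1) / 2) := by
    rintro H ⟨hHL, hH2, hHi, hHa, hHb⟩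
    have hk' : Nat.card H = qq ^ k₀ * Nat.card (H ⊓ Fs γ 1 : Submodule R (Word R N₁ N₂)) := by
      have h1 := card_sup_mul_card_inf H (L ⊓ Fs γ 1)
      rw [hHa, ← inf_assoc, inf_eq_left.2 hHL, hca] at h1
      refine Nat.eq_of_mul_eq_mul_right (m := Nat.card (L ⊓ Fs γ 1 : Submodule R (Word R N₁ N₂)))
        Nat.card_pos (h1.symm.trans ?_)
      ring
    have hl' : Nat.card (H ⊓ Fs γ 1 : Submodule R (Word R N₁ N₂)) =
        qq ^ l₀ * Nat.card (gm γ L) := by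
      have h1 := card_sup_mul_card_inf (H ⊓ Fs γ 1) (L ⊓ Fs γ 2)
      have h2 : (H ⊓ Fs γ 1) ⊓ (L ⊓ Fs γ 2) = gm γ L := by
        rw [← hH2]
        refine le_antisymm (le_inf (inf_le_left.trans inf_le_left)
          (inf_le_right.trans inf_le_right)) ?_
        exact le_inf (inf_le_inf_left _ (Fs_antitone (by omega))) (inf_le_inf_right _ hHL)
      rw [hHb, h2, hcb] at h1
      refine Nat.eq_of_mul_eq_mul_right (m := Nat.card (L ⊓ Fs γ 2 : Submodule R (Word R N₁ N₂)))
        Nat.card_pos (h1.symm.trans ?_)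
      ring
    rw [← hL.ncard_lower_part hN₁ hN₂ hHL hH2 hHi hk' hl']
    congr 2
    ext C
    constructor
    · rintro ⟨⟨h1, -, -⟩, h4⟩
      exact ⟨h4, h1.le, h1.iso, h1.cY, h1.cX⟩
    · rintro ⟨rfl, h2, h3, h4, h5⟩
      refine ⟨⟨⟨h2, h3, ?_, h4, h5⟩, ?_, ?_⟩, rfl⟩
      · rw [← hH2, hmod C 2 h52]
      · rw [← hHa, hfix]
      · rw [← hHb, hfix']
  have hn : {H : Submodule R (Word R N₁ N₂) | H ≤ L ∧ H ⊓ Fs γ 2 = gm γ L ∧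
        (∀ x ∈ H, ∀ y ∈ H, γ ^ (ν + 3) ∣ bil γ x y) ∧ H ⊔ (L ⊓ Fs γ 1) = Ta ∧
        (H ⊓ Fs γ 1) ⊔ (L ⊓ Fs γ 2) = Tb}.Nonempty := by
    refine Set.nonempty_of_ncard_ne_zero ?_
    rw [hup]
    exact (pow_pos qq_pos _).ne'
  -- The natural number common to all fibres is taken to be the size of the one over `H₀`.
  obtain ⟨H₀, hH₀⟩ := hn
  rw [ncard_eq_mul_of_fibers (fun C => C ⊔ Fs γ (2 * ν + 5))
    (T := {H : Submodule R (Word R N₁ N₂) | H ≤ L ∧ H ⊓ Fs γ 2 = gm γ L ∧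
        (∀ x ∈ H, ∀ y ∈ H, γ ^ (ν + 3) ∣ bil γ x y) ∧ H ⊔ (L ⊓ Fs γ 1) = Ta ∧
        (H ⊓ Fs γ 1) ⊔ (L ⊓ Fs γ 2) = Tb}) ?_
    (fun H hH => Nat.cast_injective (R := ℚ) ((hlow H hH).trans (hlow H₀ hH₀).symm)),
    Nat.cast_mul, hlow H₀ hH₀, hup]
  · push_cast
    ring
  · rintro C ⟨h1, h2, h3⟩
    refine ⟨sup_le (hL.le_of_isOver h1) (hI.trans gm_le), ?_, ?_, ?_, ?_⟩
    · rw [hmod C 2 h52, h1.lies]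
    · intro x hx y hy
      obtain ⟨x, hxC, x', hx', rfl⟩ := Submodule.mem_sup.1 hx
      obtain ⟨y, hyC, y', hy', rfl⟩ := Submodule.mem_sup.1 hy
      have h0 : ∀ z : Word R N₁ N₂, z ∈ Fs γ 0 := fun z => by rw [Fs_zero]; trivial
      rw [map_add, map_add, LinearMap.add_apply, LinearMap.add_apply]
      refine dvd_add (dvd_add ((pow_dvd_pow γ (by omega)).trans (h1.iso x hxC y hyC))
        (pow_dvd_bil hx' (h0 y) (by omega)))
        (dvd_add (pow_dvd_bil (h0 x) hy' (by omega)) (pow_dvd_bil hx' hy' (by omega)))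
    · rw [hfix, h2]
    · rw [hfix', h3]

/-- The number of lattices over `L` with prescribed ranks of the torsion codes. -/
theorem ncard_over (hL : IsBase γ e ν M P L) {k₀ k₁ l₀ l₁ k l u w : ℕ}
    (hN₁ : N₁ = M + k₀ + k + u) (hN₂ : N₂ = P + l₀ + l + w)
    (hk : Nat.card L = qq ^ (k₀ + k₁) * Nat.card (L ⊓ Fs γ 1 : Submodule R (Word R N₁ N₂)))
    (hl : Nat.card (L ⊓ Fs γ 1 : Submodule R (Word R N₁ N₂)) =
      qq ^ (l₀ + l₁) * Nat.card (L ⊓ Fs γ 2 : Submodule R (Word R N₁ N₂))) :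
    (∀ Ta Tb : Submodule R (Word R N₁ N₂), L ⊓ Fs γ 1 ≤ Ta → Ta ≤ L → L ⊓ Fs γ 2 ≤ Tb →
      Tb ≤ L ⊓ Fs γ 1 →
      Nat.card Ta = qq ^ k₀ * Nat.card (L ⊓ Fs γ 1 : Submodule R (Word R N₁ N₂)) →
      Nat.card Tb = qq ^ l₀ * Nat.card (L ⊓ Fs γ 2 : Submodule R (Word R N₁ N₂)) →
      (Set.ncard {C : Submodule R (Word R N₁ N₂) | IsOver γ ν M P k l L C ∧
        C ⊔ (L ⊓ Fs γ 1) = Ta ∧ (C ⊓ Fs γ 1) ⊔ (L ⊓ Fs γ 2) = Tb} : ℚ) =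
        gauss qq (u + k) k * gauss qq (w + l) l * (qq : ℚ) ^ ((k₀ * l₁ +
          (k₀ + l₀) * (N₁ + N₂ - (k₀ + k₁ + l₀ + l₁) - 1) + u * l + (M + P) * (u + w) : ℤ))) ∧
    (Set.ncard {C : Submodule R (Word R N₁ N₂) | IsOver γ ν M P k l L C ∧
      Nat.card C = qq ^ k₀ * Nat.card (C ⊓ Fs γ 1 : Submodule R (Word R N₁ N₂)) ∧
      Nat.card (C ⊓ Fs γ 1 : Submodule R (Word R N₁ N₂)) =
        qq ^ l₀ * Nat.card (C ⊓ Fs γ 2 : Submodule R (Word R N₁ N₂))} : ℚ) =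
      gauss qq (k₀ + k₁) k₀ * (gauss qq (l₀ + l₁) l₀ *
        (gauss qq (u + k) k * gauss qq (w + l) l * (qq : ℚ) ^ ((k₀ * l₁ +
          (k₀ + l₀) * (N₁ + N₂ - (k₀ + k₁ + l₀ + l₁) - 1) + u * l + (M + P) * (u + w) : ℤ)))) := by
  have hmax := hL.chain.max
  have h21 : (L ⊓ Fs γ 2 : Submodule R (Word R N₁ N₂)) ≤ L ⊓ Fs γ 1 :=
    inf_le_inf_left _ (Fs_antitone (by omega))
  have hγ2 : ∀ x ∈ L, γ • x ∈ L ⊓ Fs γ 2 := fun x hx =>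
    ⟨L.smul_mem _ hx, gm_le_Fs L (smul_mem_gm hx)⟩
  obtain ⟨κ, hκ⟩ := exists_card_eq_pow_mul hmax (le_inf gm_le (gm_le_Fs L))
    (fun x (hx : x ∈ L ⊓ Fs γ 2) => smul_mem_gm hx.1)
  have hκN : k₀ + k₁ + (l₀ + l₁) + κ = N₁ + N₂ := by
    have h1 := card_eq_card_gm hL.chain (by have := hL.he; omega)
      ((hL.annihilator_le (by omega)).trans hL.le)
    rw [hk, hl, hκ] at h1
    refine pow_mul_card_inj (A := gm γ L) ?_
    rw [← h1]
    ring
  have hfix : ∀ Ta Tb : Submodule R (Word R N₁ N₂), L ⊓ Fs γ 1 ≤ Ta → Ta ≤ L → L ⊓ Fs γ 2 ≤ Tb →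
      Tb ≤ L ⊓ Fs γ 1 →
      Nat.card Ta = qq ^ k₀ * Nat.card (L ⊓ Fs γ 1 : Submodule R (Word R N₁ N₂)) →
      Nat.card Tb = qq ^ l₀ * Nat.card (L ⊓ Fs γ 2 : Submodule R (Word R N₁ N₂)) →
      (Set.ncard {C : Submodule R (Word R N₁ N₂) | IsOver γ ν M P k l L C ∧
        C ⊔ (L ⊓ Fs γ 1) = Ta ∧ (C ⊓ Fs γ 1) ⊔ (L ⊓ Fs γ 2) = Tb} : ℚ) =
        gauss qq (u + k) k * gauss qq (w + l) l * (qq : ℚ) ^ ((k₀ * l₁ +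
          (k₀ + l₀) * (N₁ + N₂ - (k₀ + k₁ + l₀ + l₁) - 1) + u * l + (M + P) * (u + w) : ℤ)) := by
    intro Ta Tb ha haL hb hbL hca hcb
    obtain ⟨c, hc, hres⟩ := hL.ncard_over_fixed hN₁ hN₂ ha haL hb hbL hca hcb hl hκ
    rw [hres, ← zpow_natCast]
    congr 2
    -- With `t = k₀ + l₀`, the upper stage subtracts `t (t + 1) / 2` and the lower stage adds `t (t
    -- - 1) / 2`; what is left is the `- 1` beside `N₁ + N₂`.
    have h1 : (k₀ + l₀) * (k₀ + l₀ + 1) / 2 = (k₀ + l₀) * (k₀ + l₀ - 1) / 2 + (k₀ + l₀) := by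
      have := Nat.triangle_succ (k₀ + l₀)
      rwa [Nat.add_sub_cancel, mul_comm] at this
    have hκN' : (κ : ℤ) = N₁ + N₂ - (k₀ + k₁ + l₀ + l₁) := by
      rw [← Nat.cast_add, ← hκN]
      push_cast
      ring
    have hc' : ((c + (k₀ + l₀) * (k₀ + l₀ + 1) / 2 : ℕ) : ℤ) = ((k₀ + l₀) * κ : ℕ) := by rw [hc]
    rw [h1, Nat.cast_add, Nat.cast_add, Nat.cast_mul, hκN'] at hc'
    rw [Nat.cast_add, Nat.cast_add _ ((k₀ + l₀) * (k₀ + l₀ - 1) / 2)]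
    push_cast at hc' ⊢
    linear_combination hc'
  refine ⟨hfix, ?_⟩
  have hcard : ∀ A B D D' : Submodule R (Word R N₁ N₂), ∀ n, A ⊔ B = D → A ⊓ B = D' →
      (Nat.card D = qq ^ n * Nat.card B ↔ Nat.card A = qq ^ n * Nat.card D') := by
    rintro A B _ _ n rfl rfl
    have h1 := card_sup_mul_card_inf A B
    constructor
    · intro h
      rw [h] at h1
      refine Nat.eq_of_mul_eq_mul_right (m := Nat.card B) Nat.card_pos (h1.symm.trans ?_)
      ring
    · intro h
      rw [h] at h1
      refine Nat.eq_of_mul_eq_mul_right (m := Nat.card (A ⊓ B : Submodule R (Word R N₁ N₂)))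
        Nat.card_pos (h1.trans ?_)
      ring
  have hinf1 : ∀ C, IsOver γ ν M P k l L C → C ⊓ (L ⊓ Fs γ 1) = C ⊓ Fs γ 1 := fun C hC => by
    rw [← inf_assoc, inf_eq_left.2 (hL.le_of_isOver hC)]
  have hinf2 : ∀ C, IsOver γ ν M P k l L C → (C ⊓ Fs γ 1) ⊓ (L ⊓ Fs γ 2) = C ⊓ Fs γ 2 :=
    fun C hC => le_antisymm (le_inf (inf_le_left.trans inf_le_left)
      (inf_le_right.trans inf_le_right)) (le_inf (inf_le_inf_left _ (Fs_antitone (by omega)))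
        (inf_le_inf_right _ (hL.le_of_isOver hC)))
  -- The first left layer of `C` is a subspace of dimension `k₀` in that of `L`, of dimension `k₀ +
  -- k₁`; the right layers are treated likewise afterwards.
  rw [ncard_eq_mul_of_fibers_rat (T := {Ta | L ⊓ Fs γ 1 ≤ Ta ∧ Ta ≤ L ∧
      Nat.card Ta = qq ^ k₀ * Nat.card (L ⊓ Fs γ 1 : Submodule R (Word R N₁ N₂))})
    (fun C => C ⊔ (L ⊓ Fs γ 1)) ?_ ?_,
    ncard_submodules hmax inf_le_left (fun x hx => h21 (hγ2 x hx)) (Nat.le_add_right k₀ k₁) hk]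
  · rintro C ⟨hC, h1, -⟩
    exact ⟨le_sup_right, sup_le (hL.le_of_isOver hC) inf_le_left,
      (hcard _ _ _ _ k₀ rfl (hinf1 C hC)).2 h1⟩
  rintro Ta ⟨ha, haL, hca⟩
  rw [ncard_eq_mul_of_fibers_rat (T := {Tb | L ⊓ Fs γ 2 ≤ Tb ∧ Tb ≤ L ⊓ Fs γ 1 ∧
      Nat.card Tb = qq ^ l₀ * Nat.card (L ⊓ Fs γ 2 : Submodule R (Word R N₁ N₂))})
    (fun C => (C ⊓ Fs γ 1) ⊔ (L ⊓ Fs γ 2)) ?_ ?_,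
    ncard_submodules hmax h21 (fun x hx => hγ2 x hx.1) (Nat.le_add_right l₀ l₁) hl]
  · rintro C ⟨⟨hC, -, h2⟩, -⟩
    exact ⟨le_sup_right, sup_le (inf_le_inf_right _ (hL.le_of_isOver hC)) h21,
      (hcard _ _ _ _ l₀ rfl (hinf2 C hC)).2 h2⟩
  rintro Tb ⟨hb, hbL, hcb⟩
  rw [← hfix Ta Tb ha haL hb hbL hca hcb]
  congr 2
  ext C
  constructor
  · rintro ⟨⟨⟨hC, -, -⟩, h3⟩, h4⟩
    exact ⟨hC, h3, h4⟩
  · rintro ⟨hC, h3, h4⟩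
    exact ⟨⟨⟨hC, (hcard _ _ _ _ k₀ h3 (hinf1 C hC)).1 hca,
      (hcard _ _ _ _ l₀ h4 (hinf2 C hC)).1 hcb⟩, h3⟩, h4⟩

end IsBase

end Counting

/-! ### Codes as lattices of words over `R`. -/

section Lattices

variable {R : Type*} [CommRing R] {γ : R} {μ N₁ N₂ : ℕ}

/-- Reduction of words over `R` to the ambient module. -/
def redM (γ : R) (μ : ℕ) : Word R N₁ N₂ →ₗ[R] Amb γ μ N₁ N₂ where
  toFun x := (red γ μ x.1, red γ (μ - 1) x.2)
  map_add' _ _ := rfl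
  map_smul' _ _ := rfl

theorem red_eq_zero {n N : ℕ} {c : Fin N → R} : red γ n c = 0 ↔ ∀ t, γ ^ n ∣ c t := by
  rw [funext_iff]
  refine forall_congr' fun t => ?_
  exact Ideal.Quotient.eq_zero_iff_mem.trans Ideal.mem_span_singleton

theorem redM_eq_zero (hμ : 1 ≤ μ) {x : Word R N₁ N₂} :
    redM γ μ x = 0 ↔ x ∈ Fs γ (2 * μ - 1) := by
  rw [mem_Fs, show (2 * μ - 1 + 1) / 2 = μ by omega, show (2 * μ - 1) / 2 = μ - 1 by omega,
    ← red_eq_zero, ← red_eq_zero]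
  exact Prod.ext_iff

theorem redM_surjective : Function.Surjective (redM γ μ : Word R N₁ N₂ →ₗ[R] _) := by
  rintro ⟨c, d⟩
  choose c' hc using fun t => Ideal.Quotient.mk_surjective (c t)
  choose d' hd using fun t => Ideal.Quotient.mk_surjective (d t)
  exact ⟨(c', d'), Prod.ext (funext hc) (funext hd)⟩

theorem ker_redM (hμ : 1 ≤ μ) :
    LinearMap.ker (redM γ μ : Word R N₁ N₂ →ₗ[R] _) = Fs γ (2 * μ - 1) := by
  ext x
  exact redM_eq_zero hμ

/-- The words over `R` whose reductions lie in the code. -/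
def lat (C : Code γ μ N₁ N₂) : Submodule R (Word R N₁ N₂) := C.comap (redM γ μ)

theorem Fs_le_lat (hμ : 1 ≤ μ) (C : Code γ μ N₁ N₂) : Fs γ (2 * μ - 1) ≤ lat C := by
  rw [← ker_redM hμ]
  exact LinearMap.ker_le_comap _

theorem lat_le_lat {C C' : Code γ μ N₁ N₂} : lat C ≤ lat C' ↔ C ≤ C' :=
  Submodule.comap_le_comap_iff_of_surjective redM_surjective

theorem lat_injective : Function.Injective (lat : Code γ μ N₁ N₂ → _) :=
  Submodule.comap_injective_of_surjective redM_surjective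

theorem lat_map (hμ : 1 ≤ μ) {X : Submodule R (Word R N₁ N₂)} (hX : Fs γ (2 * μ - 1) ≤ X) :
    lat (X.map (redM γ μ)) = X := by
  rw [lat, Submodule.comap_map_eq, ker_redM hμ, sup_eq_left.2 hX]

theorem form_redM (x y : Word R N₁ N₂) :
    form (redM γ μ x) (redM γ μ y) = Ideal.Quotient.mk _ (bil γ x y) := by
  have h1 : ∑ j, (redM γ μ x).2 j * (redM γ μ y).2 j =
      Ideal.Quotient.mk _ (∑ j, x.2 j * y.2 j) := by
    rw [map_sum]
    exact Finset.sum_congr rfl fun j _ => (map_mul _ _ _).symm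
  have h2 : ∑ j, (redM γ μ x).1 j * (redM γ μ y).1 j =
      Ideal.Quotient.mk _ (∑ j, x.1 j * y.1 j) := by
    rw [map_sum]
    exact Finset.sum_congr rfl fun j _ => (map_mul _ _ _).symm
  rw [form, h1, h2, bil_apply, map_add]
  rfl

theorem selfOrthogonal_iff {C : Code γ μ N₁ N₂} :
    SelfOrthogonal C ↔ ∀ x ∈ lat C, ∀ y ∈ lat C, γ ^ μ ∣ bil γ x y := by
  have key : ∀ x y : Word R N₁ N₂, form (redM γ μ x) (redM γ μ y) = 0 ↔ γ ^ μ ∣ bil γ x y :=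
    fun x y => by rw [form_redM, Ideal.Quotient.eq_zero_iff_mem, Ideal.mem_span_singleton]
  constructor
  · intro h x hx y hy
    exact (key x y).1 (h hx _ hy)
  · intro h m hm m' hm'
    obtain ⟨x, rfl⟩ := redM_surjective m
    obtain ⟨y, rfl⟩ := redM_surjective m'
    exact (key x y).2 (h x hm y hm')

end Lattices

/-! ### Block echelon forms and the lattices spanned by their rows. -/

section Echelon

variable {R : Type*} [CommRing R] {γ : R} {n N₁ N₂ : ℕ} {k ℓ : ℕ → ℕ}

/-- The columns of a matrix in block echelon form determine the coefficients of a combination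
of its rows up to divisibility. -/
theorem dvd_of_echelon {N : ℕ} {p : (Σ i : Fin n, Fin (k i)) ↪ Fin N}
    {A : Matrix (Σ i : Fin n, Fin (k i)) (Fin N) R}
    (hA : ∀ x y, (y.1 : ℕ) ≤ x.1 → A x (p y) = (1 : Matrix _ _ R) x y)
    {u : (Σ i : Fin n, Fin (k i)) → R} {g : R} (h : ∀ y, g ∣ ∑ x, u x * A x (p y)) :
    ∀ x, g ∣ u x := by
  have key : ∀ s : ℕ, ∀ y, (y.1 : ℕ) = s → g ∣ u y := by
    intro s
    -- Besides its own pivot, a pivot column meets only rows of strictly earlier blocks.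
    induction s using Nat.strong_induction_on with
    | _ s ih =>
      intro y hy
      have h1 := h y
      rw [← Finset.add_sum_erase _ _ (Finset.mem_univ y), hA y y le_rfl, Matrix.one_apply_eq,
        mul_one] at h1
      refine (dvd_add_left (Finset.dvd_sum fun x hx => ?_)).1 h1
      rcases lt_or_ge (x.1 : ℕ) y.1 with hxy | hxy
      · exact (ih _ (hy ▸ hxy) x rfl).mul_right _
      · rw [hA x y hxy, Matrix.one_apply_ne (Finset.ne_of_mem_erase hx), mul_zero]
        exact dvd_zero _
  exact fun x => key _ x rfl

namespace BlockForm

/-- The combination of the rows `[A | B]` and `[γ C | D]` with given coefficients. -/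
def comb (G : BlockForm R n N₁ N₂ k ℓ) (γ : R) :
    ((Σ i : Fin n, Fin (k i)) → R) × ((Σ j : Fin (n - 1), Fin (ℓ j)) → R) →ₗ[R]
      Word R N₁ N₂ where
  toFun a := (fun c => ∑ x, a.1 x * G.A x c + γ * ∑ z, a.2 z * G.C z c,
    fun d => ∑ x, a.1 x * G.B x d + ∑ z, a.2 z * G.D z d)
  map_add' a b := by
    ext t
    · simp only [Prod.fst_add, Prod.snd_add, Pi.add_apply, add_mul, sum_add_distrib]; ring
    · simp only [Prod.fst_add, Prod.snd_add, Pi.add_apply, add_mul, sum_add_distrib]; ring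
  map_smul' c a := by
    ext t
    · simp only [Prod.smul_fst, Prod.smul_snd, Pi.smul_apply, smul_eq_mul, mul_assoc, ← mul_sum,
        RingHom.id_apply]; ring
    · simp only [Prod.smul_fst, Prod.smul_snd, Pi.smul_apply, smul_eq_mul, mul_assoc, ← mul_sum,
        RingHom.id_apply]; ring

theorem comb_fst (G : BlockForm R n N₁ N₂ k ℓ) (a) (t : Fin N₁) :
    (G.comb γ a).1 t = ∑ x, a.1 x * G.A x t + γ * ∑ z, a.2 z * G.C z t := rfl

theorem comb_snd (G : BlockForm R n N₁ N₂ k ℓ) (a) (t : Fin N₂) :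
    (G.comb γ a).2 t = ∑ x, a.1 x * G.B x t + ∑ z, a.2 z * G.D z t := rfl

/-- The two families of coefficients improve in turn. On the left columns the rows `γ C` are already
one power deeper, so the first family gains a factor `γ`; on the right columns this gain makes the
rows `B` harmless, and the second family follows. -/
theorem dvd_of_comb_mem (G : BlockForm R n N₁ N₂ k ℓ) {a} {s : ℕ} (h : G.comb γ a ∈ Fs γ s) :
    (∀ x, γ ^ ((s + 1) / 2) ∣ a.1 x) ∧ ∀ z, γ ^ (s / 2) ∣ a.2 z := by
  induction s with
  | zero => simp
  | succ s ih =>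
    obtain ⟨h1, h2⟩ := ih (Fs_antitone (Nat.le_succ s) h)
    obtain ⟨i, rfl | rfl⟩ := Nat.even_or_odd' s
    · rw [show (2 * i + 1) / 2 = i by omega] at h1
      rw [show 2 * i / 2 = i by omega] at h2
      rw [mem_Fs_odd] at h
      rw [show (2 * i + 1 + 1) / 2 = i + 1 by omega, show (2 * i + 1) / 2 = i by omega]
      refine ⟨dvd_of_echelon G.hA fun y => ?_, h2⟩
      have h3 := h.1 (G.p y)
      rw [comb_fst] at h3
      refine (dvd_add_left ?_).1 h3
      rw [pow_succ']
      exact mul_dvd_mul_left _ (Finset.dvd_sum fun z _ => (h2 z).mul_right _)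
    · rw [show (2 * i + 1 + 1) / 2 = i + 1 by omega] at h1
      rw [show (2 * i + 1) / 2 = i by omega] at h2
      rw [show 2 * i + 1 + 1 = 2 * (i + 1) by ring, mem_Fs_even] at h
      rw [show (2 * i + 1 + 1 + 1) / 2 = i + 1 by omega, show (2 * i + 1 + 1) / 2 = i + 1 by omega]
      refine ⟨h1, dvd_of_echelon G.hD fun y => ?_⟩
      have h3 := h.2 (G.q y)
      rw [comb_snd] at h3
      exact (dvd_add_right (Finset.dvd_sum fun z _ => (h1 z).mul_right _)).1 h3

/-- The span of the weighted rows, as words over `R`. -/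
def rowSpan (G : BlockForm R n N₁ N₂ k ℓ) (γ : R) (w : ℕ → ℕ) : Submodule R (Word R N₁ N₂) :=
  Submodule.map (G.comb γ)
    { carrier := {a : ((Σ i : Fin n, Fin (k i)) → R) × ((Σ j : Fin (n - 1), Fin (ℓ j)) → R) |
        (∀ x, γ ^ w x.1 ∣ a.1 x) ∧ ∀ z : Σ j : Fin (n - 1), Fin (ℓ j), γ ^ w z.1 ∣ a.2 z}
      zero_mem' := ⟨fun _ => dvd_zero _, fun _ => dvd_zero _⟩
      add_mem' := fun h h' => ⟨fun x => dvd_add (h.1 x) (h'.1 x), fun x => dvd_add (h.2 x) (h'.2 x)⟩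
      smul_mem' := fun c _ h => ⟨fun x => (h.1 x).mul_left c, fun x => (h.2 x).mul_left c⟩ }

theorem redM_comb (G : BlockForm R n N₁ N₂ k ℓ) (w : ℕ → ℕ) (μ : ℕ)
    (a : (Σ i : Fin n, Fin (k i)) → R) (b : (Σ j : Fin (n - 1), Fin (ℓ j)) → R) :
    redM γ μ (G.comb γ (fun x => γ ^ w x.1 * a x, fun z => γ ^ w z.1 * b z)) =
      ∑ x, a x • G.rowR γ w μ x + ∑ z, b z • G.rowS γ w μ z := by
  have h1 : G.comb γ (fun x => γ ^ w x.1 * a x, fun z => γ ^ w z.1 * b z) =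
      ∑ x, a x • ((fun c => γ ^ w x.1 * G.A x c, fun d => γ ^ w x.1 * G.B x d) : Word R N₁ N₂) +
      ∑ z, b z • ((fun c => γ ^ (w z.1 + 1) * G.C z c, fun d => γ ^ w z.1 * G.D z d) :
        Word R N₁ N₂) := by
    refine Prod.ext (funext fun t => ?_) (funext fun t => ?_)
    · rw [comb_fst, Prod.fst_add, Pi.add_apply, Prod.fst_sum, Prod.fst_sum, Finset.sum_apply,
        Finset.sum_apply, mul_sum]
      congr 1
      · exact Finset.sum_congr rfl fun x _ => by
          simp only [Prod.smul_fst, Pi.smul_apply, smul_eq_mul]; ring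
      · exact Finset.sum_congr rfl fun x _ => by
          simp only [Prod.smul_fst, Pi.smul_apply, smul_eq_mul]; ring
    · rw [comb_snd, Prod.snd_add, Pi.add_apply, Prod.snd_sum, Prod.snd_sum, Finset.sum_apply,
        Finset.sum_apply]
      congr 1
      · exact Finset.sum_congr rfl fun x _ => by
          simp only [Prod.smul_snd, Pi.smul_apply, smul_eq_mul]; ring
      · exact Finset.sum_congr rfl fun x _ => by
          simp only [Prod.smul_snd, Pi.smul_apply, smul_eq_mul]; ring
  rw [h1, map_add, map_sum, map_sum]
  simp only [map_smul]
  rfl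

theorem map_rowSpan (G : BlockForm R n N₁ N₂ k ℓ) (w : ℕ → ℕ) (μ : ℕ) :
    (G.rowSpan γ w).map (redM γ μ) = G.code γ w μ := by
  classical
  apply le_antisymm
  · rintro _ ⟨_, ⟨⟨a, b⟩, ⟨ha, hb⟩, rfl⟩, rfl⟩
    choose a' ha' using ha
    choose b' hb' using hb
    have : (a, b) = (fun x => γ ^ w x.1 * a' x, fun z => γ ^ w z.1 * b' z) :=
      Prod.ext (funext ha') (funext hb')
    rw [this, redM_comb]
    exact add_mem (sum_mem fun x _ => Submodule.smul_mem _ _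
      (Submodule.subset_span (Or.inl ⟨x, rfl⟩))) (sum_mem fun x _ => Submodule.smul_mem _ _
      (Submodule.subset_span (Or.inr ⟨x, rfl⟩)))
  · rw [code, Submodule.span_le]
    rintro _ (⟨x, rfl⟩ | ⟨z, rfl⟩)
    · refine ⟨_, ⟨(fun y => γ ^ w y.1 * (Pi.single x 1 : _ → R) y, fun z => γ ^ w z.1 * 0),
        ⟨fun _ => dvd_mul_right _ _, fun _ => dvd_mul_right _ _⟩, rfl⟩, ?_⟩
      rw [redM_comb G w μ (Pi.single x 1) (fun _ => 0)]
      simp [Pi.single_apply]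
    · refine ⟨_, ⟨(fun y => γ ^ w y.1 * 0, fun y => γ ^ w y.1 * (Pi.single z 1 : _ → R) y),
        ⟨fun _ => dvd_mul_right _ _, fun _ => dvd_mul_right _ _⟩, rfl⟩, ?_⟩
      rw [redM_comb G w μ (fun _ => 0) (Pi.single z 1)]
      simp [Pi.single_apply]

theorem lat_code (G : BlockForm R n N₁ N₂ k ℓ) (w : ℕ → ℕ) {μ : ℕ} (hμ : 1 ≤ μ) :
    lat (G.code γ w μ) = G.rowSpan γ w ⊔ Fs γ (2 * μ - 1) := by
  rw [lat, ← map_rowSpan, Submodule.comap_map_eq, ker_redM hμ]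

end BlockForm

end Echelon

/-! ### Torsion codes read off from a standard form and from the lattice. -/

section Torsion

variable {R : Type*} [CommRing R] [IsLocalRing R] {γ : R} {e n N : ℕ} {k : ℕ → ℕ}

/-- The combinations of the rows of the first `i + 1` blocks, modulo `γ`. -/
def spanRows (γ : R) (A : Matrix (Σ i : Fin n, Fin (k i)) (Fin N) R) (i : ℕ) :
    Set (Fin N → ResidueField R) :=
  {v | ∃ a : (Σ i : Fin n, Fin (k i)) → R, (∀ x, γ ^ (x.1 : ℕ) ∣ γ ^ i * a x) ∧
    ∀ t, residue R (∑ x, a x * A x t) = v t}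

/-- For a block of index larger than `i` the divisibility condition forces `γ ∣ a x`, so its rows
vanish modulo `γ`. -/
theorem spanRows_eq_span (h : IsChain γ e) (hn : n ≤ e)
    (A : Matrix (Σ i : Fin n, Fin (k i)) (Fin N) R) (i : ℕ) :
    spanRows γ A i = (Submodule.span (ResidueField R)
      (Set.range fun (x : {x : Σ i : Fin n, Fin (k i) // (x.1 : ℕ) ≤ i}) t =>
        residue R (A x.1 t)) : Set (Fin N → ResidueField R)) := by
  ext v
  constructor
  · rintro ⟨a, ha, hv⟩
    have hv' : v = ∑ x, residue R (a x) • (fun t => residue R (A x t)) := by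
      ext t
      rw [← hv t, map_sum, Finset.sum_apply]
      simp only [map_mul, Pi.smul_apply, smul_eq_mul]
    rw [hv']
    refine Submodule.sum_mem _ fun x _ => ?_
    by_cases hx : (x.1 : ℕ) ≤ i
    · exact Submodule.smul_mem _ _ (Submodule.subset_span ⟨⟨x, hx⟩, rfl⟩)
    · have h1 : γ ∣ a x := by
        have h2 : γ ^ (i + 1) ∣ γ ^ i * a x := (pow_dvd_pow γ (by omega)).trans (ha x)
        simpa using h.dvd_of_pow_mul h2 (by have := x.1.2; omega)
      rw [(h.residue_eq_zero _).2 h1, zero_smul]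
      exact zero_mem _
  · intro hv
    obtain ⟨c, rfl⟩ := (Submodule.mem_span_range_iff_exists_fun _).1 hv
    choose c' hc' using fun x => residue_surjective (c x)
    classical
    refine ⟨fun x => if hx : (x.1 : ℕ) ≤ i then c' ⟨x, hx⟩ else 0, fun x => ?_, fun t => ?_⟩
    · by_cases hx : (x.1 : ℕ) ≤ i
      · exact (pow_dvd_pow γ hx).mul_right _
      · simp [hx]
    · rw [map_sum, Finset.sum_apply,
        ← Fintype.sum_subtype_add_sum_subtype (fun x : Σ i : Fin n, Fin (k i) => (x.1 : ℕ) ≤ i)]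
      rw [Finset.sum_eq_zero (s := (univ : Finset {x : Σ i : Fin n, Fin (k i) // ¬(x.1 : ℕ) ≤ i})),
        add_zero]
      · refine Finset.sum_congr rfl fun x _ => ?_
        simp only [dif_pos x.2, map_mul, hc', Pi.smul_apply, smul_eq_mul]
      · intro x _
        simp only [dif_neg x.2, zero_mul, map_zero]

theorem card_blocks_le {i : ℕ} (hi : i < n) :
    Fintype.card {x : Σ i : Fin n, Fin (k i) // (x.1 : ℕ) ≤ i} = m k i := by
  have e : {x : Σ i : Fin n, Fin (k i) // (x.1 : ℕ) ≤ i} ≃ Σ j : Fin (i + 1), Fin (k j) :=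
    ⟨fun x => ⟨⟨x.1.1, Nat.lt_succ_of_le x.2⟩, x.1.2⟩,
      fun x => ⟨⟨⟨x.1, by omega⟩, x.2⟩, Nat.le_of_lt_succ x.1.2⟩, fun _ => rfl, fun _ => rfl⟩
  rw [Fintype.card_congr e, Fintype.card_sigma, m, Finset.sum_range]
  simp

theorem finrank_span_rows (h : IsChain γ e) {p : (Σ i : Fin n, Fin (k i)) ↪ Fin N}
    {A : Matrix (Σ i : Fin n, Fin (k i)) (Fin N) R}
    (hA : ∀ x y, (y.1 : ℕ) ≤ x.1 → A x (p y) = (1 : Matrix _ _ R) x y) {i : ℕ} (hi : i < n) :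
    finrank (ResidueField R) (Submodule.span (ResidueField R)
      (Set.range fun (x : {x : Σ i : Fin n, Fin (k i) // (x.1 : ℕ) ≤ i}) t =>
        residue R (A x.1 t))) = m k i := by
  rw [finrank_span_eq_card, card_blocks_le hi]
  rw [Fintype.linearIndependent_iff]
  intro g hg
  choose g' hg' using fun x => residue_surjective (g x)
  classical
  have key := dvd_of_echelon hA (g := γ)
    (u := fun x => if hx : (x.1 : ℕ) ≤ i then g' ⟨x, hx⟩ else 0) (fun y => by
      rw [← h.residue_eq_zero, map_sum,
        ← Fintype.sum_subtype_add_sum_subtype (fun x : Σ i : Fin n, Fin (k i) => (x.1 : ℕ) ≤ i),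
        Finset.sum_eq_zero (s := (univ : Finset {x : Σ i : Fin n, Fin (k i) // ¬(x.1 : ℕ) ≤ i})),
        add_zero]
      · have := congrFun hg (p y)
        rw [Finset.sum_apply] at this
        rw [← this.trans (Pi.zero_apply _)]
        refine Finset.sum_congr rfl fun x _ => ?_
        simp only [dif_pos x.2, map_mul, hg', Pi.smul_apply, smul_eq_mul]
      · intro x _
        simp only [dif_neg x.2, zero_mul, map_zero])
  intro x
  have := key x.1
  simp only [dif_pos x.2] at this
  rw [← hg', h.residue_eq_zero]
  exact this

/-- If a combination of rows is divisible by `γ ^ i`, so are its coefficients, by echelon form;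
dividing them by `γ ^ i` gives the torsion word modulo `γ`. -/
theorem tor_span_rows (h : IsChain γ e) (hn : n ≤ e) {p : (Σ i : Fin n, Fin (k i)) ↪ Fin N}
    {A : Matrix (Σ i : Fin n, Fin (k i)) (Fin N) R}
    (hA : ∀ x y, (y.1 : ℕ) ≤ x.1 → A x (p y) = (1 : Matrix _ _ R) x y) {i : ℕ} (hi : i < n) :
    tor (Submodule.span R (Set.range fun x => red γ n fun c => γ ^ (x.1 : ℕ) * A x c)) (i + 1) =
      spanRows γ A i := by
  have hsum : ∀ b : (Σ i : Fin n, Fin (k i)) → R,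
      ∑ x, b x • red γ n (fun c => γ ^ (x.1 : ℕ) * A x c) =
        red γ n fun c => ∑ x, γ ^ (x.1 : ℕ) * b x * A x c := fun b => by
    ext t
    rw [Finset.sum_apply, red, map_sum]
    refine Finset.sum_congr rfl fun x _ => ?_
    rw [mul_right_comm, mul_comm]
    rfl
  ext v
  constructor
  · rintro ⟨c, hc, hmem⟩
    obtain ⟨b, hb⟩ := (Submodule.mem_span_range_iff_exists_fun _).1 hmem
    rw [hsum, ← sub_eq_zero] at hb
    have hd : ∀ t, γ ^ n ∣ ∑ x, γ ^ (x.1 : ℕ) * b x * A x t - γ ^ i * c t := red_eq_zero.1 hb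
    have h1 : ∀ y, γ ^ i ∣ ∑ x, γ ^ (x.1 : ℕ) * b x * A x (p y) := fun y =>
      (dvd_sub_left (dvd_mul_right _ _)).1 ((pow_dvd_pow γ hi.le).trans (hd (p y)))
    choose a ha using dvd_of_echelon (u := fun x => γ ^ (x.1 : ℕ) * b x) hA h1
    refine ⟨a, fun x => ⟨b x, (ha x).symm⟩, fun t => ?_⟩
    rw [← hc, ← sub_eq_zero, ← map_sub, h.residue_eq_zero]
    have h2 : γ ^ (i + 1) ∣ γ ^ i * (∑ x, a x * A x t - c t) := by
      rw [mul_sub, mul_sum]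
      simp only [← mul_assoc, ← ha]
      exact (pow_dvd_pow γ hi).trans (hd t)
    simpa using h.dvd_of_pow_mul h2 (by omega)
  · rintro ⟨a, ha, hv⟩
    choose b hb using ha
    refine ⟨fun t => ∑ x, a x * A x t, hv, ?_⟩
    refine (Submodule.mem_span_range_iff_exists_fun _).2 ⟨b, ?_⟩
    rw [hsum]
    congr 1
    funext t
    rw [Nat.add_sub_cancel, mul_sum]
    exact Finset.sum_congr rfl fun x _ => by rw [← hb, mul_assoc]

section Codes

variable {μ N₁ N₂ : ℕ} {ℓ : ℕ → ℕ} (G : BlockForm R μ N₁ N₂ k ℓ)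

/-- In a word of `Fs γ (2 * i)` the coefficients of the rows `[γ C | D]` are divisible by `γ ^ i`,
so after division by `γ ^ i` their left parts vanish modulo `γ`. Only the matrix `A` is seen. -/
theorem gX_eq_spanRows (h : IsChain γ e) (hμ : μ ≤ e) {i : ℕ} (hi : i < μ) :
    (gX γ (lat (G.code γ id μ)) i : Set (Fin N₁ → ResidueField R)) = spanRows γ G.A i := by
  ext v
  constructor
  · rintro ⟨x, hx, rfl⟩
    change sc γ i i x ∈ lat (G.code γ id μ) at hx
    rw [G.lat_code id (by omega)] at hx
    obtain ⟨_, ⟨a, ⟨ha, hb⟩, rfl⟩, f, hf, hsum⟩ := Submodule.mem_sup.1 hx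
    have hsc : sc γ i i x ∈ Fs γ (2 * i) := by
      rw [mem_Fs_even]
      exact ⟨fun t => dvd_mul_right _ _, fun t => dvd_mul_right _ _⟩
    have hc : G.comb γ a ∈ Fs γ (2 * i) := by
      rw [eq_sub_of_add_eq hsum]
      exact sub_mem hsc (Fs_antitone (by omega) hf)
    obtain ⟨h1, h2⟩ := G.dvd_of_comb_mem hc
    rw [show (2 * i + 1) / 2 = i by omega] at h1
    rw [show 2 * i / 2 = i by omega] at h2
    choose a' ha' using h1
    choose b' hb' using h2
    refine ⟨a', fun x => ?_, fun t => ?_⟩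
    · rw [← ha']; exact ha x
    · have h3 : γ ^ (i + 1) ∣ γ ^ i * (x.1 t - ∑ y, a' y * G.A y t) := by
        have h4 : (G.comb γ a).1 t + f.1 t = γ ^ i * x.1 t := congrFun (congrArg Prod.fst hsum) t
        have h5 : γ ^ i * (x.1 t - ∑ y, a' y * G.A y t) =
            γ ^ (i + 1) * ∑ z, b' z * G.C z t + f.1 t := by
          rw [mul_sub, ← h4, BlockForm.comb_fst, mul_sum, mul_sum, pow_succ']
          simp only [ha', hb', mul_sum, mul_assoc]
          ring
        rw [h5]
        refine dvd_add (dvd_mul_right _ _) ((pow_dvd_pow γ ?_).trans (hf.1 t))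
        omega
      have h6 := h.dvd_of_pow_mul h3 (by omega)
      rw [pow_one, ← h.residue_eq_zero, map_sub, sub_eq_zero] at h6
      exact h6.symm
  · rintro ⟨a, ha, hv⟩
    refine ⟨(fun t => ∑ x, a x * G.A x t, fun t => ∑ x, a x * G.B x t), ?_, funext hv⟩
    change sc γ i i _ ∈ lat (G.code γ id μ)
    rw [G.lat_code id (by omega)]
    refine le_sup_left (a := G.rowSpan γ id) ⟨(fun x => γ ^ i * a x, 0), ⟨ha, fun _ => dvd_zero _⟩,
      ?_⟩
    refine Prod.ext (funext fun t => ?_) (funext fun t => ?_)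
    · simp [BlockForm.comb_fst, sc_fst, mul_sum, mul_assoc]
    · simp [BlockForm.comb_snd, sc_snd, mul_sum, mul_assoc]

/-- In a word of `Fs γ (2 * j + 1)` the coefficients of the rows `[A | B]` are divisible by `γ ^ (j
+ 1)`, so `B` disappears modulo `γ`. -/
theorem gY_eq_spanRows (h : IsChain γ e) (hμ : μ ≤ e) {j : ℕ} (hj : j < μ - 1) :
    (gY γ (lat (G.code γ id μ)) j : Set (Fin N₂ → ResidueField R)) = spanRows γ G.D j := by
  ext v
  constructor
  · rintro ⟨x, hx, rfl⟩
    change sc γ (j + 1) j x ∈ lat (G.code γ id μ) at hx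
    rw [G.lat_code id (by omega)] at hx
    obtain ⟨_, ⟨a, ⟨ha, hb⟩, rfl⟩, f, hf, hsum⟩ := Submodule.mem_sup.1 hx
    have hsc : sc γ (j + 1) j x ∈ Fs γ (2 * j + 1) := by
      rw [mem_Fs_odd]
      exact ⟨fun t => dvd_mul_right _ _, fun t => dvd_mul_right _ _⟩
    have hc : G.comb γ a ∈ Fs γ (2 * j + 1) := by
      rw [eq_sub_of_add_eq hsum]
      exact sub_mem hsc (Fs_antitone (by omega) hf)
    obtain ⟨h1, h2⟩ := G.dvd_of_comb_mem hc
    rw [show (2 * j + 1 + 1) / 2 = j + 1 by omega] at h1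
    rw [show (2 * j + 1) / 2 = j by omega] at h2
    choose a' ha' using h1
    choose b' hb' using h2
    refine ⟨b', fun x => ?_, fun t => ?_⟩
    · rw [← hb']; exact hb x
    · have h3 : γ ^ (j + 1) ∣ γ ^ j * (x.2 t - ∑ y, b' y * G.D y t) := by
        have h4 : (G.comb γ a).2 t + f.2 t = γ ^ j * x.2 t := congrFun (congrArg Prod.snd hsum) t
        have h5 : γ ^ j * (x.2 t - ∑ y, b' y * G.D y t) =
            γ ^ (j + 1) * ∑ z, a' z * G.B z t + f.2 t := by
          rw [mul_sub, ← h4, BlockForm.comb_snd, mul_sum, mul_sum]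
          simp only [ha', hb', mul_assoc]
          ring
        rw [h5]
        refine dvd_add (dvd_mul_right _ _) ((pow_dvd_pow γ ?_).trans (hf.2 t))
        omega
      have h6 := h.dvd_of_pow_mul h3 (by omega)
      rw [pow_one, ← h.residue_eq_zero, map_sub, sub_eq_zero] at h6
      exact h6.symm
  · rintro ⟨b, hb, hv⟩
    refine ⟨(fun t => ∑ x, b x * G.C x t, fun t => ∑ x, b x * G.D x t), ?_, funext hv⟩
    change sc γ (j + 1) j _ ∈ lat (G.code γ id μ)
    rw [G.lat_code id (by omega)]
    refine le_sup_left (a := G.rowSpan γ id) ⟨(0, fun x => γ ^ j * b x), ⟨fun _ => dvd_zero _, hb⟩,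
      ?_⟩
    refine Prod.ext (funext fun t => ?_) (funext fun t => ?_)
    · simp [BlockForm.comb_fst, sc_fst, mul_sum, mul_assoc, pow_succ']
    · simp [BlockForm.comb_snd, sc_snd, mul_sum, mul_assoc]

variable {C : Code γ μ N₁ N₂}

/-- The lattice side does not mention a generator matrix. Hence all standard forms give the same
set, and the union in the definition of `torX` is harmless. -/
theorem torX_eq (h : IsChain γ e) (hμ : μ ≤ e) (hC : HasType C k ℓ) {i : ℕ} (hi : i < μ) :
    torX C (i + 1) = (gX γ (lat C) i : Set (Fin N₁ → ResidueField R)) := by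
  have key : ∀ (k ℓ : ℕ → ℕ) (G : BlockForm R μ N₁ N₂ k ℓ), IsStandardForm G C →
      tor (G.codeX γ) (i + 1) = (gX γ (lat C) i : Set (Fin N₁ → ResidueField R)) := by
    rintro k ℓ G rfl
    rw [gX_eq_spanRows G h hμ hi]
    exact tor_span_rows h hμ G.hA hi
  ext v
  constructor
  · rintro ⟨k, ℓ, G, hG, hv⟩
    rwa [key k ℓ G hG] at hv
  · intro hv
    obtain ⟨G, hG⟩ := hC
    exact ⟨k, ℓ, G, hG, by rwa [key k ℓ G hG]⟩

theorem torY_eq (h : IsChain γ e) (hμ : μ ≤ e) (hC : HasType C k ℓ) {j : ℕ} (hj : j < μ - 1) :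
    torY C (j + 1) = (gY γ (lat C) j : Set (Fin N₂ → ResidueField R)) := by
  have key : ∀ (k ℓ : ℕ → ℕ) (G : BlockForm R μ N₁ N₂ k ℓ), IsStandardForm G C →
      tor (G.codeY γ) (j + 1) = (gY γ (lat C) j : Set (Fin N₂ → ResidueField R)) := by
    rintro k ℓ G rfl
    rw [gY_eq_spanRows G h hμ hj]
    exact tor_span_rows h (by omega) G.hD hj
  ext v
  constructor
  · rintro ⟨k, ℓ, G, hG, hv⟩
    rwa [key k ℓ G hG] at hv
  · intro hv
    obtain ⟨G, hG⟩ := hC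
    exact ⟨k, ℓ, G, hG, by rwa [key k ℓ G hG]⟩

theorem finrank_gX (h : IsChain γ e) (hμ : μ ≤ e) (hC : HasType C k ℓ) {i : ℕ} (hi : i < μ) :
    finrank (ResidueField R) (gX γ (lat C) i) = m k i := by
  obtain ⟨G, rfl⟩ := hC
  rw [SetLike.coe_injective ((gX_eq_spanRows G h hμ hi).trans (spanRows_eq_span h hμ G.A i)),
    finrank_span_rows h G.hA hi]

theorem finrank_gY (h : IsChain γ e) (hμ : μ ≤ e) (hC : HasType C k ℓ) {j : ℕ} (hj : j < μ - 1) :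
    finrank (ResidueField R) (gY γ (lat C) j) = m ℓ j := by
  obtain ⟨G, rfl⟩ := hC
  have hμ' : μ - 1 ≤ e := by omega
  rw [SetLike.coe_injective ((gY_eq_spanRows G h hμ hj).trans (spanRows_eq_span h hμ' G.D j)),
    finrank_span_rows h G.hD hj]

end Codes

end Torsion

/-! ### Choosing pivot columns for an increasing family of spaces of words. -/

section Pivots

variable {F : Type*} [Field F] {N : ℕ}

/-- The coordinate functionals on a space of words. -/
def coordOn (W : Submodule F (Fin N → F)) (t : Fin N) : W →ₗ[F] F :=
  LinearMap.proj t ∘ₗ W.subtype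

theorem exists_coord_basis (W : Submodule F (Fin N → F)) {s : Set (Fin N)}
    (hs : LinearIndepOn F (coordOn W) s) :
    ∃ b, s ⊆ b ∧ LinearIndepOn F (coordOn W) b ∧ b.ncard = finrank F W := by
  obtain ⟨b, -, hsb, hspan, hb⟩ := exists_linearIndepOn_extension hs (Set.subset_univ s)
  have : Fintype b := Fintype.ofFinite b
  refine ⟨b, hsb, hb, le_antisymm ?_ ?_⟩
  · rw [← Nat.card_coe_set_eq, Nat.card_eq_fintype_card, ← Subspace.dual_finrank_eq]
    exact hb.fintype_card_le_finrank
  -- All coordinates lie in the span of the chosen ones, so a word killed by the latter is zero.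
  · have hinj : Function.Injective (LinearMap.pi fun t : b => coordOn W t) := by
      rw [← LinearMap.ker_eq_bot, LinearMap.ker_eq_bot']
      intro v hv
      have hv' : ∀ f ∈ Submodule.span F (coordOn W '' b), f v = 0 := by
        intro f hf
        induction hf using Submodule.span_induction with
        | mem f hf =>
          obtain ⟨t, ht, rfl⟩ := hf
          exact congrFun hv ⟨t, ht⟩
        | zero => rfl
        | add f g _ _ h1 h2 => rw [LinearMap.add_apply, h1, h2, add_zero]
        | smul c f _ h1 => rw [LinearMap.smul_apply, h1, smul_zero]
      exact Subtype.ext (funext fun t => hv' _ (hspan ⟨t, Set.mem_univ t, rfl⟩))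
    have := LinearMap.finrank_le_finrank_of_injective hinj
    rwa [finrank_fintype_fun_eq_card, ← Nat.card_eq_fintype_card, Nat.card_coe_set_eq] at this

/-- Restriction to a smaller space maps coordinate functionals to coordinate functionals, so
coordinates independent on `W i` stay independent on `W (i + 1)` and extend to a basis of the dual
there. -/
theorem exists_nested_coord_bases {W : ℕ → Submodule F (Fin N → F)} (hW : Monotone W) :
    ∃ S : ℕ → Set (Fin N), Monotone S ∧
      ∀ i, LinearIndepOn F (coordOn (W i)) (S i) ∧ (S i).ncard = finrank F (W i) := by
  have step : ∀ i (s : {s // LinearIndepOn F (coordOn (W i)) s ∧ s.ncard = finrank F (W i)}),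
      ∃ b : {s // LinearIndepOn F (coordOn (W (i + 1))) s ∧ s.ncard = finrank F (W (i + 1))},
        s.1 ⊆ b.1 := by
    intro i s
    have h1 : LinearIndepOn F (coordOn (W (i + 1))) s.1 := by
      let f : Dual F (W (i + 1)) →ₗ[F] Dual F (W i) :=
        (Submodule.inclusion (hW (Nat.le_succ i))).dualMap
      exact LinearIndependent.of_comp f s.2.1
    obtain ⟨b, hb, h2⟩ := exists_coord_basis _ h1
    exact ⟨⟨b, h2⟩, hb⟩
  choose f hf using step
  obtain ⟨b, -, h0⟩ := exists_coord_basis (W 0) (linearIndepOn_empty F (coordOn (W 0)))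
  let S : ∀ i, {s // LinearIndepOn F (coordOn (W i)) s ∧ s.ncard = finrank F (W i)} :=
    fun i => Nat.rec ⟨b, h0⟩ f i
  exact ⟨fun i => (S i).1, monotone_nat_of_le_succ fun i => hf i (S i), fun i => (S i).2⟩

/-- The differences of consecutive nested coordinate bases have sizes `k i` and are the pivot
blocks. Independence of the functionals on `W i` permits prescribing all pivots of index at most
`i`. -/
theorem exists_pivots {W : ℕ → Submodule F (Fin N → F)} (hW : Monotone W) {n : ℕ} {k : ℕ → ℕ}
    (hk : ∀ i < n, finrank F (W i) = m k i) :
    ∃ p : (Σ i : Fin n, Fin (k i)) ↪ Fin N, ∀ i < n, ∀ τ : (Σ i : Fin n, Fin (k i)) → F,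
      ∃ v ∈ W i, ∀ y, (y.1 : ℕ) ≤ i → v (p y) = τ y := by
  obtain ⟨S, hS, hb⟩ := exists_nested_coord_bases hW
  have hcard : ∀ i : Fin n, Nat.card (Fin (k i)) = Nat.card (disjointed S (i : ℕ) : Set (Fin N)) := by
    rintro ⟨i, hi⟩
    rw [Nat.card_fin, Nat.card_coe_set_eq]
    cases i with
    | zero =>
      rw [disjointed_zero, (hb 0).2, hk 0 hi]
      simp [m]
    | succ i =>
      have h1 : disjointed S (i + 1) = S (i + 1) \ S i := by
        rw [hS.disjointed_add_one]
      have h2 := Set.ncard_sdiff_add_ncard_of_subset (hS (Nat.le_succ i))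
      rw [← h1, (hb _).2, (hb _).2, hk _ hi, hk i (by omega), m, m,
        Finset.sum_range_succ _ (i + 1), add_comm] at h2
      exact (Nat.add_left_cancel h2).symm
  let f := fun i => (Finite.card_eq.1 (hcard i)).some
  have hmem : ∀ y : Σ i : Fin n, Fin (k i), ((f y.1 y.2 : Fin N)) ∈ disjointed S y.1 := fun y =>
    (f y.1 y.2).2
  have hinj : Function.Injective fun y : Σ i : Fin n, Fin (k i) => (f y.1 y.2 : Fin N) := by
    rintro ⟨i, a⟩ ⟨j, b⟩ hab
    have hij : i = j := by
      by_contra hne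
      have hd := disjoint_disjointed S (fun h => hne (Fin.ext h) : (i : ℕ) ≠ j)
      refine Set.disjoint_left.1 hd (hmem ⟨i, a⟩) ?_
      have := hmem ⟨j, b⟩
      rwa [show (f j b : Fin N) = f i a from hab.symm] at this
    subst hij
    exact congrArg _ ((f i).injective (Subtype.ext hab))
  refine ⟨⟨_, hinj⟩, fun i hi τ => ?_⟩
  have hS' : ∀ y : {y : Σ i : Fin n, Fin (k i) // (y.1 : ℕ) ≤ i}, (f y.1.1 y.1.2 : Fin N) ∈ S i :=
    fun y => hS y.2 (disjointed_le S _ (hmem y.1))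
  have hli : LinearIndependent F fun y : {y : Σ i : Fin n, Fin (k i) // (y.1 : ℕ) ≤ i} =>
      coordOn (W i) (f y.1.1 y.1.2) :=
    (hb i).1.comp (fun y => ⟨_, hS' y⟩) fun y y' h =>
      Subtype.ext (hinj (congrArg Subtype.val h))
  obtain ⟨v, hv⟩ := surjective_of_linearIndependent_dual hli fun y => τ y.1
  exact ⟨v, v.2, fun y hy => congrFun hv ⟨y, hy⟩⟩

end Pivots

/-! ### Existence of standard forms; the type as a list of dimensions. -/

section StandardForm

variable {R : Type*} [CommRing R] [IsLocalRing R] {γ : R} {e : ℕ}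

/-- Nakayama's lemma for the values of a family of linear functions. -/
theorem exists_eq_of_exists_residue_eq (h : IsChain γ e) {M ι : Type*} [AddCommGroup M]
    [Module R M] {D : Submodule R M} {f : M →ₗ[R] ι → R}
    (hf : ∀ τ : ι → ResidueField R, ∃ x ∈ D, ∀ t, residue R (f x t) = τ t) (τ : ι → R) :
    ∃ x ∈ D, f x = τ := by
  -- Successive approximation, which ends because `γ ^ e = 0`.
  have key : ∀ n : ℕ, ∃ x ∈ D, ∃ σ : ι → R, τ = f x + γ ^ n • σ := by
    intro n
    induction n with
    | zero => exact ⟨0, zero_mem _, τ, by simp⟩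
    | succ n ih =>
      obtain ⟨x, hx, σ, hσ⟩ := ih
      obtain ⟨y, hy, hy'⟩ := hf fun t => residue R (σ t)
      have hd : ∀ t, γ ∣ σ t - f y t := fun t => by
        rw [← h.residue_eq_zero, map_sub, hy', sub_self]
      choose ρ hρ using hd
      refine ⟨x + γ ^ n • y, add_mem hx (D.smul_mem _ hy), ρ, ?_⟩
      funext t
      have h1 : σ t = f y t + γ * ρ t := by rw [← hρ t]; ring
      rw [hσ, map_add, map_smul]
      simp only [Pi.add_apply, Pi.smul_apply, smul_eq_mul, h1]
      ring
  obtain ⟨x, hx, σ, hσ⟩ := key e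
  exact ⟨x, hx, by rw [hσ, h.nil, zero_smul, add_zero]⟩

variable {N₁ N₂ : ℕ}

theorem gX_mono {L L' : Submodule R (Word R N₁ N₂)} (hL : L ≤ L') (i : ℕ) :
    gX γ L i ≤ gX γ L' i := Submodule.map_mono (Submodule.comap_mono hL)

theorem gY_mono {L L' : Submodule R (Word R N₁ N₂)} (hL : L ≤ L') (j : ℕ) :
    gY γ L j ≤ gY γ L' j := Submodule.map_mono (Submodule.comap_mono hL)

theorem sc_succ (a b : ℕ) (x : Word R N₁ N₂) : sc γ (a + 1) (b + 1) x = γ • sc γ a b x := by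
  ext t
  · simp only [sc_fst, Prod.smul_fst, Pi.smul_apply, smul_eq_mul]; ring
  · simp only [sc_snd, Prod.smul_snd, Pi.smul_apply, smul_eq_mul]; ring

theorem monotone_gX (L : Submodule R (Word R N₁ N₂)) : Monotone (gX γ L) := by
  refine monotone_nat_of_le_succ fun i => ?_
  rintro _ ⟨x, hx, rfl⟩
  refine ⟨x, ?_, rfl⟩
  change sc γ _ _ x ∈ L
  rw [sc_succ]
  exact L.smul_mem _ hx

theorem monotone_gY (L : Submodule R (Word R N₁ N₂)) : Monotone (gY γ L) := by
  refine monotone_nat_of_le_succ fun i => ?_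
  rintro _ ⟨x, hx, rfl⟩
  refine ⟨x, ?_, rfl⟩
  change sc γ _ _ x ∈ L
  rw [sc_succ]
  exact L.smul_mem _ hx

variable {μ : ℕ} {k ℓ : ℕ → ℕ} {L : Submodule R (Word R N₁ N₂)}

/-- The property of pivots that allows us to prescribe the entries of words. -/
def IsPivot {F : Type*} [Field F] {N n : ℕ} (W : ℕ → Submodule F (Fin N → F))
    (p : (Σ i : Fin n, Fin (k i)) ↪ Fin N) : Prop :=
  ∀ i < n, ∀ τ : (Σ i : Fin n, Fin (k i)) → F, ∃ v ∈ W i, ∀ y, (y.1 : ℕ) ≤ i → v (p y) = τ y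

/-- A word of `gX` fixes the left pivots modulo `γ`; the right pivots are then corrected by a word
`(γ c, d)` obtained from `gY`, which leaves the left residues alone. Exact entries follow by
successive approximation. -/
theorem exists_rowX (h : IsChain γ e) (hL : Fs γ (2 * μ - 1) ≤ L)
    {p : (Σ i : Fin μ, Fin (k i)) ↪ Fin N₁} {q : (Σ j : Fin (μ - 1), Fin (ℓ j)) ↪ Fin N₂}
    (hp : IsPivot (gX γ L) p) (hq : IsPivot (gY γ L) q) (x : Σ i : Fin μ, Fin (k i)) :
    ∃ w, sc γ x.1 x.1 w ∈ L ∧ (∀ y, (y.1 : ℕ) ≤ x.1 → w.1 (p y) = (1 : Matrix _ _ R) x y) ∧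
      ∀ z, (z.1 : ℕ) ≤ x.1 → w.2 (q z) = 0 := by
  obtain ⟨i, a⟩ := x
  let f : Word R N₁ N₂ →ₗ[R] ({y : Σ i : Fin μ, Fin (k i) // (y.1 : ℕ) ≤ i} ⊕
      {z : Σ j : Fin (μ - 1), Fin (ℓ j) // (z.1 : ℕ) ≤ i}) → R :=
    LinearMap.pi (Sum.elim (fun y => LinearMap.proj (p y.1) ∘ₗ LinearMap.fst R _ _)
      (fun z => LinearMap.proj (q z.1) ∘ₗ LinearMap.snd R _ _))
  have key := exists_eq_of_exists_residue_eq h (D := L.comap (sc γ i i)) (f := f) (fun τ => by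
    classical
    obtain ⟨v, ⟨w, hw, rfl⟩, hwp⟩ := hp i i.2 fun y =>
      if hy : (y.1 : ℕ) ≤ i then τ (Sum.inl ⟨y, hy⟩) else 0
    obtain ⟨d, c, hcd, hd⟩ : ∃ d c, sc γ i i (γ • c, d) ∈ L ∧ ∀ z : {z : Σ j : Fin (μ - 1),
        Fin (ℓ j) // (z.1 : ℕ) ≤ i}, residue R (d (q z)) =
          τ (Sum.inr z) - residue R (w.2 (q z)) := by
      -- For the last block there is no right torsion code left, but `γ ^ (μ - 1)` annihilates every
      -- right part, so any correction is allowed.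
      rcases Nat.lt_or_ge (i : ℕ) (μ - 1) with hi | hi
      · obtain ⟨v, ⟨w', hw', rfl⟩, hwq⟩ := hq i hi fun z =>
          if hz : (z.1 : ℕ) ≤ i then τ (Sum.inr ⟨z, hz⟩) - residue R (w.2 (q z)) else 0
        refine ⟨w'.2, w'.1, ?_, fun z => ?_⟩
        · convert (show sc γ (i + 1) i w' ∈ L from hw') using 1
          ext t
          · simp only [sc_fst, Pi.smul_apply, smul_eq_mul]; ring
          · rfl
        · exact (hwq z.1 z.2).trans (dif_pos z.2)
      · choose d hd using fun z : {z : Σ j : Fin (μ - 1), Fin (ℓ j) // (z.1 : ℕ) ≤ i} =>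
          residue_surjective (τ (Sum.inr z) - residue R (w.2 (q z)))
        refine ⟨Function.extend (fun z => q z.1) d 0, 0, hL ?_, fun z => ?_⟩
        · refine ⟨fun t => by simp [sc_fst], fun t => ?_⟩
          rw [sc_snd]
          exact (pow_dvd_pow γ (by omega)).mul_right _
        · rw [Function.Injective.extend_apply (fun z z' hz => Subtype.ext (q.injective hz)), hd]
    refine ⟨w + (γ • c, d), add_mem hw hcd, ?_⟩
    rintro (y | z)
    · have h1 : f (w + (γ • c, d)) (Sum.inl y) = w.1 (p y) + γ * c (p y) := rfl
      rw [h1, map_add, (h.residue_eq_zero _).2 (dvd_mul_right _ _), add_zero]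
      exact (hwp y.1 y.2).trans (dif_pos y.2)
    · have h1 : f (w + (γ • c, d)) (Sum.inr z) = w.2 (q z) + d (q z) := rfl
      rw [h1, map_add, hd, add_sub_cancel])
  obtain ⟨w, hw, hf⟩ := key (Sum.elim (fun y => (1 : Matrix (Σ i : Fin μ, Fin (k i)) _ R) ⟨i, a⟩ y.1) 0)
  exact ⟨w, hw, fun y hy => congrFun hf (Sum.inl ⟨y, hy⟩),
    fun z hz => congrFun hf (Sum.inr ⟨z, hz⟩)⟩

/-- Now the right pivots come first. The left ones, up to block `j + 1`, are corrected by a word of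
`gX` of index `j + 1`, whose right part acquires a factor `γ` in the scaling by `(j + 1, j)`. -/
theorem exists_rowY (h : IsChain γ e)
    {p : (Σ i : Fin μ, Fin (k i)) ↪ Fin N₁} {q : (Σ j : Fin (μ - 1), Fin (ℓ j)) ↪ Fin N₂}
    (hp : IsPivot (gX γ L) p) (hq : IsPivot (gY γ L) q) (x : Σ j : Fin (μ - 1), Fin (ℓ j)) :
    ∃ w, sc γ (x.1 + 1) x.1 w ∈ L ∧ (∀ y, (y.1 : ℕ) ≤ x.1 + 1 → w.1 (p y) = 0) ∧
      ∀ z, (z.1 : ℕ) ≤ x.1 → w.2 (q z) = (1 : Matrix _ _ R) x z := by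
  obtain ⟨i, a⟩ := x
  let f : Word R N₁ N₂ →ₗ[R] ({y : Σ i : Fin μ, Fin (k i) // (y.1 : ℕ) ≤ i + 1} ⊕
      {z : Σ j : Fin (μ - 1), Fin (ℓ j) // (z.1 : ℕ) ≤ i}) → R :=
    LinearMap.pi (Sum.elim (fun y => LinearMap.proj (p y.1) ∘ₗ LinearMap.fst R _ _)
      (fun z => LinearMap.proj (q z.1) ∘ₗ LinearMap.snd R _ _))
  have key := exists_eq_of_exists_residue_eq h (D := L.comap (sc γ (i + 1) i)) (f := f) (fun τ => by
    classical
    obtain ⟨v, ⟨w, hw, rfl⟩, hwq⟩ := hq i i.2 fun z =>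
      if hz : (z.1 : ℕ) ≤ i then τ (Sum.inr ⟨z, hz⟩) else 0
    obtain ⟨v, ⟨w', hw', rfl⟩, hwp⟩ := hp (i + 1) (by omega) fun y =>
      if hy : (y.1 : ℕ) ≤ i + 1 then τ (Sum.inl ⟨y, hy⟩) - residue R (w.1 (p y)) else 0
    have hw'' : sc γ (i + 1) i (w'.1, γ • w'.2) ∈ L := by
      convert (show sc γ (i + 1) (i + 1) w' ∈ L from hw') using 1
      ext t
      · rfl
      · simp only [sc_snd, Pi.smul_apply, smul_eq_mul]; ring
    refine ⟨w + (w'.1, γ • w'.2), add_mem hw hw'', ?_⟩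
    rintro (y | z)
    · have h1 : f (w + (w'.1, γ • w'.2)) (Sum.inl y) = w.1 (p y) + w'.1 (p y) := rfl
      have h2 : residue R (w'.1 (p y)) = τ (Sum.inl y) - residue R (w.1 (p y)) :=
        (hwp y.1 y.2).trans (dif_pos y.2)
      rw [h1, map_add, h2, add_sub_cancel]
    · have h1 : f (w + (w'.1, γ • w'.2)) (Sum.inr z) = w.2 (q z) + γ * w'.2 (q z) := rfl
      rw [h1, map_add, (h.residue_eq_zero _).2 (dvd_mul_right _ _), add_zero]
      exact (hwq z.1 z.2).trans (dif_pos z.2))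
  obtain ⟨w, hw, hf⟩ := key (Sum.elim 0 (fun z => (1 : Matrix (Σ j : Fin (μ - 1), Fin (ℓ j)) _ R) ⟨i, a⟩ z.1))
  exact ⟨w, hw, fun y hy => congrFun hf (Sum.inl ⟨y, hy⟩),
    fun z hz => congrFun hf (Sum.inr ⟨z, hz⟩)⟩

variable [Finite R]

/-- Nested lattices with equal layers have equal cardinalities, by descending along the filtration
from `Fs γ (2 * μ - 1)`, which both contain. -/
theorem eq_of_finrank_eq (h : IsChain γ e) (hμ : 1 ≤ μ) (hμe : μ ≤ e)
    {L' : Submodule R (Word R N₁ N₂)} (hL : Fs γ (2 * μ - 1) ≤ L) (hLL : L ≤ L')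
    (hX : ∀ i < μ, finrank (ResidueField R) (gX γ L i) = finrank (ResidueField R) (gX γ L' i))
    (hY : ∀ j < μ - 1, finrank (ResidueField R) (gY γ L j) = finrank (ResidueField R) (gY γ L' j)) :
    L = L' := by
  have key : ∀ t ≤ 2 * μ - 1, Nat.card (L ⊓ Fs γ (2 * μ - 1 - t) : Submodule R (Word R N₁ N₂)) =
      Nat.card (L' ⊓ Fs γ (2 * μ - 1 - t) : Submodule R (Word R N₁ N₂)) := by
    intro t
    induction t with
    | zero =>
      intro _
      rw [Nat.sub_zero, inf_eq_right.2 hL, inf_eq_right.2 (hL.trans hLL)]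
    | succ t ih =>
      intro ht
      have ih' := ih (by omega)
      obtain ⟨i, hi | hi⟩ := Nat.even_or_odd' (2 * μ - 1 - (t + 1))
      · rw [show 2 * μ - 1 - t = 2 * i + 1 by omega] at ih'
        rw [hi, card_inf_Fs_even h L (by omega), card_inf_Fs_even h L' (by omega), ih',
          Submodule.eq_of_le_of_finrank_eq (gX_mono hLL i) (hX i (by omega))]
      · rw [show 2 * μ - 1 - t = 2 * i + 2 by omega] at ih'
        rw [hi, card_inf_Fs_odd h L (by omega), card_inf_Fs_odd h L' (by omega), ih',
          Submodule.eq_of_le_of_finrank_eq (gY_mono hLL i) (hY i (by omega))]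
  have h0 := key (2 * μ - 1) le_rfl
  rw [Nat.sub_self, Fs_zero, inf_top_eq, inf_top_eq] at h0
  exact SetLike.coe_injective (Set.eq_of_subset_of_ncard_le hLL
    (by rw [← Nat.card_coe_set_eq, ← Nat.card_coe_set_eq]; exact h0.ge) (Set.toFinite _))

/-- Pivots for the increasing torsion codes provide rows in standard form inside the lattice. The
code that these rows generate is contained in `C` and has the same layers, so it is `C`. -/
theorem hasType_iff (h : IsChain γ e) (hμ : 1 ≤ μ) (hμe : μ ≤ e) {C : Code γ μ N₁ N₂} :
    HasType C k ℓ ↔ (∀ i < μ, finrank (ResidueField R) (gX γ (lat C) i) = m k i) ∧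
      ∀ j < μ - 1, finrank (ResidueField R) (gY γ (lat C) j) = m ℓ j := by
  refine ⟨fun hC => ⟨fun i hi => finrank_gX h hμe hC hi, fun j hj => finrank_gY h hμe hC hj⟩, ?_⟩
  rintro ⟨hX, hY⟩
  obtain ⟨p, hp⟩ := exists_pivots (monotone_gX (lat C)) hX
  obtain ⟨q, hq⟩ := exists_pivots (monotone_gY (lat C)) hY
  choose a ha hap haq using exists_rowX h (Fs_le_lat hμ C) hp hq
  choose b hb hbp hbq using exists_rowY h hp hq
  let G : BlockForm R μ N₁ N₂ k ℓ :=
    { p := p, q := q, A := fun x => (a x).1, B := fun x => (a x).2, C := fun x => (b x).1,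
      D := fun x => (b x).2, hA := hap, hB := haq, hC := hbp, hD := hbq }
  have hG : HasType (G.code γ id μ) k ℓ := ⟨G, rfl⟩
  have hle : G.code γ id μ ≤ C := by
    rw [BlockForm.code, Submodule.span_le]
    rintro _ (⟨x, rfl⟩ | ⟨z, rfl⟩)
    · exact ha x
    · exact hb z
  refine ⟨G, lat_injective (eq_of_finrank_eq h hμ hμe (Fs_le_lat hμ _) (lat_le_lat.2 hle)
    (fun i hi => ?_) fun j hj => ?_)⟩
  · rw [hX i hi, finrank_gX h hμe hG hi]
  · rw [hY j hj, finrank_gY h hμe hG hj]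

local notation "qq" => Nat.card (ResidueField R)

theorem finrank_gX_iff (h : IsChain γ e) {i r : ℕ} (hi : i < e) :
    finrank (ResidueField R) (gX γ L i) = r ↔
      Nat.card (L ⊓ Fs γ (2 * i) : Submodule R (Word R N₁ N₂)) =
        qq ^ r * Nat.card (L ⊓ Fs γ (2 * i + 1) : Submodule R (Word R N₁ N₂)) := by
  rw [card_inf_Fs_even h L hi, Nat.mul_left_inj Nat.card_pos.ne',
    Module.natCard_eq_pow_finrank (K := ResidueField R),
    Nat.pow_right_inj (one_lt_card_residueField (R := R))]

theorem finrank_gY_iff (h : IsChain γ e) {j r : ℕ} (hj : j < e) :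
    finrank (ResidueField R) (gY γ L j) = r ↔
      Nat.card (L ⊓ Fs γ (2 * j + 1) : Submodule R (Word R N₁ N₂)) =
        qq ^ r * Nat.card (L ⊓ Fs γ (2 * j + 2) : Submodule R (Word R N₁ N₂)) := by
  rw [card_inf_Fs_odd h L hj, Nat.mul_left_inj Nat.card_pos.ne',
    Module.natCard_eq_pow_finrank (K := ResidueField R),
    Nat.pow_right_inj (one_lt_card_residueField (R := R))]

end StandardForm

/-! ### The lift relation without matrices, and the shift of torsion codes. -/

section Lifts

variable {R : Type*} [CommRing R] [IsLocalRing R] {γ : R} {e μ N₁ N₂ : ℕ} {k ℓ : ℕ → ℕ}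

theorem gm_sup (A B : Submodule R (Word R N₁ N₂)) : gm γ (A ⊔ B) = gm γ A ⊔ gm γ B :=
  Submodule.map_sup _ _ _

/-- The truncated weight `i - 1` gives blocks `0` and `1` the same weight, which is the merging of
the first two entries of the type; `i ≤ i - 1 + 1` still holds for both. -/
theorem BlockForm.gm_rowSpan_le {n : ℕ} (G : BlockForm R n N₁ N₂ k ℓ) :
    gm γ (G.rowSpan γ fun i => i - 1) ≤ G.rowSpan γ id := by
  rintro _ ⟨_, ⟨a, ⟨h1, h2⟩, rfl⟩, rfl⟩
  refine ⟨γ • a, ⟨fun x => ?_, fun z => ?_⟩, map_smul _ _ _⟩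
  · exact (pow_dvd_pow γ (show (x.1 : ℕ) ≤ x.1 - 1 + 1 by omega)).trans
      (by rw [pow_succ']; exact mul_dvd_mul_left γ (h1 x))
  · exact (pow_dvd_pow γ (show (z.1 : ℕ) ≤ z.1 - 1 + 1 by omega)).trans
      (by rw [pow_succ']; exact mul_dvd_mul_left γ (h2 z))

/-- A combination in `Fs γ 2` has all its coefficients divisible by `γ`, so `γ` can be taken out of
the coefficients themselves. -/
theorem BlockForm.inf_Fs_two_le {n : ℕ} (h : IsChain γ e) (hn : n ≤ e)
    (G : BlockForm R n N₁ N₂ k ℓ) :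
    G.rowSpan γ id ⊓ Fs γ 2 ≤ gm γ (G.rowSpan γ fun i => i - 1) := by
  rintro _ ⟨⟨a, ⟨ha, hb⟩, rfl⟩, hx⟩
  obtain ⟨h1, h2⟩ := G.dvd_of_comb_mem hx
  rw [show (2 + 1) / 2 = 1 by norm_num, pow_one] at h1
  rw [show 2 / 2 = 1 by norm_num, pow_one] at h2
  choose b hb' using h1
  choose c hc' using h2
  have hdvd : ∀ {i : ℕ} {z : R}, i < n → γ ^ i ∣ γ * z → γ ^ (i - 1) ∣ z := by
    intro i z hi hz
    cases i with
    | zero => simp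
    | succ i => exact h.dvd_of_mul hz (by omega)
  refine ⟨G.comb γ (b, c), ⟨(b, c), ⟨fun x => hdvd x.1.2 ?_, fun z => hdvd (i := z.1) (by omega) ?_⟩,
    rfl⟩, ?_⟩
  · rw [← hb']; exact ha x
  · rw [← hc']; exact hb z
  · change γ • G.comb γ (b, c) = _
    rw [← map_smul]
    congr 1
    exact Prod.ext (funext fun x => (hb' x).symm) (funext fun z => (hc' z).symm)

/-- The additional rows built from `T`, `J` and `U` lie in `Fs γ (2 * μ - 3)`, and modulo that
submodule `C'` is spanned by the rows shared with `C`. -/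
theorem IsLift.gm_lat (h : IsChain γ e) (hμ : 4 ≤ μ) (hμe : μ ≤ e) {C : Code γ (μ - 2) N₁ N₂}
    {C' : Code γ μ N₁ N₂} (hC : IsLift k ℓ C C') :
    (lat C' ⊓ Fs γ 2) ⊔ Fs γ (2 * μ - 3) = gm γ (lat C) := by
  obtain ⟨G, T, J, U, -, -, -, -, -, rfl, rfl⟩ := hC
  have h1 : G.rowSpan γ id ≤ lat (G.code γ id μ) := by
    rw [G.lat_code id (by omega)]
    exact le_sup_left
  have h2 : lat (G.code γ id μ ⊔ Submodule.span R
      (Set.range (fun x => ((red γ μ fun c => γ ^ (μ - 1) * T x c, 0) : Amb γ μ N₁ N₂)) ∪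
       Set.range (fun x => ((red γ μ fun c => γ ^ (μ - 1) * J x c,
          red γ (μ - 1) fun d => γ ^ (μ - 2) * U x d) : Amb γ μ N₁ N₂)))) ≤
      G.rowSpan γ id ⊔ Fs γ (2 * μ - 3) := by
    have hF : (Fs γ (2 * μ - 1) : Submodule R (Word R N₁ N₂)) ≤
        G.rowSpan γ id ⊔ Fs γ (2 * μ - 3) := (Fs_antitone (by omega)).trans le_sup_right
    rw [← lat_map (by omega) hF, lat_le_lat, Submodule.map_sup, G.map_rowSpan]
    refine sup_le_sup_left (Submodule.span_le.2 ?_) _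
    rintro _ (⟨x, rfl⟩ | ⟨x, rfl⟩)
    · refine ⟨(fun c => γ ^ (μ - 1) * T x c, 0), ⟨fun t => ?_, fun t => dvd_zero _⟩, rfl⟩
      exact (pow_dvd_pow γ (by omega)).mul_right _
    · refine ⟨(fun c => γ ^ (μ - 1) * J x c, fun d => γ ^ (μ - 2) * U x d),
        ⟨fun t => ?_, fun t => ?_⟩, rfl⟩
      · exact (pow_dvd_pow γ (by omega)).mul_right _
      · exact (pow_dvd_pow γ (by omega)).mul_right _
  rw [G.lat_code _ (by omega), gm_sup, gm_Fs, show 2 * (μ - 2) - 1 + 2 = 2 * μ - 3 by omega]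
  apply le_antisymm
  · refine sup_le ?_ le_sup_right
    rintro x ⟨hx, hx2⟩
    obtain ⟨y, hy, f, hf, rfl⟩ := Submodule.mem_sup.1 (h2 hx)
    refine add_mem (le_sup_left (a := gm γ _) (G.inf_Fs_two_le h (by omega) ⟨hy, ?_⟩))
      (le_sup_right (a := gm γ _) hf)
    simpa using sub_mem hx2 (Fs_antitone (by omega) hf)
  · refine sup_le_sup_right (le_inf (G.gm_rowSpan_le.trans (h1.trans ?_)) ?_) _
    · exact lat_le_lat.2 le_sup_left
    · rintro _ ⟨x, -, rfl⟩
      exact smul_mem_Fs (s := 0) (by rw [Fs_zero]; trivial)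

/-- The rows of a matrix in block echelon form which belong to one block. -/
theorem linearIndependent_block {n N : ℕ} {p : (Σ i : Fin n, Fin (k i)) ↪ Fin N}
    {A : Matrix (Σ i : Fin n, Fin (k i)) (Fin N) R}
    (hA : ∀ x y, (y.1 : ℕ) ≤ x.1 → A x (p y) = (1 : Matrix _ _ R) x y) (i : Fin n) :
    LinearIndependent (ResidueField R) fun (a : Fin (k i)) t => residue R (A ⟨i, a⟩ t) := by
  rw [Fintype.linearIndependent_iff]
  intro g hg b
  have := congrFun hg (p ⟨i, b⟩)
  rw [Finset.sum_apply, Finset.sum_eq_single b] at this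
  · simpa [hA _ _ le_rfl] using this
  · intro a _ hab
    have hne : (⟨i, a⟩ : Σ i : Fin n, Fin (k i)) ≠ ⟨i, b⟩ := fun h => hab (by simpa using h)
    have h0 : A ⟨i, a⟩ (p ⟨i, b⟩) = 0 := (hA ⟨i, a⟩ ⟨i, b⟩ le_rfl).trans (Matrix.one_apply_ne hne)
    rw [Pi.smul_apply, h0, map_zero, smul_zero]
  · simp

/-- The inclusion of the rows of the first blocks. -/
def rowIncl (k : ℕ → ℕ) {n n' : ℕ} (h : n ≤ n') :
    (Σ i : Fin n, Fin (k i)) ↪ Σ i : Fin n', Fin (k i) where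
  toFun x := ⟨Fin.castLE h x.1, x.2⟩
  inj' := by
    rintro ⟨i, a⟩ ⟨j, b⟩ hab
    obtain rfl : i = j := Fin.ext (congrArg (fun x => (x.1 : ℕ)) hab)
    simpa using hab

theorem one_rowIncl {n n' : ℕ} (h : n ≤ n') (x y : Σ i : Fin n, Fin (k i)) :
    (1 : Matrix _ _ R) (rowIncl k h x) (rowIncl k h y) = (1 : Matrix _ _ R) x y := by
  simp only [Matrix.one_apply, EmbeddingLike.apply_eq_iff_eq]

/-- The block form consisting of all but the last row blocks. -/
def BlockForm.truncate (G : BlockForm R μ N₁ N₂ k ℓ) : BlockForm R (μ - 1) N₁ N₂ k ℓ where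
  p := (rowIncl k (Nat.sub_le μ 1)).trans G.p
  q := (rowIncl ℓ (Nat.sub_le (μ - 1) 1)).trans G.q
  A x := G.A (rowIncl k (Nat.sub_le μ 1) x)
  B x := G.B (rowIncl k (Nat.sub_le μ 1) x)
  C x := G.C (rowIncl ℓ (Nat.sub_le (μ - 1) 1) x)
  D x := G.D (rowIncl ℓ (Nat.sub_le (μ - 1) 1) x)
  hA _ _ h := (G.hA _ _ h).trans (one_rowIncl _ _ _)
  hB _ _ h := G.hB _ _ h
  hC _ _ h := G.hC _ _ h
  hD _ _ h := (G.hD _ _ h).trans (one_rowIncl _ _ _)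

/-- Cutting the last row blocks off a standard form leaves the common block form, and the cut blocks
serve as `T`, `J` and `U`. -/
theorem HasType.exists_isLift (hμ : 2 ≤ μ) {C' : Code γ μ N₁ N₂} (hC : HasType C' k ℓ) :
    ∃ C, IsLift k ℓ C C' := by
  obtain ⟨G, rfl⟩ := hC
  refine ⟨_, G.truncate, fun a => G.A ⟨⟨μ - 1, by omega⟩, a⟩, fun a => G.C ⟨⟨μ - 2, by omega⟩, a⟩,
    fun a => G.D ⟨⟨μ - 2, by omega⟩, a⟩, ?_, ?_, ?_, linearIndependent_block G.hA ⟨μ - 1, by omega⟩,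
    linearIndependent_block G.hD ⟨μ - 2, by omega⟩, rfl, ?_⟩
  · intro a y
    refine (G.hA _ (rowIncl k _ y) ?_).trans (Matrix.one_apply_ne fun h => ?_)
    · exact y.1.2.le
    · have : (μ - 1 : ℕ) = y.1 := congrArg (fun x => (x.1 : ℕ)) h
      have := y.1.2
      omega
  · intro a y
    refine G.hC _ (rowIncl k _ y) ?_
    have := y.1.2
    change (y.1 : ℕ) ≤ μ - 2 + 1
    omega
  · intro a y
    refine (G.hD _ (rowIncl ℓ _ y) ?_).trans (Matrix.one_apply_ne fun h => ?_)
    · have := y.1.2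
      change (y.1 : ℕ) ≤ μ - 2
      omega
    · have : (μ - 2 : ℕ) = y.1 := congrArg (fun x => (x.1 : ℕ)) h
      have := y.1.2
      omega
  · have hX : ∀ a : Fin (k (μ - 1)), (red γ (μ - 1) fun d => γ ^ (μ - 1) * G.B ⟨⟨μ - 1, by omega⟩, a⟩ d) = 0 :=
      fun a => red_eq_zero.2 fun t => dvd_mul_right _ _
    apply le_antisymm
    · rw [BlockForm.code, Submodule.span_le]
      rintro _ (⟨⟨⟨i, hi⟩, a⟩, rfl⟩ | ⟨⟨⟨j, hj⟩, b⟩, rfl⟩)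
      · rcases Nat.lt_or_ge i (μ - 1) with h | h
        · exact Submodule.mem_sup_left (Submodule.subset_span (Or.inl ⟨⟨⟨i, h⟩, a⟩, rfl⟩))
        · obtain rfl : i = μ - 1 := by omega
          refine Submodule.mem_sup_right (Submodule.subset_span (Or.inl ⟨a, ?_⟩))
          exact Prod.ext rfl (hX a).symm
      · rcases Nat.lt_or_ge j (μ - 1 - 1) with h | h
        · exact Submodule.mem_sup_left (Submodule.subset_span (Or.inr ⟨⟨⟨j, h⟩, b⟩, rfl⟩))
        · obtain rfl : j = μ - 2 := by omega
          refine Submodule.mem_sup_right (Submodule.subset_span (Or.inr ⟨b, ?_⟩))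
          refine Prod.ext ?_ rfl
          change red γ μ _ = red γ μ fun c => γ ^ (μ - 2 + 1) * _
          rw [show μ - 2 + 1 = μ - 1 by omega]
    · refine sup_le ?_ ?_
      · rw [BlockForm.code, Submodule.span_le]
        rintro _ (⟨x, rfl⟩ | ⟨z, rfl⟩)
        · exact Submodule.subset_span (Or.inl ⟨rowIncl k _ x, rfl⟩)
        · exact Submodule.subset_span (Or.inr ⟨rowIncl ℓ _ z, rfl⟩)
      · rw [Submodule.span_le]
        rintro _ (⟨a, rfl⟩ | ⟨b, rfl⟩)
        · exact Submodule.subset_span (Or.inl ⟨⟨⟨μ - 1, by omega⟩, a⟩, Prod.ext rfl (hX a)⟩)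
        · refine Submodule.subset_span (Or.inr ⟨⟨⟨μ - 2, by omega⟩, b⟩, Prod.ext ?_ rfl⟩)
          change (red γ μ fun c => γ ^ (μ - 2 + 1) * _) = red γ μ _
          rw [show μ - 2 + 1 = μ - 1 by omega]

variable [Finite R]

theorem eq_of_gm_lat_eq (h : IsChain γ e) (hμ : 1 ≤ μ) (hμe : μ < e) {C C' : Code γ μ N₁ N₂}
    (hC : gm γ (lat C) = gm γ (lat C')) : C = C' := by
  have hle : ∀ D : Code γ μ N₁ N₂, Fs γ (2 * e - 2) ≤ lat D := fun D =>
    (Fs_antitone (by omega)).trans (Fs_le_lat hμ D)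
  exact lat_injective (le_antisymm
    (fun x hx => mem_of_smul_mem_gm h (by omega) (hle _) (hC.le (smul_mem_gm hx)))
    fun x hx => mem_of_smul_mem_gm h (by omega) (hle _) (hC.ge (smul_mem_gm hx)))

/-- A code of the given type lifts some `C₁`, and the relation on the right determines the lifted
code, because `γ` can be cancelled from its lattice. -/
theorem isLift_iff (h : IsChain γ e) (hμ : 4 ≤ μ) (hμe : μ ≤ e) {C : Code γ (μ - 2) N₁ N₂}
    {C' : Code γ μ N₁ N₂} (hC' : HasType C' k ℓ) :
    IsLift k ℓ C C' ↔ (lat C' ⊓ Fs γ 2) ⊔ Fs γ (2 * μ - 3) = gm γ (lat C) := by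
  refine ⟨fun hC => hC.gm_lat h hμ hμe, fun hC => ?_⟩
  obtain ⟨C₁, h1⟩ := hC'.exists_isLift (by omega)
  obtain rfl : C₁ = C :=
    eq_of_gm_lat_eq h (by omega) (by omega) ((h1.gm_lat h hμ hμe).symm.trans hC)
  exact h1

theorem gX_sup_Fs (h : IsChain γ e) {n i : ℕ} (hi : i ≤ n) (A : Submodule R (Word R N₁ N₂)) :
    gX γ (A ⊔ Fs γ (2 * n + 1)) i = gX γ A i := by
  refine le_antisymm ?_ (gX_mono le_sup_left i)
  rintro _ ⟨x, hx, rfl⟩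
  obtain ⟨y, hy, f, hf, hyf⟩ := Submodule.mem_sup.1 (show sc γ i i x ∈ _ from hx)
  rw [mem_Fs_odd] at hf
  choose c hc using fun t => (pow_dvd_pow γ (show i + 1 ≤ n + 1 by omega)).trans (hf.1 t)
  choose d hd using fun t => (pow_dvd_pow γ hi).trans (hf.2 t)
  refine ⟨x - (fun t => γ * c t, d), ?_, ?_⟩
  · change sc γ i i _ ∈ A
    convert hy using 1
    rw [map_sub, ← hyf, sub_eq_iff_eq_add]
    congr 1
    ext t
    · rw [hc, sc_fst]; ring
    · rw [hd, sc_snd]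
  · rw [map_sub, (resX_eq_zero (x := (fun t => γ * c t, d)) h).2 fun t => dvd_mul_right γ (c t), sub_zero]

/-- The inequality is strict, unlike on the left: the right part of `Fs γ (2 * n + 1)` is divisible
only by `γ ^ n`. -/
theorem gY_sup_Fs (h : IsChain γ e) {n j : ℕ} (hj : j < n) (A : Submodule R (Word R N₁ N₂)) :
    gY γ (A ⊔ Fs γ (2 * n + 1)) j = gY γ A j := by
  refine le_antisymm ?_ (gY_mono le_sup_left j)
  rintro _ ⟨x, hx, rfl⟩
  obtain ⟨y, hy, f, hf, hyf⟩ := Submodule.mem_sup.1 (show sc γ (j + 1) j x ∈ _ from hx)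
  rw [mem_Fs_odd] at hf
  choose c hc using fun t => (pow_dvd_pow γ (show j + 1 ≤ n + 1 by omega)).trans (hf.1 t)
  choose d hd using fun t => (pow_dvd_pow γ (show j + 1 ≤ n by omega)).trans (hf.2 t)
  refine ⟨x - (c, fun t => γ * d t), ?_, ?_⟩
  · change sc γ (j + 1) j _ ∈ A
    convert hy using 1
    rw [map_sub, ← hyf, sub_eq_iff_eq_add]
    congr 1
    ext t
    · rw [hc, sc_fst]
    · rw [hd, sc_snd]; ring
  · rw [map_sub, (resY_eq_zero (x := (c, fun t => γ * d t)) h).2 fun t => dvd_mul_right γ (d t), sub_zero]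

theorem gX_inf_Fs_two (A : Submodule R (Word R N₁ N₂)) (i : ℕ) :
    gX γ (A ⊓ Fs γ 2) (i + 1) = gX γ A (i + 1) := by
  refine le_antisymm (gX_mono inf_le_left _) ?_
  rintro _ ⟨x, hx, rfl⟩
  refine ⟨x, ⟨hx, ?_⟩, rfl⟩
  change sc γ (i + 1) (i + 1) x ∈ Fs γ (0 + 2)
  rw [sc_succ]
  exact smul_mem_Fs (by rw [Fs_zero]; trivial)

theorem gY_inf_Fs_two (A : Submodule R (Word R N₁ N₂)) (j : ℕ) :
    gY γ (A ⊓ Fs γ 2) (j + 1) = gY γ A (j + 1) := by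
  refine le_antisymm (gY_mono inf_le_left _) ?_
  rintro _ ⟨x, hx, rfl⟩
  refine ⟨x, ⟨hx, ?_⟩, rfl⟩
  change sc γ (j + 1 + 1) (j + 1) x ∈ Fs γ (0 + 2)
  rw [sc_succ]
  exact smul_mem_Fs (by rw [Fs_zero]; trivial)

theorem gX_gm (h : IsChain γ e) (he : 1 ≤ e) {L : Submodule R (Word R N₁ N₂)}
    (hL : Fs γ (2 * e - 2) ≤ L) (i : ℕ) : gX γ (gm γ L) (i + 1) = gX γ L i := by
  apply le_antisymm
  · rintro _ ⟨x, hx, rfl⟩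
    refine ⟨x, mem_of_smul_mem_gm h he hL ?_, rfl⟩
    rw [← sc_succ]
    exact hx
  · rintro _ ⟨x, hx, rfl⟩
    refine ⟨x, ?_, rfl⟩
    change sc γ (i + 1) (i + 1) x ∈ gm γ L
    rw [sc_succ]
    exact smul_mem_gm hx

theorem gY_gm (h : IsChain γ e) (he : 1 ≤ e) {L : Submodule R (Word R N₁ N₂)}
    (hL : Fs γ (2 * e - 2) ≤ L) (j : ℕ) : gY γ (gm γ L) (j + 1) = gY γ L j := by
  apply le_antisymm
  · rintro _ ⟨x, hx, rfl⟩
    refine ⟨x, mem_of_smul_mem_gm h he hL ?_, rfl⟩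
    rw [← sc_succ]
    exact hx
  · rintro _ ⟨x, hx, rfl⟩
    refine ⟨x, ?_, rfl⟩
    change sc γ (j + 1 + 1) (j + 1) x ∈ gm γ L
    rw [sc_succ]
    exact smul_mem_gm hx

section Relation

variable {L L' : Submodule R (Word R N₁ N₂)} {n : ℕ}

/-- Neither intersecting with `Fs γ 2` nor adding `Fs γ (2 * n + 1)` changes these torsion codes,
and multiplication by `γ` shifts the index by one. -/
theorem gX_succ_eq (h : IsChain γ e) (hn : 1 ≤ n) (hne : n + 1 ≤ e) (hL : Fs γ (2 * n - 1) ≤ L)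
    (hLL : (L' ⊓ Fs γ 2) ⊔ Fs γ (2 * n + 1) = gm γ L) {i : ℕ} (hi : i < n) :
    gX γ L' (i + 1) = gX γ L i := by
  rw [← gX_gm h (by omega) ((Fs_antitone (by omega)).trans hL) i, ← hLL, gX_sup_Fs h hi,
    gX_inf_Fs_two]

theorem gY_succ_eq (h : IsChain γ e) (hn : 1 ≤ n) (hne : n + 1 ≤ e) (hL : Fs γ (2 * n - 1) ≤ L)
    (hLL : (L' ⊓ Fs γ 2) ⊔ Fs γ (2 * n + 1) = gm γ L) {j : ℕ} (hj : j + 1 < n) :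
    gY γ L' (j + 1) = gY γ L j := by
  rw [← gY_gm h (by omega) ((Fs_antitone (by omega)).trans hL) j, ← hLL, gY_sup_Fs h hj,
    gY_inf_Fs_two]

end Relation

end Lifts

theorem m_merge (k : ℕ → ℕ) (i : ℕ) : m (merge k) i = m k (i + 1) := by
  induction i with
  | zero => simp [m, merge, Finset.sum_range_succ]
  | succ i ih =>
    rw [m] at ih ⊢
    rw [Finset.sum_range_succ, ih, m, m, Finset.sum_range_succ _ (i + 1 + 1)]
    simp [merge]

theorem m_succ (k : ℕ → ℕ) (i : ℕ) : m k (i + 1) = m k i + k (i + 1) := Finset.sum_range_succ _ _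

/-- The instance `i = s` of admissibility. It provides the non-negative slacks `u` and `w` used in
the counts. -/
theorem Admissible.le {n s : ℕ} {k : ℕ → ℕ} (hk : Admissible n (s + 1) k) :
    k 0 + m k s ≤ n := by
  have h1 := hk s (by omega) (by omega)
  have h2 : m k s = k 0 + ∑ j ∈ Ico 1 (s + 1), k j := by
    rw [m, Finset.range_eq_Ico, ← Finset.sum_eq_sum_Ico_succ_bot (by omega)]
  rw [show s + 1 - s = 1 by omega, Finset.sum_range_one] at h1
  omega

theorem gauss_pos {q n s : ℕ} (hq : 1 < q) (hs : s ≤ n) : 0 < gauss q n s := by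
  have key : ∀ {i j : ℕ}, i < j → (0 : ℚ) < (q : ℚ) ^ j - (q : ℚ) ^ i := fun hij =>
    sub_pos.2 (pow_lt_pow_right₀ (by exact_mod_cast hq) hij)
  refine Finset.prod_pos fun i hi => ?_
  have := Finset.mem_range.1 hi
  exact div_pos (key (by omega)) (key (by omega))

/-! ### Counting lifts of codes. -/

section Counting

variable {R : Type*} [CommRing R] [IsLocalRing R] [Finite R] {γ : R} {e ν N₁ N₂ : ℕ}
  {k ℓ : ℕ → ℕ} {C : Code γ (ν + 4 - 2) N₁ N₂} {C' : Code γ (ν + 4) N₁ N₂}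

local notation "qq" => Nat.card (ResidueField R)

theorem Fs_le_lat_sub_two : Fs γ (2 * ν + 3) ≤ lat C := by
  have := Fs_le_lat (by omega) C
  rwa [show 2 * (ν + 4 - 2) - 1 = 2 * ν + 3 by omega] at this

theorem Fs_le_lat_add_four : Fs γ (2 * ν + 7) ≤ lat C' := by
  have := Fs_le_lat (by omega) C'
  rwa [show 2 * (ν + 4) - 1 = 2 * ν + 7 by omega] at this

theorem isLift_iff_lies (h : IsChain γ e) (hνe : ν + 4 ≤ e) (hC' : HasType C' k ℓ) :
    IsLift k ℓ C C' ↔ (lat C' ⊓ Fs γ 2) ⊔ Fs γ (2 * ν + 5) = gm γ (lat C) := by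
  rw [isLift_iff h (by omega) hνe hC', show 2 * (ν + 4) - 3 = 2 * ν + 5 by omega]

theorem gX_succ_eq_of_lies (h : IsChain γ e) (hνe : ν + 4 ≤ e)
    (hL : (lat C' ⊓ Fs γ 2) ⊔ Fs γ (2 * ν + 5) = gm γ (lat C)) {i : ℕ} (hi : i < ν + 2) :
    gX γ (lat C') (i + 1) = gX γ (lat C) i :=
  gX_succ_eq (n := ν + 2) h (by omega) (by omega)
    ((Fs_antitone (by omega)).trans Fs_le_lat_sub_two) hL hi

theorem gY_succ_eq_of_lies (h : IsChain γ e) (hνe : ν + 4 ≤ e)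
    (hL : (lat C' ⊓ Fs γ 2) ⊔ Fs γ (2 * ν + 5) = gm γ (lat C)) {j : ℕ} (hj : j < ν + 1) :
    gY γ (lat C') (j + 1) = gY γ (lat C) j :=
  gY_succ_eq (n := ν + 2) h (by omega) (by omega)
    ((Fs_antitone (by omega)).trans Fs_le_lat_sub_two) hL (by omega)

theorem isBase_lat (h : IsChain γ e) (hodd : Odd qq) (hνe : ν + 4 ≤ e) (hC : SelfOrthogonal C)
    (hC' : HasType C (merge k) (merge ℓ)) :
    IsBase γ e ν (m k (ν + 2)) (m ℓ (ν + 1)) (lat C) := by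
  refine ⟨h, hodd, hνe, Fs_le_lat_sub_two, selfOrthogonal_iff.1 hC, ?_, ?_⟩
  · have h1 := (finrank_gX_iff h (by omega)).1 (finrank_gX h (by omega) hC'
      (show ν + 1 < ν + 4 - 2 by omega))
    rw [m_merge, show 2 * (ν + 1) + 1 = 2 * ν + 3 by ring, inf_eq_right.2 Fs_le_lat_sub_two,
      show 2 * (ν + 1) = 2 * ν + 2 by ring] at h1
    exact h1
  · have h1 := (finrank_gY_iff h (by omega)).1
      (finrank_gY h (by omega) hC' (show ν < ν + 4 - 2 - 1 by omega))
    rwa [m_merge] at h1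

/-- The intermediate torsion dimensions of `C'` are inherited from `C`, so the type adds conditions
only at the first and last indices. The last ones are part of `IsOver`. -/
theorem isLift_and_iff (h : IsChain γ e) (hνe : ν + 4 ≤ e)
    (hC : HasType C (merge k) (merge ℓ)) :
    (IsLift k ℓ C C' ∧ SelfOrthogonal C' ∧ HasType C' k ℓ) ↔
      IsOver γ ν (m k (ν + 2)) (m ℓ (ν + 1)) (k (ν + 3)) (ℓ (ν + 2)) (lat C) (lat C') ∧
      finrank (ResidueField R) (gX γ (lat C') 0) = k 0 ∧
      finrank (ResidueField R) (gY γ (lat C') 0) = ℓ 0 := by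
  have eX : ∀ r, finrank (ResidueField R) (gX γ (lat C') (ν + 3)) = r ↔
      Nat.card (lat C' ⊓ Fs γ (2 * ν + 6) : Submodule R (Word R N₁ N₂)) =
        qq ^ r * Nat.card (Fs γ (2 * ν + 7) : Submodule R (Word R N₁ N₂)) := fun r => by
    rw [finrank_gX_iff h (by omega), show 2 * (ν + 3) + 1 = 2 * ν + 7 by ring,
      inf_eq_right.2 Fs_le_lat_add_four, show 2 * (ν + 3) = 2 * ν + 6 by ring]
  have eY : ∀ r, finrank (ResidueField R) (gY γ (lat C') (ν + 2)) = r ↔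
      Nat.card (lat C' ⊓ Fs γ (2 * ν + 5) : Submodule R (Word R N₁ N₂)) =
        qq ^ r * Nat.card (lat C' ⊓ Fs γ (2 * ν + 6) : Submodule R (Word R N₁ N₂)) := fun r => by
    rw [finrank_gY_iff h (by omega), show 2 * (ν + 2) + 1 = 2 * ν + 5 by ring,
      show 2 * (ν + 2) + 2 = 2 * ν + 6 by ring]
  constructor
  · rintro ⟨h1, h2, h3⟩
    have hX := fun i (hi : i < ν + 4) => finrank_gX h hνe h3 hi
    have hY := fun i (hi : i < ν + 4 - 1) => finrank_gY h hνe h3 hi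
    refine ⟨⟨Fs_le_lat_add_four, selfOrthogonal_iff.1 h2, (isLift_iff_lies h hνe h3).1 h1, ?_, ?_⟩, ?_, ?_⟩
    · exact (eY _).1 ((hY (ν + 2) (by omega)).trans (m_succ _ _))
    · exact (eX _).1 ((hX (ν + 3) (by omega)).trans (m_succ _ _))
    · rw [hX 0 (by omega)]; simp [m]
    · rw [hY 0 (by omega)]; simp [m]
  · rintro ⟨h1, h2, h3⟩
    have h4 : HasType C' k ℓ := by
      refine (hasType_iff h (by omega) hνe).2 ⟨fun i hi => ?_, fun j hj => ?_⟩
      · rcases i with _ | i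
        · rw [h2]; simp [m]
        · rcases Nat.lt_or_ge i (ν + 2) with hi' | hi'
          · rw [gX_succ_eq_of_lies h hνe h1.lies hi', ← m_merge]
            exact finrank_gX h (by omega) hC (by omega)
          · obtain rfl : i = ν + 2 := by omega
            rw [m_succ]
            exact (eX _).2 h1.cX
      · rcases j with _ | j
        · rw [h3]; simp [m]
        · rcases Nat.lt_or_ge j (ν + 1) with hj' | hj'
          · rw [gY_succ_eq_of_lies h hνe h1.lies hj', ← m_merge]
            exact finrank_gY h (by omega) hC (by omega)
          · obtain rfl : j = ν + 1 := by omega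
            rw [m_succ]
            exact (eY _).2 h1.cY
    exact ⟨(isLift_iff_lies h hνe h4).2 h1.lies, selfOrthogonal_iff.2 h1.iso, h4⟩

theorem IsLift.torX_succ (h : IsChain γ e) (hνe : ν + 4 ≤ e)
    (hC : HasType C (merge k) (merge ℓ)) (hC' : HasType C' k ℓ) (hL : IsLift k ℓ C C') {i : ℕ}
    (hi : 1 ≤ i) (hi' : i ≤ ν + 2) : torX C' (i + 1) = torX C i := by
  obtain ⟨i, rfl⟩ : ∃ i', i = i' + 1 := ⟨i - 1, by omega⟩
  rw [torX_eq h hνe hC' (by omega), torX_eq h (by omega) hC (by omega),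
    gX_succ_eq_of_lies h hνe ((isLift_iff_lies h hνe hC').1 hL) (by omega)]

theorem IsLift.torY_succ (h : IsChain γ e) (hνe : ν + 4 ≤ e)
    (hC : HasType C (merge k) (merge ℓ)) (hC' : HasType C' k ℓ) (hL : IsLift k ℓ C C') {j : ℕ}
    (hj : 1 ≤ j) (hj' : j ≤ ν + 1) : torY C' (j + 1) = torY C j := by
  obtain ⟨j, rfl⟩ : ∃ j', j = j' + 1 := ⟨j - 1, by omega⟩
  rw [torY_eq h hνe hC' (by omega), torY_eq h (by omega) hC (by omega),
    gY_succ_eq_of_lies h hνe ((isLift_iff_lies h hνe hC').1 hL) (by omega)]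

/-- In terms of the slacks `u` and `w` the exponent `Θ` becomes the sum of the exponents of the
successive stages of the count. -/
theorem liftFactor_eq {q u w : ℕ} (hN₁ : N₁ = m k (ν + 2) + k 0 + k (ν + 3) + u)
    (hN₂ : N₂ = m ℓ (ν + 1) + ℓ 0 + ℓ (ν + 2) + w) :
    liftFactor q (ν + 4) N₁ N₂ k ℓ = gauss q (k 0 + k 1) (k 0) * (gauss q (ℓ 0 + ℓ 1) (ℓ 0) *
      (gauss q (u + k (ν + 3)) (k (ν + 3)) * gauss q (w + ℓ (ν + 2)) (ℓ (ν + 2)) *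
        (q : ℚ) ^ ((k 0 * ℓ 1 + (k 0 + ℓ 0) * (N₁ + N₂ - (k 0 + k 1 + ℓ 0 + ℓ 1) - 1) +
          u * ℓ (ν + 2) + (m k (ν + 2) + m ℓ (ν + 1)) * (u + w) : ℤ)))) := by
  have h1 : N₁ - m k (ν + 2) - k 0 = u + k (ν + 3) := by omega
  have h2 : N₂ - m ℓ (ν + 1) - ℓ 0 = w + ℓ (ν + 2) := by omega
  have h3 : Theta (ν + 4) N₁ N₂ k ℓ =
      (k 0 * ℓ 1 + (k 0 + ℓ 0) * (N₁ + N₂ - (k 0 + k 1 + ℓ 0 + ℓ 1) - 1) +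
        u * ℓ (ν + 2) + (m k (ν + 2) + m ℓ (ν + 1)) * (u + w) : ℤ) := by
    have hk1 : m k 1 = k 0 + k 1 := by simp [m, Finset.sum_range_succ]
    have hl1 : m ℓ 1 = ℓ 0 + ℓ 1 := by simp [m, Finset.sum_range_succ]
    rw [hN₁, hN₂]
    simp only [Theta, hk1, hl1, show ν + 4 - 2 = ν + 2 from rfl, show ν + 4 - 3 = ν + 1 from rfl,
      show ν + 4 - 1 = ν + 3 from rfl]
    push_cast
    ring
  rw [liftFactor, show ν + 4 - 2 = ν + 2 from rfl, show ν + 4 - 3 = ν + 1 from rfl,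
    show ν + 4 - 1 = ν + 3 from rfl, h1, h2, h3]
  ring

section Base

variable (h : IsChain γ e) (hodd : Odd (Nat.card (ResidueField R))) (hνe : ν + 4 ≤ e)
  (hk : Admissible N₁ (ν + 4) k) (hℓ : Admissible N₂ (ν + 3) ℓ) (hC : SelfOrthogonal C)
  (hC' : HasType C (merge k) (merge ℓ))
include h hodd hνe hk hℓ hC hC'

theorem ncard_lifts :
    (Set.ncard {C' : Code γ (ν + 4) N₁ N₂ | IsLift k ℓ C C' ∧ SelfOrthogonal C' ∧
      HasType C' k ℓ} : ℚ) = liftFactor qq (ν + 4) N₁ N₂ k ℓ := by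
  have hB := isBase_lat h hodd hνe hC hC'
  obtain ⟨u, hu⟩ := Nat.exists_eq_add_of_le hk.le
  obtain ⟨w, hw⟩ := Nat.exists_eq_add_of_le hℓ.le
  rw [m_succ] at hu hw
  have hN₁ : N₁ = m k (ν + 2) + k 0 + k (ν + 3) + u := by rw [hu]; ring
  have hN₂ : N₂ = m ℓ (ν + 1) + ℓ 0 + ℓ (ν + 2) + w := by rw [hw]; ring
  have hX := (finrank_gX_iff h (by omega)).1
    (finrank_gX h (by omega) hC' (show 0 < ν + 4 - 2 by omega))
  have hY := (finrank_gY_iff h (by omega)).1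
    (finrank_gY h (by omega) hC' (show 0 < ν + 4 - 2 - 1 by omega))
  have hm : ∀ k : ℕ → ℕ, m (merge k) 0 = k 0 + k 1 := fun k => by simp [m, merge]
  rw [hm, Nat.mul_zero, Fs_zero, inf_top_eq] at hX
  rw [hm] at hY
  rw [liftFactor_eq hN₁ hN₂, ← (hB.ncard_over hN₁ hN₂ hX hY).2,
    ← Set.ncard_image_of_injective _ lat_injective]
  congr 2
  ext L'
  simp only [Set.mem_image, Set.mem_ofPred_eq, isLift_and_iff h hνe hC',
    finrank_gX_iff (γ := γ) h (show 0 < e by omega),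
    finrank_gY_iff (γ := γ) h (show 0 < e by omega), Nat.mul_zero, Fs_zero, inf_top_eq]
  constructor
  · rintro ⟨C', h1, rfl⟩
    exact h1
  · intro h1
    exact ⟨L'.map (redM γ (ν + 4)), by rwa [lat_map (by omega) h1.1.le], lat_map (by omega) h1.1.le⟩

/-- `P₁` and `P₂` are pulled back to submodules `Ta` and `Tb`, which prescribe the first layers. The
number of lattices with these layers is positive, so one exists. -/
theorem exists_lift {P₁ : Submodule (ResidueField R) (Fin N₁ → ResidueField R)}
    {P₂ : Submodule (ResidueField R) (Fin N₂ → ResidueField R)}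
    (hP₁ : finrank (ResidueField R) P₁ = k 0) (hP₂ : finrank (ResidueField R) P₂ = ℓ 0)
    (hP₁' : P₁ ≤ gX γ (lat C) 0) (hP₂' : P₂ ≤ gY γ (lat C) 0) :
    ∃ C' : Code γ (ν + 4) N₁ N₂, IsLift k ℓ C C' ∧ SelfOrthogonal C' ∧ HasType C' k ℓ ∧
      gX γ (lat C') 0 = P₁ ∧ gY γ (lat C') 0 = P₂ := by
  have hB := isBase_lat h hodd hνe hC hC'
  obtain ⟨u, hu⟩ := Nat.exists_eq_add_of_le hk.le
  obtain ⟨w, hw⟩ := Nat.exists_eq_add_of_le hℓ.le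
  rw [m_succ] at hu hw
  have hN₁ : N₁ = m k (ν + 2) + k 0 + k (ν + 3) + u := by rw [hu]; ring
  have hN₂ : N₂ = m ℓ (ν + 1) + ℓ 0 + ℓ (ν + 2) + w := by rw [hw]; ring
  have hX := (finrank_gX_iff h (by omega)).1
    (finrank_gX h (by omega) hC' (show 0 < ν + 4 - 2 by omega))
  have hY := (finrank_gY_iff h (by omega)).1
    (finrank_gY h (by omega) hC' (show 0 < ν + 4 - 2 - 1 by omega))
  have hm : ∀ k : ℕ → ℕ, m (merge k) 0 = k 0 + k 1 := fun k => by simp [m, merge]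
  rw [hm, Nat.mul_zero, Fs_zero, inf_top_eq] at hX
  rw [hm] at hY
  have hs0 : ∀ x : Word R N₁ N₂, sc γ 0 0 x = x := fun x =>
    Prod.ext (funext fun t => by rw [sc_fst, pow_zero, one_mul])
      (funext fun t => by rw [sc_snd, pow_zero, one_mul])
  have hs1 : ∀ x : Word R N₁ N₂, resY (sc γ 1 0 x) = resY x := fun x =>
    funext fun t => by rw [resY_apply, sc_snd, pow_zero, one_mul, resY_apply]
  have hs1' : ∀ x : Word R N₁ N₂, sc γ 1 0 x ∈ Fs γ 1 := fun x =>
    mem_Fs_odd (i := 0).2 ⟨fun t => by simp [sc_fst], fun t => by simp⟩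
  have hr1 : ∀ x ∈ (Fs γ 1 : Submodule R (Word R N₁ N₂)), resX x = 0 := fun x hx =>
    (resX_eq_zero h).2 fun t => by simpa using hx.1 t
  have hr2 : ∀ x ∈ (Fs γ 2 : Submodule R (Word R N₁ N₂)), resY x = 0 := fun x hx =>
    (resY_eq_zero h).2 fun t => by simpa using hx.2 t
  have h12 : (Fs γ 2 : Submodule R (Word R N₁ N₂)) ≤ Fs γ 1 := Fs_antitone (by omega)
  set Ta : Submodule R (Word R N₁ N₂) := lat C ⊓ P₁.comap resX with hTa
  set Tb : Submodule R (Word R N₁ N₂) := (lat C ⊓ Fs γ 1) ⊓ P₂.comap resY with hTb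
  have h1 : lat C ⊓ Fs γ 1 ≤ Ta := inf_le_inf_left _ fun x hx => by
    rw [Submodule.mem_comap, hr1 x hx]; exact zero_mem _
  have h2 : lat C ⊓ Fs γ 2 ≤ Tb := le_inf (inf_le_inf_left _ h12) fun x hx => by
    rw [Submodule.mem_comap, hr2 x hx.2]; exact zero_mem _
  have hgX : gX γ Ta 0 = P₁ := by
    apply le_antisymm
    · rintro _ ⟨x, hx, rfl⟩
      change sc γ 0 0 x ∈ Ta at hx
      rw [hs0] at hx
      exact hx.2
    · intro v hv
      obtain ⟨x, hx, rfl⟩ := hP₁' hv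
      refine ⟨x, ⟨hx, ?_⟩, rfl⟩
      change sc γ 0 0 x ∈ P₁.comap resX
      rw [hs0]
      exact hv
  have hgY : gY γ Tb 0 = P₂ := by
    apply le_antisymm
    · rintro _ ⟨x, hx, rfl⟩
      have := hx.2
      change resY (sc γ 1 0 x) ∈ P₂ at this
      rwa [hs1] at this
    · intro v hv
      obtain ⟨x, hx, rfl⟩ := hP₂' hv
      refine ⟨x, ⟨⟨hx, hs1' x⟩, ?_⟩, rfl⟩
      change resY (sc γ 1 0 x) ∈ P₂
      rwa [hs1]
  have h3 : Nat.card Ta = qq ^ k 0 *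
      Nat.card (lat C ⊓ Fs γ 1 : Submodule R (Word R N₁ N₂)) := by
    have h4 := (finrank_gX_iff (L := Ta) h (show 0 < e by omega)).1 (hgX ▸ hP₁)
    have h5 : Ta ⊓ Fs γ 1 = lat C ⊓ Fs γ 1 :=
      le_antisymm (inf_le_inf_right _ inf_le_left) (le_inf h1 inf_le_right)
    rwa [Nat.mul_zero, Fs_zero, inf_top_eq, h5] at h4
  have h4 : Nat.card Tb = qq ^ ℓ 0 *
      Nat.card (lat C ⊓ Fs γ 2 : Submodule R (Word R N₁ N₂)) := by
    have h4 := (finrank_gY_iff (L := Tb) h (show 0 < e by omega)).1 (hgY ▸ hP₂)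
    have h5 : Tb ⊓ Fs γ 2 = lat C ⊓ Fs γ 2 :=
      le_antisymm (inf_le_inf_right _ (inf_le_left.trans inf_le_left)) (le_inf h2 inf_le_right)
    have h6 : Tb ⊓ Fs γ 1 = Tb := inf_eq_left.2 (inf_le_left.trans inf_le_right)
    rwa [Nat.mul_zero, Nat.zero_add, Nat.zero_add, h5, h6] at h4
  have hcount := (hB.ncard_over hN₁ hN₂ hX hY).1 Ta Tb h1 inf_le_left h2 inf_le_left h3 h4
  have hq := one_lt_card_residueField (R := R)
  have hpos : (0 : ℚ) < Set.ncard {L' : Submodule R (Word R N₁ N₂) |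
      IsOver γ ν (m k (ν + 2)) (m ℓ (ν + 1)) (k (ν + 3)) (ℓ (ν + 2)) (lat C) L' ∧
        L' ⊔ (lat C ⊓ Fs γ 1) = Ta ∧ (L' ⊓ Fs γ 1) ⊔ (lat C ⊓ Fs γ 2) = Tb} := by
    rw [hcount]
    exact mul_pos (mul_pos (gauss_pos hq (by omega)) (gauss_pos hq (by omega)))
      (zpow_pos (by exact_mod_cast Nat.card_pos) _)
  obtain ⟨L', hL', hTa', hTb'⟩ := Set.nonempty_of_ncard_ne_zero (by exact_mod_cast hpos.ne')
  have hlat : lat (L'.map (redM γ (ν + 4))) = L' := lat_map (by omega) hL'.le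
  have hX' : gX γ L' 0 = P₁ := by
    refine le_antisymm ((gX_mono (le_sup_left.trans hTa'.le) 0).trans hgX.le) fun v hv => ?_
    rw [← hgX] at hv
    obtain ⟨x, hx, rfl⟩ := hv
    change sc γ 0 0 x ∈ Ta at hx
    rw [hs0, ← hTa'] at hx
    obtain ⟨y, hy, z, hz, rfl⟩ := Submodule.mem_sup.1 hx
    refine ⟨y, ?_, ?_⟩
    · change sc γ 0 0 y ∈ L'
      rwa [hs0]
    · rw [map_add, hr1 z hz.2, add_zero]
  have hY' : gY γ L' 0 = P₂ := by
    apply le_antisymm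
    · rintro _ ⟨x, hx, rfl⟩
      have : sc γ 1 0 x ∈ Tb := hTb' ▸ Submodule.mem_sup_left ⟨hx, hs1' x⟩
      rw [← hs1]
      exact this.2
    · intro v hv
      rw [← hgY] at hv
      obtain ⟨x, hx, rfl⟩ := hv
      change sc γ 1 0 x ∈ Tb at hx
      rw [← hTb'] at hx
      obtain ⟨y, hy, z, hz, hyz⟩ := Submodule.mem_sup.1 hx
      choose c hc using fun t => (mem_Fs_odd (i := 0).1 hy.2).1 t
      have hcy : sc γ 1 0 (c, y.2) = y :=
        Prod.ext (funext fun t => (hc t).symm) (funext fun t => by rw [sc_snd, pow_zero, one_mul])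
      refine ⟨(c, y.2), ?_, ?_⟩
      · change sc γ 1 0 (c, y.2) ∈ L'
        rw [hcy]
        exact hy.1
      · rw [← hs1, hcy, ← hs1 x, ← hyz, map_add, hr2 z hz.2, add_zero]
  refine ⟨L'.map (redM γ (ν + 4)), ?_⟩
  have key := (isLift_and_iff (C' := L'.map (redM γ (ν + 4))) h hνe hC').2
    (by rw [hlat]; exact ⟨hL', hX' ▸ hP₁, hY' ▸ hP₂⟩)
  rw [hlat]
  exact ⟨key.1, key.2.1, key.2.2, hX', hY'⟩

end Base

/-- The code over `R_{ν+2}` that a code over `R_{ν+4}` lifts. -/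
def reduce (C' : Code γ (ν + 4) N₁ N₂) : Code γ (ν + 4 - 2) N₁ N₂ :=
  (((lat C' ⊓ Fs γ 2) ⊔ Fs γ (2 * ν + 5)).comap (LinearMap.lsmul R (Word R N₁ N₂) γ)).map
    (redM γ (ν + 4 - 2))

theorem lat_reduce (C' : Code γ (ν + 4) N₁ N₂) :
    lat (reduce C') = ((lat C' ⊓ Fs γ 2) ⊔ Fs γ (2 * ν + 5)).comap
      (LinearMap.lsmul R (Word R N₁ N₂) γ) :=
  lat_map (by omega) fun _ hx => Submodule.mem_sup_right
    (Fs_antitone (show 2 * ν + 5 ≤ 2 * (ν + 4 - 2) - 1 + 2 by omega) (smul_mem_Fs hx))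

/-- The left side lies in `Fs γ 2`, where every word is `γ` times another, so dividing by `γ` and
multiplying back loses nothing. -/
theorem gm_lat_reduce (C' : Code γ (ν + 4) N₁ N₂) :
    (lat C' ⊓ Fs γ 2) ⊔ Fs γ (2 * ν + 5) = gm γ (lat (reduce C')) := by
  rw [lat_reduce]
  apply le_antisymm
  · intro x hx
    have h2 : x ∈ Fs γ (0 + 2) :=
      (sup_le inf_le_right (Fs_antitone (by omega)) : _ ≤ Fs γ (0 + 2)) hx
    obtain ⟨y, -, rfl⟩ := exists_smul_of_mem_Fs h2
    exact smul_mem_gm hx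
  · rintro _ ⟨y, hy, rfl⟩
    exact hy

/-- `γ ^ 2 * bil γ x y` is the pairing of `γ x` and `γ y`. Up to pairings with `Fs γ (2 * ν + 5)`,
which is orthogonal to `Fs γ 2` modulo `γ ^ (ν + 4)`, it is a pairing within `lat C'`; then `γ ^ 2`
is cancelled. -/
theorem selfOrthogonal_reduce (h : IsChain γ e) (hνe : ν + 4 ≤ e) (hC' : SelfOrthogonal C') :
    SelfOrthogonal (reduce C') := by
  rw [selfOrthogonal_iff] at hC' ⊢
  intro x hx y hy
  rw [lat_reduce] at hx hy
  obtain ⟨a, ha, f, hf, haf⟩ := Submodule.mem_sup.1 hx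
  obtain ⟨b, hb, g, hg, hbg⟩ := Submodule.mem_sup.1 hy
  refine h.dvd_of_pow_mul (a := 2) ?_ (by omega)
  have h1 : γ ^ 2 * bil γ x y = bil γ (a + f) (b + g) := by
    rw [haf, hbg]
    change _ = bil γ (γ • x) (γ • y)
    rw [map_smul, map_smul, LinearMap.smul_apply, smul_eq_mul, smul_eq_mul]
    ring
  rw [h1, map_add, map_add, LinearMap.add_apply, LinearMap.add_apply]
  exact dvd_add (dvd_add ((pow_dvd_pow γ (by omega)).trans (hC' a ha.1 b hb.1))
    (pow_dvd_bil hf hb.2 (by omega)))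
    (dvd_add (pow_dvd_bil ha.2 hg (by omega)) (pow_dvd_bil hf hg (by omega)))

theorem hasType_reduce (h : IsChain γ e) (hνe : ν + 4 ≤ e) (hC' : HasType C' k ℓ) :
    HasType (reduce C') (merge k) (merge ℓ) := by
  refine (hasType_iff h (by omega) (by omega)).2 ⟨fun i hi => ?_, fun j hj => ?_⟩
  · rw [← gX_succ_eq_of_lies h hνe (gm_lat_reduce C') (by omega), m_merge]
    exact finrank_gX h hνe hC' (by omega)
  · rw [← gY_succ_eq_of_lies h hνe (gm_lat_reduce C') (by omega), m_merge]
    exact finrank_gY h hνe hC' (by omega)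

/-- The fibre of `reduce` over `C` consists of the self-orthogonal lifts of `C` of the given type,
and its size does not depend on `C`. -/
theorem numSelfOrthogonal_eq (h : IsChain γ e) (hodd : Odd qq) (hνe : ν + 4 ≤ e)
    (hk : Admissible N₁ (ν + 4) k) (hℓ : Admissible N₂ (ν + 3) ℓ) :
    (numSelfOrthogonal γ (ν + 4) N₁ N₂ k ℓ : ℚ) =
      numSelfOrthogonal γ (ν + 4 - 2) N₁ N₂ (merge k) (merge ℓ) *
        liftFactor qq (ν + 4) N₁ N₂ k ℓ := by
  have hfin : ∀ n, Finite (Code γ n N₁ N₂) := fun n =>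
    Finite.of_injective lat lat_injective
  refine ncard_eq_mul_of_fibers_rat
    (S := {C' : Code γ (ν + 4) N₁ N₂ | SelfOrthogonal C' ∧ HasType C' k ℓ})
    (T := {C : Code γ (ν + 4 - 2) N₁ N₂ | SelfOrthogonal C ∧ HasType C (merge k) (merge ℓ)}) reduce
    (fun C' hC' => ⟨selfOrthogonal_reduce h hνe hC'.1, hasType_reduce h hνe hC'.2⟩) ?_
  rintro C ⟨hC, hC'⟩
  rw [← ncard_lifts h hodd hνe hk hℓ hC hC']
  congr 2
  ext C'
  constructor
  · rintro ⟨⟨h1, h2⟩, rfl⟩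
    exact ⟨(isLift_iff_lies h hνe h2).2 (gm_lat_reduce C'), h1, h2⟩
  · rintro ⟨h1, h2, h3⟩
    exact ⟨⟨h2, h3⟩, eq_of_gm_lat_eq h (by omega) (by omega)
      ((gm_lat_reduce C').symm.trans ((isLift_iff_lies h hνe h3).1 h1))⟩

end Counting

end MixedChain

theorem proposition4p10 {R : Type*} [CommRing R] [IsLocalRing R] [Finite R] (γ : R)
    (e q μ N₁ N₂ : ℕ)
    (hmax : IsLocalRing.maximalIdeal R = Ideal.span {γ})
    (hnil : γ ^ e = 0) (hnil' : γ ^ (e - 1) ≠ 0)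
    (hq : Nat.card (IsLocalRing.ResidueField R) = q) (hodd : Odd q)
    (hμ : 4 ≤ μ) (hμe : μ ≤ e) (hN₁ : 0 < N₁) (hN₂ : 0 < N₂)
    (k ℓ : ℕ → ℕ) (hk : MixedChain.Admissible N₁ μ k) (hℓ : MixedChain.Admissible N₂ (μ - 1) ℓ) :
    (∀ C : MixedChain.Code γ (μ - 2) N₁ N₂, MixedChain.SelfOrthogonal C →
      MixedChain.HasType C (MixedChain.merge k) (MixedChain.merge ℓ) →
      (∀ (P₁ : Submodule (IsLocalRing.ResidueField R) (Fin N₁ → IsLocalRing.ResidueField R))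
          (P₂ : Submodule (IsLocalRing.ResidueField R) (Fin N₂ → IsLocalRing.ResidueField R)),
        Module.finrank (IsLocalRing.ResidueField R) P₁ = k 0 →
        Module.finrank (IsLocalRing.ResidueField R) P₂ = ℓ 0 →
        (P₁ : Set (Fin N₁ → IsLocalRing.ResidueField R)) ⊆ MixedChain.torX C 1 →
        (P₂ : Set (Fin N₂ → IsLocalRing.ResidueField R)) ⊆ MixedChain.torY C 1 →
        ∃ C' : MixedChain.Code γ μ N₁ N₂, MixedChain.IsLift k ℓ C C' ∧
          MixedChain.SelfOrthogonal C' ∧ MixedChain.HasType C' k ℓ ∧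
          MixedChain.torX C' 1 = P₁ ∧ MixedChain.torY C' 1 = P₂ ∧
          (∀ i, 1 ≤ i → i ≤ μ - 2 → MixedChain.torX C' (i + 1) = MixedChain.torX C i) ∧
          (∀ j, 1 ≤ j → j ≤ μ - 3 → MixedChain.torY C' (j + 1) = MixedChain.torY C j)) ∧
      (Set.ncard {C' : MixedChain.Code γ μ N₁ N₂ | MixedChain.IsLift k ℓ C C' ∧
          MixedChain.SelfOrthogonal C' ∧ MixedChain.HasType C' k ℓ ∧
          (∀ i, 1 ≤ i → i ≤ μ - 2 → MixedChain.torX C' (i + 1) = MixedChain.torX C i) ∧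
          (∀ j, 1 ≤ j → j ≤ μ - 3 → MixedChain.torY C' (j + 1) = MixedChain.torY C j)} : ℚ) =
        MixedChain.liftFactor q μ N₁ N₂ k ℓ) ∧
    (MixedChain.numSelfOrthogonal γ μ N₁ N₂ k ℓ : ℚ) =
      MixedChain.numSelfOrthogonal γ (μ - 2) N₁ N₂ (MixedChain.merge k) (MixedChain.merge ℓ) *
        MixedChain.liftFactor q μ N₁ N₂ k ℓ := by
  obtain ⟨ν, rfl⟩ := Nat.exists_eq_add_of_le' hμ
  subst hq
  have h : MixedChain.IsChain γ e := ⟨hmax, hnil, hnil'⟩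
  refine ⟨fun C hC hC' => ⟨fun P₁ P₂ hP₁ hP₂ hP₁' hP₂' => ?_, ?_⟩,
    MixedChain.numSelfOrthogonal_eq h hodd hμe hk hℓ⟩
  · rw [MixedChain.torX_eq (i := 0) h (by omega) hC' (by omega)] at hP₁'
    rw [MixedChain.torY_eq (j := 0) h (by omega) hC' (by omega)] at hP₂'
    obtain ⟨C', h1, h2, h3, h4, h5⟩ :=
      MixedChain.exists_lift h hodd hμe hk hℓ hC hC' hP₁ hP₂ hP₁' hP₂'
    refine ⟨C', h1, h2, h3, ?_, ?_, fun i hi hi' => h1.torX_succ h hμe hC' h3 hi hi',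
      fun j hj hj' => h1.torY_succ h hμe hC' h3 hj hj'⟩
    · rw [MixedChain.torX_eq (i := 0) h hμe h3 (by omega), h4]
    · rw [MixedChain.torY_eq (j := 0) h hμe h3 (by omega), h5]
  -- The torsion conditions cut out nothing: every lift of this type satisfies them.
  · rw [← MixedChain.ncard_lifts h hodd hμe hk hℓ hC hC']
    congr 2
    ext C'
    constructor
    · rintro ⟨h1, h2, h3, -⟩
      exact ⟨h1, h2, h3⟩
    · rintro ⟨h1, h2, h3⟩
      exact ⟨h1, h2, h3, fun i hi hi' => h1.torX_succ h hμe hC' h3 hi hi',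
        fun j hj hj' => h1.torY_succ h hμe hC' h3 hj hj'⟩
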